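/- **Setting.** Let $p,d,n\ge 1$, $r=dp$, $0\ne q\in\mathbb C$, let $\xi$ be a primitive $p$-th root of unity, and let $v_0,\dots,v_{d-1}\in\mathbb C^{\times}$ satisfy $v_i^p\neq v_j^p$ for $i\ne j$. Put $u_{lp+k+1}=\xi^k v_l$ ($0\le k<p$, $0\le l<d$). Let $\mathcal H=\mathcal H_{r,1,n}(u_1,\dots,u_r,q)$ be the $\mathbb C$-algebra generated by $T_1,\dots,T_n$ with relations $T_iT_j=T_jT_i$ ($|i-j|>1$), $T_iT_{i+1}T_i=T_{i+1}T_iT_{i+1}$ ($2\le i\le n-1$), $T_1T_2T_1T_2=T_2T_1T_2T_1$, $\prod_{j=1}^r(T_1-u_j)=0$, $(T_i-1)(T_i+q)=0$ ($i\ge 2$), and let $\mathcal H'=\mathcal H_{r,p,n}$ be its subalgebra generated by $T_1^p$, $T_1^{-1}T_2T_1$, $T_2,\dots,T_n$. Assume that $\mathcal H$ is semisimple. The cyclic group $G=\langle\tau\rangle\cong\mathbb Z/p$ acts on $\mathcal H$ by algebra automorphisms, $\tau(T_1)=\xi T_1$, $\tau(T_i)=T_i$ for $i\ge2$; it fixes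 $\mathcal H'$ elementwise. For an $r$-tuple $\lambda=(\lambda^i_j)_{i\in\mathbb Z/p,\,0\le j<d}$ of Young diagrams of total size $n$ let $V(\lambda)$ be the vector space with basis $v(t)$, $t$ a standard tableau of shape $\lambda$. The group $G$ also acts on such tuples, $\tau$ acting as $\mathrm{shift}(\lambda)=(\lambda^{i+1}_j)$, and similarly on tableaux; let $G_\lambda$ be the stabilizer of $\lambda$, $\bar\lambda$ its orbit and $e_\lambda=p/|\bar\lambda|$. For a 2-cocycle $\alpha:G_\lambda\times G_\lambda\to\mathbb C^\times$ let $(\mathbb CG_\lambda)_\alpha$ be the algebra with basis $c_g$ and $c_gc_h=\alpha(g,h)c_{gh}$, and let $\mathcal H\rtimes_\alpha G_\lambda$ be the crossed product, consisting of sums $\sum_g r_g\,g$ with $(r\,g)(s\,h)=\alpha(g,h)\,r\,g(s)\,gh$. For $\alpha=1$ it is $\mathcal H\rtimes G_\lambda$. Since $G_\lambda$ fixes $\mathcal H'$, one has $\mathcal H'\rtimes_\alpha G_\lambda\cong \mathcal H'\otimes(\mathbb CG_\lambda)_\alpha$, and it acts on $M\otimes N$ for every $\mathcal H'$-module $M$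 and $(\mathbb CG_\lambda)_\alpha$-module $N$. **Theorem.** (1) There are $\mathcal H$-module structures on all the $V(\lambda)$ for which the generators act by the seminormal formulas: $T_1v(t)=\xi^iv_j\,v(t)$ if the number $1$ lies in the component $(i,j)$ of $t$, and for $m\ge2$ $$T_m v(t)=x\,v(t)+(1-x)\,v(s\,t),$$ where $s\,t$ is $t$ with $m-1$ and $m$ exchanged, $v(s\,t)=0$ if $s\,t$ is not standard, and $x$ is as follows. Let $c,c'$ be the contents (column minus row) of $m-1$, $m$ in $t$, and let $w,w'$ be the numbers $\xi^iv_j$ belonging to their components $(i,j)$. If the components coincide, $x=1/[c'-c]_q$, with $[k]_q=(q^k-1)/(q-1)$ and $[k]_1=k$; otherwise $x=(q-1)b/(a-b)$ with $a=wq^{-c}$, $b=w'q^{-c'}$. The module $V(\lambda)$ is simple. It becomes an $\mathcal H\rtimes G_\lambda$-module when $\tau^k\in G_\lambda$ acts by $v(t)\mapsto v(\mathrm{shift}^k t)$. (2) For $l\in\mathbb N$ let $V(\bar\lambda,l)\subseteq V(\lambda)$ be the space of vectors on which $\mathrm{shift}^k$ acts as $\xi^{kl}$ for every $\tau^k\in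 G_\lambda$. It is an $\mathcal H'$-submodule which up to isomorphism depends only on $\bar\lambda$ and $l$, and $V(\bar\lambda,1),\dots,V(\bar\lambda,e_\lambda)$ are irreducible and pairwise non-isomorphic. (3) Let $\alpha$ be any 2-cocycle on $G_\lambda$ and let $V(\lambda)$ be given any $\mathcal H\rtimes_\alpha G_\lambda$-module structure that extends its $\mathcal H$-module structure. Then the simple $(\mathbb CG_\lambda)_{\alpha^{-1}}$-modules, up to isomorphism, can be listed without repetition as $\pi_1,\dots,\pi_{e_\lambda}$ in such a way that $$V(\lambda)\;\cong\;\bigoplus_{l=1}^{e_\lambda}V(\bar\lambda,l)\otimes(\pi_l)^{*}$$ as $\mathcal H'\rtimes_\alpha G_\lambda$-modules. Here $(\pi_l)^*$ is the dual space, a $(\mathbb CG_\lambda)_\alpha$-module by $(c_gf)(m)=f(c_g^{-1}m)$. In particular, with $\alpha=1$, this holds for $V(\lambda)$ as an $\mathcal H\rtimes G_\lambda$-module. -/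

import Mathlib

open Polynomial
open scoped TensorProduct DirectSum

noncomputable section

namespace CyclotomicHecke

/-! ### Crossed products, twisted group algebras and their modules -/

section Crossed

/-- A `ℂˣ`-valued two-cocycle (factor set) on `G`, for the trivial action of `G` on `ℂˣ`. -/
@[ext] structure TwoCocycle (G : Type*) [Group G] where
  toFun : G → G → ℂˣ
  cocycle : ∀ g h k, toFun g h * toFun (g * h) k = toFun h k * toFun g (h * k)

namespace TwoCocycle

variable {G : Type*} [Group G]

instance : CoeFun (TwoCocycle G) (fun _ => G → G → ℂˣ) := ⟨TwoCocycle.toFun⟩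

/-- The trivial cocycle. -/
instance : One (TwoCocycle G) := ⟨⟨fun _ _ => 1, fun _ _ _ => rfl⟩⟩

/-- The pointwise inverse `α⁻¹` of a cocycle. -/
instance : Inv (TwoCocycle G) :=
  ⟨fun α => ⟨fun g h => (α g h)⁻¹, fun g h k => by
    have := congrArg (fun x : ℂˣ => x⁻¹) (α.cocycle g h k)
    simpa only [mul_inv] using this⟩⟩

lemma one_left (α : TwoCocycle G) (k : G) : α 1 k = α 1 1 := by
  have := α.cocycle 1 1 k
  simp only [one_mul] at this
  exact (mul_right_cancel this).symm

lemma one_right (α : TwoCocycle G) (k : G) : α k 1 = α 1 1 := by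
  have := α.cocycle k 1 1
  simp only [mul_one] at this
  exact mul_right_cancel this

lemma inv_comm (α : TwoCocycle G) (g : G) : α g⁻¹ g = α g g⁻¹ := by
  have := α.cocycle g g⁻¹ g
  simp only [mul_inv_cancel, inv_mul_cancel, one_left, one_right] at this
  exact (mul_right_cancel this).symm

lemma inv_apply (α : TwoCocycle G) (g h : G) : (α⁻¹ : TwoCocycle G) g h = (α g h)⁻¹ := rfl

lemma one_apply (g h : G) : (1 : TwoCocycle G) g h = 1 := rfl

end TwoCocycle

variable {R G : Type*} [Ring R] [Algebra ℂ R] [Group G]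

/-- The (twisted) skew group algebra `R ⋊_α G`: finite formal sums `∑ r_g g` with
`(r g) (s h) = α(g, h) r θ_g(s) gh`. For `α = 1` it is the skew group ring `R ⋊ G`. -/
def CrossedProduct (_θ : G →* (R ≃ₐ[ℂ] R)) (_α : TwoCocycle G) : Type _ := G →₀ R

namespace CrossedProduct

variable (θ : G →* (R ≃ₐ[ℂ] R)) (α : TwoCocycle G)

instance : AddCommGroup (CrossedProduct θ α) := inferInstanceAs (AddCommGroup (G →₀ R))
instance : Module ℂ (CrossedProduct θ α) := inferInstanceAs (Module ℂ (G →₀ R))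

/-- The element `r g` of `R ⋊_α G`. -/
def single (g : G) (r : R) : CrossedProduct θ α := Finsupp.single g r

/-- Multiplication on homogeneous elements: `(r, s) ↦ α(g, h) r θ_g(s) gh`. -/
def homMul (g h : G) : R →ₗ[ℂ] R →ₗ[ℂ] (G →₀ R) :=
  ((LinearMap.mul ℂ R).compl₂ (θ g).toLinearMap).compr₂
    ((α g h : ℂ) • Finsupp.lsingle (g * h))

/-- The bilinear multiplication of `R ⋊_α G`. -/
def mulLin : (G →₀ R) →ₗ[ℂ] (G →₀ R) →ₗ[ℂ] (G →₀ R) :=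
  Finsupp.lsum ℂ fun g => (Finsupp.lsum ℂ fun h => (homMul θ α g h).flip).flip

instance : Mul (CrossedProduct θ α) := ⟨fun a b => mulLin θ α a b⟩
instance : One (CrossedProduct θ α) :=
  ⟨single θ α 1 (algebraMap ℂ R ((α 1 1)⁻¹ : ℂˣ))⟩

variable {θ α}

lemma single_mul_single (g h : G) (r s : R) :
    single θ α g r * single θ α h s = single θ α (g * h) ((α g h : ℂ) • (r * θ g s)) := by
  change mulLin θ α (Finsupp.single g r) (Finsupp.single h s) = Finsupp.single _ _
  simp only [mulLin, homMul, Finsupp.lsum_single, LinearMap.flip_apply, LinearMap.compr₂_apply,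
    LinearMap.compl₂_apply, LinearMap.mul_apply', LinearMap.smul_apply, Finsupp.lsingle_apply,
    AlgEquiv.toLinearMap_apply, Finsupp.smul_single]

lemma smul_single (c : ℂ) (g : G) (r : R) :
    c • single θ α g r = single θ α g (c • r) := by
  change c • Finsupp.single g r = Finsupp.single g (c • r)
  exact Finsupp.smul_single c g r

lemma one_def : (1 : CrossedProduct θ α) =
    single θ α 1 (algebraMap ℂ R ((α 1 1)⁻¹ : ℂˣ)) := rfl

lemma add_mul_aux (a b c : CrossedProduct θ α) : (a + b) * c = a * c + b * c := by
  change mulLin θ α (a + b) c = mulLin θ α a c + mulLin θ α b c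
  exact LinearMap.map_add₂ (mulLin θ α) a b c

lemma mul_add_aux (a b c : CrossedProduct θ α) : a * (b + c) = a * b + a * c :=
  map_add (mulLin θ α a) b c

lemma zero_mul_aux (a : CrossedProduct θ α) : 0 * a = 0 :=
  LinearMap.map_zero₂ (mulLin θ α) a

lemma mul_zero_aux (a : CrossedProduct θ α) : a * 0 = 0 :=
  map_zero (mulLin θ α a)

lemma smul_mul_aux (c : ℂ) (a b : CrossedProduct θ α) : (c • a) * b = c • (a * b) :=
  LinearMap.map_smul₂ (mulLin θ α) c a b

lemma mul_smul_aux (c : ℂ) (a b : CrossedProduct θ α) : a * (c • b) = c • (a * b) :=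
  map_smul (mulLin θ α a) c b

lemma induction {P : CrossedProduct θ α → Prop} (a : CrossedProduct θ α) (h0 : P 0)
    (hadd : ∀ a b, P a → P b → P (a + b)) (hs : ∀ g r, P (single θ α g r)) : P a :=
  Finsupp.induction_linear (motive := P) a h0 hadd hs

lemma mul_assoc_aux (a b c : CrossedProduct θ α) : a * b * c = a * (b * c) := by
  induction a using induction with
  | h0 => simp only [zero_mul_aux]
  | hadd a b ha hb => simp only [add_mul_aux, ha, hb]
  | hs g r =>
  induction b using induction with
  | h0 => simp only [zero_mul_aux, mul_zero_aux]
  | hadd a b ha hb => simp only [add_mul_aux, mul_add_aux, ha, hb]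
  | hs h s =>
  induction c using induction with
  | h0 => simp only [mul_zero_aux]
  | hadd a b ha hb => simp only [mul_add_aux, ha, hb]
  | hs k t =>
    have h2 : ((α g h : ℂ) * α (g * h) k) = (α h k : ℂ) * α g (h * k) := by
      exact_mod_cast congrArg Units.val (α.cocycle g h k)
    simp only [single_mul_single, map_smul, map_mul, smul_mul_assoc, mul_smul_comm, smul_smul,
      mul_assoc, AlgEquiv.mul_apply]
    rw [mul_comm (α (g * h) k : ℂ), mul_comm (α g (h * k) : ℂ), h2]

instance : Ring (CrossedProduct θ α) where
  __ := (inferInstance : AddCommGroup (CrossedProduct θ α))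
  left_distrib := mul_add_aux
  right_distrib := add_mul_aux
  zero_mul := zero_mul_aux
  mul_zero := mul_zero_aux
  mul_assoc := mul_assoc_aux
  one_mul a := by
    induction a using induction with
    | h0 => simp only [mul_zero_aux]
    | hadd a b ha hb => simp only [mul_add_aux, ha, hb]
    | hs g r =>
      rw [one_def, single_mul_single, TwoCocycle.one_left]
      simp [Algebra.algebraMap_eq_smul_one, smul_smul]
  mul_one a := by
    induction a using induction with
    | h0 => simp only [zero_mul_aux]
    | hadd a b ha hb => simp only [add_mul_aux, ha, hb]
    | hs g r =>
      rw [one_def, single_mul_single, TwoCocycle.one_right, AlgEquiv.commutes]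
      simp [Algebra.algebraMap_eq_smul_one, smul_smul]

instance : Algebra ℂ (CrossedProduct θ α) :=
  Algebra.ofModule smul_mul_aux mul_smul_aux

end CrossedProduct

/-- The twisted group algebra `(ℂG)_α`, with basis `c_g` and `c_g c_h = α(g, h) c_{gh}`. -/
abbrev TwistedGroupAlgebra (α : TwoCocycle G) : Type _ :=
  CrossedProduct (1 : G →* (ℂ ≃ₐ[ℂ] ℂ)) α

/-- The basis element `c_g` of `(ℂG)_α`, as a unit. -/
def TwistedGroupAlgebra.basisUnit (α : TwoCocycle G) (g : G) : (TwistedGroupAlgebra α)ˣ where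
  val := CrossedProduct.single _ α g 1
  inv := CrossedProduct.single _ α g⁻¹ (((α g g⁻¹)⁻¹ * (α 1 1)⁻¹ : ℂˣ) : ℂ)
  val_inv := by
    rw [CrossedProduct.single_mul_single, CrossedProduct.one_def]
    simp
  inv_val := by
    rw [CrossedProduct.single_mul_single, CrossedProduct.one_def, TwoCocycle.inv_comm]
    simp

/-- The vector space `W` on which an algebra `A` acts through `ρ`, regarded as an `A`-module. -/
def RepSpace {A W : Type*} [Ring A] [Algebra ℂ A] [AddCommGroup W] [Module ℂ W]
    (_ρ : A →ₐ[ℂ] Module.End ℂ W) : Type _ := W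

namespace RepSpace

variable {A W : Type*} [Ring A] [Algebra ℂ A] [AddCommGroup W] [Module ℂ W]
  (ρ : A →ₐ[ℂ] Module.End ℂ W)

instance : AddCommGroup (RepSpace ρ) := inferInstanceAs (AddCommGroup W)
instance : Module ℂ (RepSpace ρ) := inferInstanceAs (Module ℂ W)
instance : Module A (RepSpace ρ) := Module.compHom W (ρ : A →+* Module.End ℂ W)

/-- The identity map `RepSpace ρ → W`. -/
def toSpace : RepSpace ρ ≃ₗ[ℂ] W := LinearEquiv.refl ℂ W

lemma toSpace_smul (a : A) (x : RepSpace ρ) : toSpace ρ (a • x) = ρ a (toSpace ρ x) := rfl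

instance : IsScalarTower ℂ A (RepSpace ρ) := ⟨fun c a x => by
  apply (toSpace ρ).injective
  simp only [toSpace_smul, map_smul, LinearMap.smul_apply]⟩

end RepSpace

/-- The data of an `R ⋊_α G`-module structure on a vector space `W`: an action of `R` and
invertible operators `φ_g` with `φ_g φ_h = α(g, h) φ_{gh}` and `φ_g r = θ_g(r) φ_g`. -/
structure CovariantRep (θ : G →* (R ≃ₐ[ℂ] R)) (α : TwoCocycle G)
    (W : Type*) [AddCommGroup W] [Module ℂ W] where
  act : R →ₐ[ℂ] Module.End ℂ W
  op : G → (W ≃ₗ[ℂ] W)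
  op_mul : ∀ g h w, op g (op h w) = (α g h : ℂ) • op (g * h) w
  op_act : ∀ g r w, op g (act r w) = act (θ g r) (op g w)

namespace CovariantRep

variable {θ : G →* (R ≃ₐ[ℂ] R)} {α : TwoCocycle G}
  {W : Type*} [AddCommGroup W] [Module ℂ W]

lemma op_one (F : CovariantRep θ α W) (w : W) : F.op 1 w = (α 1 1 : ℂ) • w := by
  apply (F.op 1).injective
  rw [F.op_mul, map_smul, one_mul]

/-- The linear map underlying the action: `r g` acts as `r φ_g`. -/
def toLin (F : CovariantRep θ α W) : CrossedProduct θ α →ₗ[ℂ] Module.End ℂ W :=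
  Finsupp.lsum ℂ fun g =>
    (LinearMap.mulRight ℂ ((F.op g : W →ₗ[ℂ] W) : Module.End ℂ W)) ∘ₗ F.act.toLinearMap

lemma toLin_single (F : CovariantRep θ α W) (g : G) (r : R) (w : W) :
    F.toLin (CrossedProduct.single θ α g r) w = F.act r (F.op g w) := by
  change (Finsupp.lsum ℂ _ (Finsupp.single g r) : Module.End ℂ W) w = _
  rw [Finsupp.lsum_single]
  rfl

/-- The resulting algebra homomorphism `R ⋊_α G → End(W)`. -/
def toHom (F : CovariantRep θ α W) : CrossedProduct θ α →ₐ[ℂ] Module.End ℂ W :=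
  AlgHom.ofLinearMap F.toLin
    (by
      ext w
      rw [CrossedProduct.one_def, toLin_single, op_one, AlgHom.commutes]
      simp [Module.algebraMap_end_apply, smul_smul])
    (fun a b => by
      induction a using CrossedProduct.induction with
      | h0 => simp
      | hadd a b ha hb => simp only [add_mul, map_add, ha, hb]
      | hs g r =>
      induction b using CrossedProduct.induction with
      | h0 => simp
      | hadd a b ha hb => simp only [mul_add, map_add, ha, hb]
      | hs h s =>
        ext w
        simp only [CrossedProduct.single_mul_single, toLin_single, Module.End.mul_apply, map_smul,
          map_mul, LinearMap.smul_apply, F.op_act, F.op_mul])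

/-- `W` as an `R ⋊_α G`-module. -/
abbrev Space (F : CovariantRep θ α W) : Type _ := RepSpace F.toHom

/-- Restriction of an `R ⋊_α G`-module to `S ⋊_α G`, for a subalgebra `S` of `R` on which `G`
acts trivially. -/
def restrictFixed (F : CovariantRep θ α W) (S : Subalgebra ℂ R)
    (hS : ∀ g, ∀ s ∈ S, θ g s = s) :
    CovariantRep (1 : G →* (S ≃ₐ[ℂ] S)) α W where
  act := F.act.comp S.val
  op := F.op
  op_mul := F.op_mul
  op_act g r w := by
    have h := F.op_act g r w
    rw [hS g r r.2] at h
    exact h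

/-- The outer tensor product `M ⊗ N` of an `S`-module `M` and a `(ℂG)_α`-module `N`, as a module
over `S ⋊_α G`, where `G` acts trivially on `S`: `s` acts on `M` and `g` acts on `N` as `c_g`. -/
def outerTensor {S M N : Type*} [Ring S] [Algebra ℂ S] [AddCommGroup M] [Module ℂ M]
    [AddCommGroup N] [Module ℂ N] (σ : S →ₐ[ℂ] Module.End ℂ M)
    (D : CovariantRep (1 : G →* (ℂ ≃ₐ[ℂ] ℂ)) α N) :
    CovariantRep (1 : G →* (S ≃ₐ[ℂ] S)) α (M ⊗[ℂ] N) where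
  act := (Module.End.rTensorAlgHom ℂ M N).comp σ
  op g := LinearEquiv.lTensor M (D.op g)
  op_mul g h w := by
    induction w using TensorProduct.induction_on with
    | zero => simp
    | tmul x y => simp [D.op_mul]
    | add x y hx hy => simp only [map_add, smul_add, hx, hy]
  op_act g r w := by
    induction w using TensorProduct.induction_on with
    | zero => simp
    | tmul x y => rfl
    | add x y hx hy => simp only [map_add, hx, hy]

/-- The dual `M^*` of a `(ℂG)_{α⁻¹}`-module `M`, which is a `(ℂG)_α`-module:
`(c_g f)(m) = f(c_g⁻¹ m)`. -/
def twistedDual (α : TwoCocycle G) (M : Type*) [AddCommGroup M] [Module ℂ M]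
    [Module (TwistedGroupAlgebra α⁻¹) M] [IsScalarTower ℂ (TwistedGroupAlgebra α⁻¹) M] :
    CovariantRep (1 : G →* (ℂ ≃ₐ[ℂ] ℂ)) α (Module.Dual ℂ M) where
  act := Algebra.ofId ℂ _
  op g := (LinearEquiv.ofLinearMap
      (Algebra.lsmul ℂ ℂ M (((TwistedGroupAlgebra.basisUnit α⁻¹ g)⁻¹ :
        (TwistedGroupAlgebra α⁻¹)ˣ) : TwistedGroupAlgebra α⁻¹))
      (Algebra.lsmul ℂ ℂ M (TwistedGroupAlgebra.basisUnit α⁻¹ g : TwistedGroupAlgebra α⁻¹))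
      (by ext m; simp [← mul_smul]) (by ext m; simp [← mul_smul])).dualMap
  op_mul g h f := by
    ext m
    have key : (((TwistedGroupAlgebra.basisUnit α⁻¹ h)⁻¹ : (TwistedGroupAlgebra α⁻¹)ˣ) :
          TwistedGroupAlgebra α⁻¹) *
        ((TwistedGroupAlgebra.basisUnit α⁻¹ g)⁻¹ : (TwistedGroupAlgebra α⁻¹)ˣ) =
        (α g h : ℂ) • (((TwistedGroupAlgebra.basisUnit α⁻¹ (g * h))⁻¹ :
          (TwistedGroupAlgebra α⁻¹)ˣ) : TwistedGroupAlgebra α⁻¹) := by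
      rw [← Units.val_mul, ← mul_inv_rev, Units.inv_eq_of_mul_eq_one_left]
      rw [Units.val_mul, smul_mul_assoc]
      have : (TwistedGroupAlgebra.basisUnit α⁻¹ g : TwistedGroupAlgebra α⁻¹) *
          TwistedGroupAlgebra.basisUnit α⁻¹ h = ((α g h : ℂ)⁻¹) •
            (TwistedGroupAlgebra.basisUnit α⁻¹ (g * h) : TwistedGroupAlgebra α⁻¹) := by
        change CrossedProduct.single _ _ _ _ * CrossedProduct.single _ _ _ _ =
          _ • CrossedProduct.single _ _ _ _
        rw [CrossedProduct.single_mul_single, CrossedProduct.smul_single]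
        simp only [TwoCocycle.inv_apply, map_one, mul_one, smul_eq_mul, Units.val_inv_eq_inv_val]
      rw [this, mul_smul_comm, smul_smul]
      simp
    simp only [LinearEquiv.dualMap_apply, LinearEquiv.coe_ofLinearMap, Algebra.lsmul_coe,
      LinearMap.smul_apply]
    rw [← mul_smul, key, smul_assoc, map_smul]
  op_act g r f := by
    simp [Algebra.ofId_apply, Module.algebraMap_end_apply]

end CovariantRep

end Crossed

/-! ### Cyclotomic Hecke algebras -/

/-- The defining relations of the cyclotomic Hecke algebra; the generator `ι i`, for
`i = 0, …, n - 1`, is the one usually written `T_{i+1}`. -/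
inductive HeckeRel {r n : ℕ} (u : Fin r → ℂ) (q : ℂ) :
    FreeAlgebra ℂ (Fin n) → FreeAlgebra ℂ (Fin n) → Prop
  | comm (i j : Fin n) (h : i.val + 1 < j.val) :
      HeckeRel u q (FreeAlgebra.ι ℂ i * FreeAlgebra.ι ℂ j)
        (FreeAlgebra.ι ℂ j * FreeAlgebra.ι ℂ i)
  | braid (i j : Fin n) (hi : 1 ≤ i.val) (hj : j.val = i.val + 1) :
      HeckeRel u q (FreeAlgebra.ι ℂ i * FreeAlgebra.ι ℂ j * FreeAlgebra.ι ℂ i)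
        (FreeAlgebra.ι ℂ j * FreeAlgebra.ι ℂ i * FreeAlgebra.ι ℂ j)
  | braid_four (i j : Fin n) (hi : i.val = 0) (hj : j.val = 1) :
      HeckeRel u q
        (FreeAlgebra.ι ℂ i * FreeAlgebra.ι ℂ j * FreeAlgebra.ι ℂ i * FreeAlgebra.ι ℂ j)
        (FreeAlgebra.ι ℂ j * FreeAlgebra.ι ℂ i * FreeAlgebra.ι ℂ j * FreeAlgebra.ι ℂ i)
  | cyclotomic (i : Fin n) (hi : i.val = 0) :
      HeckeRel u q (aeval (FreeAlgebra.ι ℂ i) (∏ k, (X - C (u k)))) 0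
  | quadratic (i : Fin n) (hi : 1 ≤ i.val) :
      HeckeRel u q
        ((FreeAlgebra.ι ℂ i - 1) * (FreeAlgebra.ι ℂ i + algebraMap ℂ _ q)) 0

/-- The cyclotomic Hecke algebra `H_{r,1,n}(u_1, …, u_r, q)`. -/
def Hecke {r : ℕ} (n : ℕ) (u : Fin r → ℂ) (q : ℂ) : Type :=
  RingQuot (HeckeRel (n := n) u q)

namespace Hecke

variable {r n : ℕ} {u : Fin r → ℂ} {q : ℂ}

instance : Ring (Hecke n u q) := inferInstanceAs (Ring (RingQuot (HeckeRel (n := n) u q)))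
instance : Algebra ℂ (Hecke n u q) :=
  inferInstanceAs (Algebra ℂ (RingQuot (HeckeRel (n := n) u q)))

variable (n u q) in
/-- The quotient map from the free algebra. -/
def mk : FreeAlgebra ℂ (Fin n) →ₐ[ℂ] Hecke n u q := RingQuot.mkAlgHom ℂ (HeckeRel (n := n) u q)

variable (u q) in
/-- The generators of the Hecke algebra. -/
def T (i : Fin n) : Hecke n u q := mk n u q (FreeAlgebra.ι ℂ i)

lemma mk_rel {a b : FreeAlgebra ℂ (Fin n)} (h : HeckeRel u q a b) : mk n u q a = mk n u q b :=
  RingQuot.mkAlgHom_rel ℂ h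

/-- The universal property of the Hecke algebra. -/
def lift {A : Type*} [Ring A] [Algebra ℂ A] (f : Fin n → A)
    (hf : ∀ a b, HeckeRel u q a b → FreeAlgebra.lift ℂ f a = FreeAlgebra.lift ℂ f b) :
    Hecke n u q →ₐ[ℂ] A :=
  RingQuot.liftAlgHom ℂ ⟨FreeAlgebra.lift ℂ f, fun {a b} h => hf a b h⟩

lemma lift_T {A : Type*} [Ring A] [Algebra ℂ A] (f : Fin n → A)
    (hf : ∀ a b, HeckeRel u q a b → FreeAlgebra.lift ℂ f a = FreeAlgebra.lift ℂ f b)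
    (i : Fin n) : lift f hf (T u q i) = f i := by
  unfold lift T mk
  erw [RingQuot.liftAlgHom_mkAlgHom_apply]
  exact FreeAlgebra.lift_ι_apply f i

lemma hom_ext {A : Type*} [Semiring A] [Algebra ℂ A] {f g : Hecke n u q →ₐ[ℂ] A}
    (h : ∀ i, f (T u q i) = g (T u q i)) : f = g := by
  apply RingQuot.ringQuot_ext'
  apply FreeAlgebra.hom_ext
  funext i
  exact h i

end Hecke

/-- The parameters `u_{lp+k+1} = ξ^k v_l` for `0 ≤ k < p`, `0 ≤ l < d` (in zero-based
numbering, the entry with index `lp + k` is `ξ^k v_l`). -/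
def cycParam (p : ℕ) {d : ℕ} (ξ : ℂ) (v : Fin d → ℂ) : Fin (d * p) → ℂ :=
  fun j => ξ ^ (j.modNat : ℕ) * v j.divNat

/-- `H_{r,1,n}` with `r = dp` and parameters `u_{lp+k+1} = ξ^k v_l`. -/
abbrev HeckeR1n (p n : ℕ) {d : ℕ} (ξ : ℂ) (v : Fin d → ℂ) (q : ℂ) : Type :=
  Hecke n (cycParam p ξ v) q

/-- The subalgebra `H_{r,p,n}` of `H_{r,1,n}`, generated by `T_1^p`, `T_1⁻¹ T_2 T_1` and
`T_2, …, T_n`. -/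
def heckeRpn (p n : ℕ) {d : ℕ} (ξ : ℂ) (v : Fin d → ℂ) (q : ℂ) :
    Subalgebra ℂ (HeckeR1n p n ξ v q) :=
  Algebra.adjoin ℂ
    ({x | ∃ i : Fin n, i.val = 0 ∧ x = Hecke.T _ q i ^ p} ∪
     {x | ∃ i j : Fin n, i.val = 0 ∧ j.val = 1 ∧
        x = Ring.inverse (Hecke.T _ q i) * Hecke.T _ q j * Hecke.T _ q i} ∪
     {x | ∃ i : Fin n, 1 ≤ i.val ∧ x = Hecke.T _ q i})

/-! ### The action of `ℤ/p` on the Hecke algebra -/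

/-- The cyclic group `G = ⟨τ⟩ ≅ ℤ/p`, written multiplicatively; `τ` is `ofAdd 1`. -/
abbrev CycGroup (p : ℕ) : Type := Multiplicative (ZMod p)

/-- The character `τ^k ↦ ξ^k` of `G`, for `ξ^p = 1`. -/
def chi {p : ℕ} (ξ : ℂ) (g : CycGroup p) : ℂ := ξ ^ (g.toAdd.val)

section Action

variable {p d n : ℕ} {ξ : ℂ}

lemma chi_mul [NeZero p] (hξ : ξ ^ p = 1) (g h : CycGroup p) : chi ξ (g * h) = chi ξ g * chi ξ h := by
  unfold chi
  rw [toAdd_mul, ZMod.val_add, ← pow_add, ← pow_eq_pow_mod _ hξ]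

lemma chi_one : chi ξ (1 : CycGroup p) = 1 := by
  simp [chi]

lemma chi_pow (hξ : ξ ^ p = 1) (g : CycGroup p) : chi ξ g ^ p = 1 := by
  unfold chi
  rw [← pow_mul, mul_comm, pow_mul, hξ, one_pow]

lemma chi_ne_zero [NeZero p] (hξ : ξ ^ p = 1) (g : CycGroup p) : chi ξ g ≠ 0 := by
  intro h
  have := chi_pow hξ g
  rw [h, zero_pow (NeZero.ne p)] at this
  exact zero_ne_one this

lemma prod_cycParam [NeZero p] (hξ : IsPrimitiveRoot ξ p) (v : Fin d → ℂ) :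
    (∏ k, (X - C (cycParam p ξ v k)) : ℂ[X]) = ∏ l, (X ^ p - C (v l ^ p)) := by
  rw [← finProdFinEquiv.prod_comp, Fintype.prod_prod_type]
  refine Finset.prod_congr rfl fun l _ => ?_
  rw [X_pow_sub_C_eq_prod hξ (NeZero.pos p) rfl, ← Fin.prod_univ_eq_prod_range
    (fun k => (X - C (ξ ^ k * v l) : ℂ[X]))]
  refine Finset.prod_congr rfl fun k _ => ?_
  have h := finProdFinEquiv.symm_apply_apply (l, k)
  simp only [finProdFinEquiv_symm_apply, Prod.mk.injEq] at h
  simp only [cycParam, h.1, h.2]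

/-- The image of the generators under `τ^k`: `T_1 ↦ ξ^k T_1` and `T_i ↦ T_i` for `i ≥ 2`. -/
def tauGen (ξ : ℂ) (v : Fin d → ℂ) (q : ℂ) (g : CycGroup p) (i : Fin n) :
    HeckeR1n p n ξ v q :=
  if i.val = 0 then chi ξ g • Hecke.T _ q i else Hecke.T _ q i

lemma tauGen_rel [NeZero p] (hξ : IsPrimitiveRoot ξ p) (v : Fin d → ℂ) (q : ℂ) (g : CycGroup p)
    (a b : FreeAlgebra ℂ (Fin n)) (h : HeckeRel (cycParam p ξ v) q a b) :
    FreeAlgebra.lift ℂ (tauGen ξ v q g) a = FreeAlgebra.lift ℂ (tauGen ξ v q g) b := by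
  have hr := Hecke.mk_rel h
  cases h with
  | comm i j h =>
    have hj : j.val ≠ 0 := by omega
    simp only [map_mul, FreeAlgebra.lift_ι_apply, tauGen, hj, if_false] at hr ⊢
    split_ifs
    · rw [smul_mul_assoc, mul_smul_comm]
      exact congrArg _ hr
    · exact hr
  | braid i j hi hj =>
    have hi : i.val ≠ 0 := by omega
    have hj : j.val ≠ 0 := by omega
    simp only [map_mul, FreeAlgebra.lift_ι_apply, tauGen, hi, hj, if_false] at hr ⊢
    exact hr
  | braid_four i j hi hj =>
    have hj : j.val ≠ 0 := by omega
    simp only [map_mul, FreeAlgebra.lift_ι_apply, tauGen, hi, hj, if_false, if_true] at hr ⊢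
    simp only [smul_mul_assoc, mul_smul_comm]
    exact congrArg _ (congrArg _ hr)
  | cyclotomic i hi =>
    rw [prod_cycParam hξ] at hr ⊢
    rw [map_zero, ← Polynomial.aeval_algHom_apply] at hr ⊢
    rw [FreeAlgebra.lift_ι_apply]
    have hP : (∏ l, (X ^ p - C (v l ^ p)) : ℂ[X]) =
        (∏ l, (X - C (v l ^ p)) : ℂ[X]).comp (X ^ p) := by
      simp [Polynomial.prod_comp]
    rw [hP, aeval_comp] at hr ⊢
    have hT : Hecke.mk n (cycParam p ξ v) q (FreeAlgebra.ι ℂ i) = Hecke.T (cycParam p ξ v) q i := rfl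
    rw [hT] at hr
    simp only [tauGen, hi, if_true, map_pow, aeval_X, _root_.smul_pow, chi_pow hξ.pow_eq_one,
      one_smul] at hr ⊢
    exact hr
  | quadratic i hi =>
    have hi : i.val ≠ 0 := by omega
    simp only [map_mul, map_sub, map_add, map_one, AlgHom.commutes, map_zero,
      FreeAlgebra.lift_ι_apply, tauGen, hi, if_false] at hr ⊢
    exact hr

variable [NeZero p]

/-- The algebra endomorphism `τ^k` of `H_{r,1,n}`. -/
def tauHom (hξ : IsPrimitiveRoot ξ p) (v : Fin d → ℂ) (q : ℂ) (g : CycGroup p) :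
    HeckeR1n p n ξ v q →ₐ[ℂ] HeckeR1n p n ξ v q :=
  Hecke.lift (tauGen ξ v q g) (tauGen_rel hξ v q g)

lemma tauHom_T (hξ : IsPrimitiveRoot ξ p) (v : Fin d → ℂ) (q : ℂ) (g : CycGroup p) (i : Fin n) :
    tauHom hξ v q g (Hecke.T _ q i) = tauGen ξ v q g i :=
  Hecke.lift_T _ _ i

lemma tauHom_mul (hξ : IsPrimitiveRoot ξ p) (v : Fin d → ℂ) (q : ℂ) (g h : CycGroup p) :
    (tauHom hξ v q (g * h) : HeckeR1n p n ξ v q →ₐ[ℂ] _) =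
      (tauHom hξ v q g).comp (tauHom hξ v q h) := by
  apply Hecke.hom_ext
  intro i
  rw [AlgHom.comp_apply, tauHom_T, tauHom_T]
  unfold tauGen
  split_ifs with hi
  · rw [map_smul, tauHom_T, tauGen, if_pos hi, smul_smul, chi_mul hξ.pow_eq_one,
      mul_comm (chi ξ g)]
  · rw [tauHom_T, tauGen, if_neg hi]

lemma tauHom_one (hξ : IsPrimitiveRoot ξ p) (v : Fin d → ℂ) (q : ℂ) :
    (tauHom hξ v q 1 : HeckeR1n p n ξ v q →ₐ[ℂ] _) = AlgHom.id ℂ _ := by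
  apply Hecke.hom_ext
  intro i
  rw [tauHom_T, tauGen, chi_one]
  simp

/-- The action of `G = ⟨τ⟩ ≅ ℤ/p` on `H_{r,1,n}` by algebra automorphisms, with
`τ(T_1) = ξ T_1` and `τ(T_i) = T_i` for `i ≥ 2`. -/
def heckeAut (n : ℕ) (hξ : IsPrimitiveRoot ξ p) (v : Fin d → ℂ) (q : ℂ) :
    CycGroup p →* (HeckeR1n p n ξ v q ≃ₐ[ℂ] HeckeR1n p n ξ v q) where
  toFun g := AlgEquiv.ofAlgHom (tauHom hξ v q g) (tauHom hξ v q g⁻¹)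
    (by rw [← tauHom_mul, mul_inv_cancel, tauHom_one])
    (by rw [← tauHom_mul, inv_mul_cancel, tauHom_one])
  map_one' := by
    ext x
    exact DFunLike.congr_fun (tauHom_one hξ v q) x
  map_mul' g h := by
    ext x
    exact DFunLike.congr_fun (tauHom_mul hξ v q g h) x

lemma heckeAut_T (hξ : IsPrimitiveRoot ξ p) (v : Fin d → ℂ) (q : ℂ) (g : CycGroup p) (i : Fin n) :
    heckeAut n hξ v q g (Hecke.T _ q i) =
      if i.val = 0 then chi ξ g • Hecke.T _ q i else Hecke.T _ q i :=
  tauHom_T hξ v q g i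

lemma inverse_smul {A : Type*} [Ring A] [Algebra ℂ A] {c : ℂ} (hc : c ≠ 0) (a : A) :
    Ring.inverse (c • a) = c⁻¹ • Ring.inverse a := by
  by_cases ha : IsUnit a
  · obtain ⟨x, rfl⟩ := ha
    let y : Aˣ := ⟨c • (x : A), c⁻¹ • ((x⁻¹ : Aˣ) : A), by simp [smul_smul, hc],
      by simp [smul_smul, hc]⟩
    rw [Ring.inverse_unit]
    exact Ring.inverse_unit y
  · have hca : ¬ IsUnit (c • a) := by
      intro h
      apply ha
      have := h.smul (Units.mk0 c hc)⁻¹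
      simpa [Units.smul_def, smul_smul, hc] using this
    rw [Ring.inverse_non_unit _ ha, Ring.inverse_non_unit _ hca, smul_zero]

lemma map_inverse_equiv {A : Type*} [Ring A] [Algebra ℂ A] (f : A ≃ₐ[ℂ] A) (a : A) :
    f (Ring.inverse a) = Ring.inverse (f a) := by
  by_cases ha : IsUnit a
  · obtain ⟨x, rfl⟩ := ha
    rw [Ring.inverse_unit]
    exact (Ring.inverse_unit (Units.map (f : A →* A) x)).symm
  · have hfa : ¬ IsUnit (f a) := fun h => ha (by
      have := h.map f.symm
      rwa [AlgEquiv.symm_apply_apply] at this)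
    rw [Ring.inverse_non_unit _ ha, Ring.inverse_non_unit _ hfa, map_zero]

/-- `τ` fixes `H_{r,p,n}` elementwise. -/
lemma heckeAut_fixes (hξ : IsPrimitiveRoot ξ p) (v : Fin d → ℂ) (q : ℂ) (g : CycGroup p)
    (x : HeckeR1n p n ξ v q) (hx : x ∈ heckeRpn p n ξ v q) : heckeAut n hξ v q g x = x := by
  have hc := chi_ne_zero hξ.pow_eq_one g
  induction hx using Algebra.adjoin_induction with
  | mem x hx =>
    rcases hx with (⟨i, hi, rfl⟩ | ⟨i, j, hi, hj, rfl⟩) | ⟨i, hi, rfl⟩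
    · rw [map_pow, heckeAut_T, if_pos hi, _root_.smul_pow, chi_pow hξ.pow_eq_one, one_smul]
    · have hj : j.val ≠ 0 := by omega
      have hinv : heckeAut n hξ v q g (Ring.inverse (Hecke.T _ q i)) =
          Ring.inverse (heckeAut n hξ v q g (Hecke.T _ q i)) := map_inverse_equiv _ _
      rw [map_mul, map_mul, hinv, heckeAut_T, if_pos hi, heckeAut_T, if_neg hj, inverse_smul hc]
      simp [smul_smul, hc]
    · rw [heckeAut_T, if_neg (by omega)]
  | algebraMap c => exact AlgEquiv.commutes _ c
  | add x y _ _ hx hy => rw [map_add, hx, hy]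
  | mul x y _ _ hx hy => rw [map_mul, hx, hy]

end Action

/-! ### Multi-diagrams, standard tableaux, and the seminormal representations -/

section Tableaux

variable {p d n : ℕ}

/-- An `r`-tuple `(λ^i_j)` of Young diagrams, `i ∈ ℤ/p` and `0 ≤ j < d`, of total size `n`. -/
@[ext] structure MultiDiagram (p d n : ℕ) [NeZero p] where
  diag : ZMod p → Fin d → YoungDiagram
  size : ∑ i, ∑ j, (diag i j).card = n

/-- A cell `((i, j), (k, l))`: the position in row `k` and column `l` of the component `(i, j)`. -/
abbrev Cell (p d : ℕ) : Type := (ZMod p × Fin d) × (ℕ × ℕ)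

/-- The cell of the shifted tuple that corresponds to a given one under `shift^k`: the component
with index `i` of a tuple has index `i - k` in the shifted tuple. -/
def shiftCell (g : CycGroup p) (c : Cell p d) : Cell p d := ((c.1.1 - g.toAdd, c.1.2), c.2)

lemma shiftCell_mul (g h : CycGroup p) (c : Cell p d) :
    shiftCell (g * h) c = shiftCell g (shiftCell h c) := by
  unfold shiftCell
  rw [toAdd_mul]
  ext1
  · ext1
    · change _ = c.1.1 - h.toAdd - g.toAdd
      ring
    · rfl
  · rfl

lemma shiftCell_one (c : Cell p d) : shiftCell 1 c = c := by
  simp [shiftCell]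

lemma shiftCell_injective (g : CycGroup p) :
    Function.Injective (shiftCell g : Cell p d → Cell p d) := fun a b h => by
  have := congrArg (shiftCell g⁻¹) h
  rwa [← shiftCell_mul, ← shiftCell_mul, inv_mul_cancel, shiftCell_one, shiftCell_one] at this

lemma shiftCell_fst_eq (g : CycGroup p) (a b : Cell p d) :
    (shiftCell g a).1 = (shiftCell g b).1 ↔ a.1 = b.1 := by
  simp [shiftCell, Prod.ext_iff]

variable [NeZero p]

/-- The action of `ℤ/p` on multi-diagrams in which the generator acts by
`shift (λ^i_j) = (λ^{i+1}_j)`. -/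
instance : MulAction (CycGroup p) (MultiDiagram p d n) where
  smul g lam := ⟨fun i j => lam.diag (i + g.toAdd) j, by
    refine Eq.trans ?_ lam.size
    exact Equiv.sum_comp (Equiv.addRight g.toAdd) (fun i => ∑ j, (lam.diag i j).card)⟩
  one_smul lam := by
    ext1
    funext i j
    change lam.diag (i + 0) j = _
    rw [add_zero]
  mul_smul g h lam := by
    ext1
    funext i j
    change lam.diag (i + (g.toAdd + h.toAdd)) j = lam.diag (i + g.toAdd + h.toAdd) j
    rw [add_assoc]

lemma smul_diag (g : CycGroup p) (lam : MultiDiagram p d n) (i : ZMod p) (j : Fin d) :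
    (g • lam).diag i j = lam.diag (i + g.toAdd) j := rfl

/-- The set of cells of a multi-diagram. -/
def MultiDiagram.cells (lam : MultiDiagram p d n) : Set (Cell p d) :=
  {c | c.2 ∈ lam.diag c.1.1 c.1.2}

/-- A standard tableau of shape `lam`: a bijection from `{1, …, n}` (here `Fin n`) to the cells
of `lam` that increases along rows and columns, i.e. from each cell to its right neighbour and to
its lower neighbour. -/
structure IsStandard (lam : MultiDiagram p d n) (t : Fin n → Cell p d) : Prop where
  bij : Set.BijOn t Set.univ lam.cells
  row : ∀ a b, (t a).1 = (t b).1 → (t b).2 = ((t a).2.1, (t a).2.2 + 1) → a < b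
  col : ∀ a b, (t a).1 = (t b).1 → (t b).2 = ((t a).2.1 + 1, (t a).2.2) → a < b

/-- The set of standard tableaux of shape `lam`. -/
abbrev StdTableau (lam : MultiDiagram p d n) : Type := {t : Fin n → Cell p d // IsStandard lam t}

/-- The vector space `V(lam)` with basis `v(t)` the standard tableaux `t` of shape `lam`. -/
abbrev V (lam : MultiDiagram p d n) : Type := StdTableau lam →₀ ℂ

/-- The content (column minus row) of a cell. -/
def content (c : Cell p d) : ℤ := (c.2.2 : ℤ) - c.2.1

/-- The parameter `ξ^i v_j` attached to the component `(i, j)` of a cell. -/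
def compParam (ξ : ℂ) (v : Fin d → ℂ) (c : Cell p d) : ℂ := ξ ^ c.1.1.val * v c.1.2

/-- The `q`-integer `[m]_q = (q^m - 1) / (q - 1)`, with `[m]_1 = m`. -/
def qInt (q : ℂ) (m : ℤ) : ℂ := if q = 1 then m else (q ^ m - 1) / (q - 1)

/-- For cells `A`, `B` holding the numbers `i - 1`, `i` of a tableau, the diagonal coefficient of
`T_i`. With `a`, `b` the parameters of the components of `A`, `B` times `q^{-content}`, it is
`(q - 1) b / (a - b)`, which is `1 / [content B - content A]_q` when the components agree; the
latter form makes sense also at `q = 1`. -/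
def diagCoeff (ξ : ℂ) (v : Fin d → ℂ) (q : ℂ) (A B : Cell p d) : ℂ :=
  if A.1 = B.1 then (qInt q (content B - content A))⁻¹
  else ((q - 1) * (compParam ξ v B * q ^ (-content B))) /
    (compParam ξ v A * q ^ (-content A) - compParam ξ v B * q ^ (-content B))

/-- The predecessor of an index in `Fin n` (used for nonzero indices). -/
def prevIdx (i : Fin n) : Fin n := ⟨i.val - 1, by omega⟩

open Classical in
/-- The basis vector `v(t)`, understood as `0` when `t` is not a standard tableau. -/
def basisOrZero (lam : MultiDiagram p d n) (t : Fin n → Cell p d) : V lam :=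
  if h : IsStandard lam t then Finsupp.single ⟨t, h⟩ 1 else 0

/-- The seminormal (Ariki–Koike, Hoefsmit) operators on `V(lam)`:
`T_1 v(t) = ξ^i v_j v(t)`, where `(i, j)` is the component of `t` that contains the number `1`, and
`T_i v(t) = x v(t) + (1 - x) v(s_{i-1} t)` for `i ≥ 2`, where `s_{i-1} t` is `t` with the
numbers `i - 1`, `i` exchanged. -/
def seminormalOp (ξ : ℂ) (v : Fin d → ℂ) (q : ℂ) (lam : MultiDiagram p d n) (i : Fin n) :
    Module.End ℂ (V lam) :=
  Finsupp.linearCombination ℂ fun t : StdTableau lam =>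
    if i.val = 0 then compParam ξ v (t.1 i) • (Finsupp.single t 1 : V lam)
    else diagCoeff ξ v q (t.1 (prevIdx i)) (t.1 i) • (Finsupp.single t 1 : V lam) +
      (1 - diagCoeff ξ v q (t.1 (prevIdx i)) (t.1 i)) •
        basisOrZero lam (t.1 ∘ Equiv.swap (prevIdx i) i)

/-- The stabilizer `G_lam` of `lam` in `G = ⟨τ⟩ = ⟨shift⟩ ≅ ℤ/p`. -/
abbrev stab (lam : MultiDiagram p d n) : Subgroup (CycGroup p) :=
  MulAction.stabilizer (CycGroup p) lam

/-- `e_lam = p / |cyclic equivalence class of lam|`. -/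
def eNum (lam : MultiDiagram p d n) : ℕ := p / Nat.card (MulAction.orbit (CycGroup p) lam)

lemma IsStandard.shift {lam : MultiDiagram p d n} {t : Fin n → Cell p d} (h : IsStandard lam t)
    (g : CycGroup p) : IsStandard (g • lam) (shiftCell g ∘ t) := by
  refine ⟨⟨?_, (shiftCell_injective g).injOn.comp h.bij.injOn (Set.mapsTo_univ _ _), ?_⟩, ?_, ?_⟩
  · intro a _
    have := h.bij.mapsTo (Set.mem_univ a)
    simp only [MultiDiagram.cells, Set.mem_ofPred_eq, smul_diag, Function.comp, shiftCell,
      sub_add_cancel] at this ⊢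
    exact this
  · intro c hc
    have hc2 : shiftCell g⁻¹ c ∈ lam.cells := by
      simp only [MultiDiagram.cells, Set.mem_ofPred_eq, smul_diag, shiftCell, toAdd_inv,
        sub_neg_eq_add] at hc ⊢
      exact hc
    obtain ⟨a, _, ha⟩ := h.bij.surjOn hc2
    refine ⟨a, Set.mem_univ a, ?_⟩
    rw [Function.comp, ha, ← shiftCell_mul, mul_inv_cancel, shiftCell_one]
  · intro a b h1 h2
    exact h.row a b ((shiftCell_fst_eq g _ _).1 h1) h2
  · intro a b h1 h2
    exact h.col a b ((shiftCell_fst_eq g _ _).1 h1) h2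

lemma isStandard_shift_iff {lam : MultiDiagram p d n} {g : CycGroup p} (hg : g ∈ stab lam)
    (t : Fin n → Cell p d) : IsStandard lam (shiftCell g ∘ t) ↔ IsStandard lam t := by
  have hg2 : g • lam = lam := hg
  have hg3 : g⁻¹ • lam = lam := (stab lam).inv_mem hg
  constructor
  · intro h
    have := h.shift g⁻¹
    rw [hg3] at this
    convert this
    funext a
    simp only [Function.comp]
    rw [← shiftCell_mul, inv_mul_cancel, shiftCell_one]
  · intro h
    have := h.shift g
    rwa [hg2] at this

/-- The action of `G_lam` on the standard tableaux of shape `lam`, by powers of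
`shift (T^i_j) = (T^{i+1}_j)`. -/
def shiftTab {lam : MultiDiagram p d n} (g : stab lam) : StdTableau lam ≃ StdTableau lam where
  toFun t := ⟨shiftCell (g : CycGroup p) ∘ t.1, (isStandard_shift_iff g.2 _).2 t.2⟩
  invFun t := ⟨shiftCell ((g⁻¹ : stab lam) : CycGroup p) ∘ t.1,
    (isStandard_shift_iff (g⁻¹).2 _).2 t.2⟩
  left_inv t := by
    apply Subtype.ext
    funext a
    simp only [Function.comp]
    rw [← shiftCell_mul, ← Subgroup.coe_mul, inv_mul_cancel, Subgroup.coe_one, shiftCell_one]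
  right_inv t := by
    apply Subtype.ext
    funext a
    simp only [Function.comp]
    rw [← shiftCell_mul, ← Subgroup.coe_mul, mul_inv_cancel, Subgroup.coe_one, shiftCell_one]

/-- The shift operators on `V(lam)`: `v(t) ↦ v(shift^k t)` for `τ^k ∈ G_lam`. -/
def shiftOp {lam : MultiDiagram p d n} (g : stab lam) : V lam ≃ₗ[ℂ] V lam :=
  Finsupp.domLCongr (shiftTab g)

lemma shiftOp_single {lam : MultiDiagram p d n} (g : stab lam) (t : StdTableau lam) (c : ℂ) :
    shiftOp g (Finsupp.single t c) = Finsupp.single (shiftTab g t) c :=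
  Finsupp.domLCongr_single _ _ _

lemma compParam_shift {ξ : ℂ} (hξ : ξ ^ p = 1) (v : Fin d → ℂ) (g : CycGroup p) (c : Cell p d) :
    compParam ξ v c = chi ξ g * compParam ξ v (shiftCell g c) := by
  have h := chi_mul hξ g (Multiplicative.ofAdd (c.1.1 - g.toAdd))
  have h2 : g * Multiplicative.ofAdd (c.1.1 - g.toAdd) = Multiplicative.ofAdd c.1.1 := by
    apply Multiplicative.toAdd.injective
    simp
  rw [h2] at h
  simp only [chi, toAdd_ofAdd] at h
  simp only [compParam, shiftCell, chi, h, mul_assoc]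

lemma diagCoeff_shift {ξ : ℂ} (hξ : ξ ^ p = 1) (v : Fin d → ℂ) (q : ℂ) (g : CycGroup p)
    (A B : Cell p d) : diagCoeff ξ v q (shiftCell g A) (shiftCell g B) = diagCoeff ξ v q A B := by
  have hc := chi_ne_zero hξ g
  unfold diagCoeff
  by_cases h : A.1 = B.1
  · rw [if_pos h, if_pos ((shiftCell_fst_eq g A B).2 h)]
    rfl
  · rw [if_neg h, if_neg (fun h2 => h ((shiftCell_fst_eq g A B).1 h2))]
    rw [compParam_shift hξ v g A, compParam_shift hξ v g B]
    have hA : content (shiftCell g A) = content A := rfl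
    have hB : content (shiftCell g B) = content B := rfl
    rw [hA, hB, mul_assoc (chi ξ g), mul_assoc (chi ξ g), ← mul_sub, mul_left_comm (q - 1) (chi ξ g),
      mul_div_mul_left _ _ hc]

lemma shiftOp_basisOrZero {lam : MultiDiagram p d n} (g : stab lam) (t : Fin n → Cell p d) :
    shiftOp g (basisOrZero lam t) = basisOrZero lam (shiftCell (g : CycGroup p) ∘ t) := by
  unfold basisOrZero
  by_cases h : IsStandard lam t
  · rw [dif_pos h, dif_pos ((isStandard_shift_iff g.2 t).2 h), shiftOp_single]
    rfl
  · rw [dif_neg h, dif_neg (fun h2 => h ((isStandard_shift_iff g.2 t).1 h2)), map_zero]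

/-- The shift operators intertwine the seminormal operators up to the automorphism `τ^k`. -/
lemma shiftOp_seminormalOp {ξ : ℂ} (hξ : ξ ^ p = 1) (v : Fin d → ℂ) (q : ℂ)
    {lam : MultiDiagram p d n} (g : stab lam) (i : Fin n) (x : V lam) :
    shiftOp g (seminormalOp ξ v q lam i x) =
      if i.val = 0 then chi ξ (g : CycGroup p) • seminormalOp ξ v q lam i (shiftOp g x)
      else seminormalOp ξ v q lam i (shiftOp g x) := by
  induction x using Finsupp.induction_linear with
  | zero => simp
  | add x y hx hy =>
    simp only [map_add, hx, hy]
    split_ifs <;> simp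
  | single t c =>
    have hcomp : ∀ a, (shiftTab g t).1 a = shiftCell (g : CycGroup p) (t.1 a) := fun _ => rfl
    rw [shiftOp_single]
    simp only [seminormalOp, Finsupp.linearCombination_single, map_smul]
    split_ifs with hi
    · rw [map_smul, shiftOp_single, smul_comm, hcomp, compParam_shift hξ v (g : CycGroup p) (t.1 i),
        mul_smul, smul_comm c (compParam _ _ _)]
    · rw [map_add, map_smul, map_smul, shiftOp_single, shiftOp_basisOrZero, hcomp, hcomp,
        diagCoeff_shift hξ]
      rfl

end Tableaux

/-! ### Ariki's modules -/

section Modules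

variable {p d n : ℕ} [NeZero p] {ξ : ℂ} {v : Fin d → ℂ} {q : ℂ}

/-- The action of the stabilizer `G_lam` on `H_{r,1,n}`. -/
abbrev stabAut (hξ : IsPrimitiveRoot ξ p) (v : Fin d → ℂ) (q : ℂ) (lam : MultiDiagram p d n) :
    stab lam →* (HeckeR1n p n ξ v q ≃ₐ[ℂ] HeckeR1n p n ξ v q) :=
  (heckeAut n hξ v q).comp (stab lam).subtype

/-- `ρ` is the seminormal representation of `H_{r,1,n}` on `V(lam)`. -/
def IsSeminormal (lam : MultiDiagram p d n)
    (ρ : HeckeR1n p n ξ v q →ₐ[ℂ] Module.End ℂ (V lam)) : Prop :=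
  ∀ i, ρ (Hecke.T _ q i) = seminormalOp ξ v q lam i

lemma shiftOp_act (hξ : IsPrimitiveRoot ξ p) {lam : MultiDiagram p d n}
    {ρ : HeckeR1n p n ξ v q →ₐ[ℂ] Module.End ℂ (V lam)} (hρ : IsSeminormal lam ρ) (g : stab lam)
    (h : HeckeR1n p n ξ v q) (x : V lam) :
    shiftOp g (ρ h x) = ρ (stabAut hξ v q lam g h) (shiftOp g x) := by
  have key : (((shiftOp g).conjAlgEquiv ℂ : Module.End ℂ (V lam) ≃ₐ[ℂ] _) :
      Module.End ℂ (V lam) →ₐ[ℂ] Module.End ℂ (V lam)).comp ρ =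
      ρ.comp (stabAut hξ v q lam g : HeckeR1n p n ξ v q →ₐ[ℂ] HeckeR1n p n ξ v q) := by
    apply Hecke.hom_ext
    intro i
    apply LinearMap.ext
    intro y
    change shiftOp g (ρ (Hecke.T _ q i) ((shiftOp g).symm y)) =
      ρ (heckeAut n hξ v q g (Hecke.T _ q i)) y
    rw [hρ i, shiftOp_seminormalOp hξ.pow_eq_one, heckeAut_T, LinearEquiv.apply_symm_apply]
    split_ifs
    · rw [map_smul, hρ i]
      rfl
    · rw [hρ i]
  have := LinearMap.congr_fun (DFunLike.congr_fun key h) (shiftOp g x)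
  change shiftOp g (ρ h ((shiftOp g).symm (shiftOp g x))) = _ at this
  rwa [LinearEquiv.symm_apply_apply] at this

/-- `V(lam)` as an `H_{r,1,n} ⋊ G_lam`-module, where `τ^k ∈ G_lam` acts by `shift^k`. -/
def shiftRep (hξ : IsPrimitiveRoot ξ p) {lam : MultiDiagram p d n}
    {ρ : HeckeR1n p n ξ v q →ₐ[ℂ] Module.End ℂ (V lam)} (hρ : IsSeminormal lam ρ) :
    CovariantRep (stabAut hξ v q lam) 1 (V lam) where
  act := ρ
  op := shiftOp
  op_mul g h x := by
    rw [TwoCocycle.one_apply, Units.val_one, one_smul]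
    induction x using Finsupp.induction_linear with
    | zero => simp
    | add x y hx hy => simp only [map_add, hx, hy]
    | single t c =>
      rw [shiftOp_single, shiftOp_single, shiftOp_single]
      congr 1
      apply Subtype.ext
      funext a
      exact (shiftCell_mul (g : CycGroup p) (h : CycGroup p) (t.1 a)).symm
  op_act g h x := shiftOp_act hξ hρ g h x

/-- Ariki's `H_{r,p,n}`-module `V(λ̄, l)`, realized in `V(lam)`: the vectors on which
`shift^k`, for each `τ^k ∈ G_lam`, acts by `ξ^{kl}`. Equivalently, it is the eigenspace of the
generator `shift^{p / e}` of `G_lam` for the eigenvalue `ω^l`, where `e = eNum lam` and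
`ω = ξ^{p / e}` is a primitive `e`-th root of unity. -/
def arikiModule (hξ : IsPrimitiveRoot ξ p) {lam : MultiDiagram p d n}
    {ρ : HeckeR1n p n ξ v q →ₐ[ℂ] Module.End ℂ (V lam)} (hρ : IsSeminormal lam ρ) (l : ℕ) :
    Submodule (heckeRpn p n ξ v q) (RepSpace ρ) where
  carrier := {x | ∀ g : stab lam,
    shiftOp g (RepSpace.toSpace ρ x) = chi ξ (g : CycGroup p) ^ l • RepSpace.toSpace ρ x}
  add_mem' hx hy g := by
    rw [map_add, map_add, hx g, hy g, smul_add]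
  zero_mem' g := by simp
  smul_mem' h x hx g := by
    change shiftOp g (ρ h (RepSpace.toSpace ρ x)) = _ • ρ h (RepSpace.toSpace ρ x)
    have hfix : stabAut hξ v q lam g (h : HeckeR1n p n ξ v q) = h :=
      heckeAut_fixes hξ v q (g : CycGroup p) _ h.2
    rw [shiftOp_act hξ hρ, hfix, hx g, map_smul]

end Modules

end CyclotomicHecke

end

open CyclotomicHecke
open scoped TensorProduct DirectSum

/-! The argument rests on two facts. Semisimplicity forces the parameters apart, and for separated
parameters the Hecke algebra contains, for each `V lam`, all matrix units, chosen so that they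
vanish on every other shape.

Separation. On words in an ordered alphabet the generators T_i, i ≥ 2, act by the formulas of
quantum Schur–Weyl duality, while T_1 acts by a scalar or by flipping the first sign. Each of these
modules has a one-dimensional quotient, given by a functional ε. Semisimplicity splits the quotient
(`Hecke.exists_eigenvector`), so there is an eigenvector x with ε(x) = 1. The eigenvector equations
fix the coefficients that enter ε(x) up to a common factor. Up to such a factor, ε(x) is the
Poincaré polynomial ∏ [k]_q in the first case and ∏ (1 - a b⁻¹ q⁻ⁱ) in the second, so none of these
factors can vanish (`geom_sum_ne_zero_of_semisimple`, `param_ne_of_semisimple`).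

Seminormal modules. A cell count bounds the content differences inside a tableau, so separation
keeps all denominators away from zero. The relations reduce to a sum rule, a product rule and one
three-term identity for the coefficients (`Hecke.exists_word_rep`, `exists_seminormal`). The
Jucys–Murphy elements act diagonally by residues and tell apart tableaux of all shapes at once; at q
= 1 residues forget contents, and elements acting by contents are added. Products of separating
elements give the diagonal matrix units, and the generators lead from one tableau to the next
(`exists_isMatrixUnit`). Simplicity of `V lam` and the scalarity of its endomorphisms follow at
once.

Descent to the subalgebra. The cosets H' T_1^k span H, so summing an element over G lands in H'
(`sum_heckeAut_mem`). The sum over a matrix unit acts on `V lam` through its conjugates under the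
stabilizer alone, since the other translates come from shapes that it kills. After division by e it
acts on vectors of weight l as x ↦ x(t) P_l v(s), with P_l the weight projector
(`exists_rpn_unit_weight`). The stabilizer acts freely on tableaux, so P_l v(s) is nonzero and
irreducibility follows. Replacing s by its shift under g multiplies the operator by χ(g)^l, and this
tells different weights apart.

Twisted extensions. The operator of g and the shift by g intertwine the same automorphism, so they
differ by a scalar c(g), and c trivializes α (`exists_trivialization`). The simple modules of the
algebra twisted by α⁻¹ are therefore the lines (c χ^l)⁻¹. On the weight space l the element g acts
by c χ^l, exactly as on the dual of that line, so the required isomorphism is the weight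
decomposition (`exists_decomposition`). -/

namespace CyclotomicHecke

/-! ### Hecke operators on words -/

section Words

variable {ι L : Type*} [DecidableEq ι]

/-- The operator `e_t ↦ x(t_a, t_b) e_t + y(t_a, t_b) e_{t'}` on the space with basis the words
`t : ι → L`, where `t'` is `t` with the letters at `a` and `b` exchanged. -/
noncomputable def adjOp (x y : L → L → ℂ) (a b : ι) : Module.End ℂ ((ι → L) →₀ ℂ) :=
  Finsupp.linearCombination ℂ fun t : ι → L =>
    x (t a) (t b) • (Finsupp.single t 1 : (ι → L) →₀ ℂ) +
      y (t a) (t b) • Finsupp.single (t ∘ Equiv.swap a b) 1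

lemma adjOp_single (x y : L → L → ℂ) (a b : ι) (t : ι → L) :
    adjOp x y a b (Finsupp.single t 1) = x (t a) (t b) • (Finsupp.single t 1 : (ι → L) →₀ ℂ) +
      y (t a) (t b) • Finsupp.single (t ∘ Equiv.swap a b) 1 := by
  simp [adjOp, Finsupp.linearCombination_single]

/-- The two hypotheses are the coefficients of the exchanged word and of the word itself in (T -
1)(T + q) = 0. The first carries the factor y, so it asks nothing where no exchange takes place. -/
lemma adjOp_quadratic {x y : L → L → ℂ} {q : ℂ} (a b : ι) (t : ι → L)
    (h1 : y (t a) (t b) * (x (t a) (t b) + x (t b) (t a) - (1 - q)) = 0)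
    (h2 : y (t a) (t b) * y (t b) (t a) = (1 - x (t a) (t b)) * (q + x (t a) (t b))) :
    adjOp x y a b (adjOp x y a b (Finsupp.single t 1)) =
      (1 - q) • adjOp x y a b (Finsupp.single t 1) + q • Finsupp.single t 1 := by
  have e : (t ∘ Equiv.swap a b) ∘ Equiv.swap a b = t := by
    funext i; simp
  have v1 : (t ∘ Equiv.swap a b) a = t b := by simp
  have v2 : (t ∘ Equiv.swap a b) b = t a := by simp
  simp only [adjOp_single, map_add, map_smul, e, v1, v2]
  match_scalars
  · linear_combination h2
  · linear_combination h1

lemma adjOp_comm (x y : L → L → ℂ) {a b c d : ι} (hac : a ≠ c) (had : a ≠ d) (hbc : b ≠ c)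
    (hbd : b ≠ d) (t : ι → L) :
    adjOp x y a b (adjOp x y c d (Finsupp.single t 1)) =
      adjOp x y c d (adjOp x y a b (Finsupp.single t 1)) := by
  have e : (t ∘ Equiv.swap a b) ∘ Equiv.swap c d = (t ∘ Equiv.swap c d) ∘ Equiv.swap a b := by
    rw [Function.comp_assoc, Function.comp_assoc]
    congr 1
    have hd : Equiv.Perm.Disjoint (Equiv.swap a b) (Equiv.swap c d) := by
      intro i
      by_cases h1 : i = a
      · right; subst h1; exact Equiv.swap_apply_of_ne_of_ne hac had
      · by_cases h2 : i = b
        · right; subst h2; exact Equiv.swap_apply_of_ne_of_ne hbc hbd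
        · left; exact Equiv.swap_apply_of_ne_of_ne h1 h2
    exact congrArg (fun σ : Equiv.Perm ι => (σ : ι → ι)) hd.commute.eq
  simp only [adjOp_single, map_add, map_smul, e]
  have h1 : (t ∘ Equiv.swap c d) a = t a := by
    simp [Equiv.swap_apply_of_ne_of_ne hac had]
  have h2 : (t ∘ Equiv.swap c d) b = t b := by
    simp [Equiv.swap_apply_of_ne_of_ne hbc hbd]
  have h3 : (t ∘ Equiv.swap a b) c = t c := by
    simp [Equiv.swap_apply_of_ne_of_ne hac.symm hbc.symm]
  have h4 : (t ∘ Equiv.swap a b) d = t d := by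
    simp [Equiv.swap_apply_of_ne_of_ne had.symm hbd.symm]
  rw [h1, h2, h3, h4]
  module

lemma swap_comp_braid {a b c : ι} (hab : a ≠ b) (hbc : b ≠ c) (hac : a ≠ c) (t : ι → L) :
    ((t ∘ Equiv.swap a b) ∘ Equiv.swap b c) ∘ Equiv.swap a b =
      ((t ∘ Equiv.swap b c) ∘ Equiv.swap a b) ∘ Equiv.swap b c := by
  funext i
  simp only [Function.comp]
  congr 1
  by_cases h1 : i = a
  · subst h1
    simp [Equiv.swap_apply_of_ne_of_ne, hab, hac, hbc.symm, hac.symm]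
  by_cases h2 : i = b
  · subst h2
    simp [Equiv.swap_apply_of_ne_of_ne, hab, hac, hbc.symm, hac.symm]
  by_cases h3 : i = c
  · subst h3
    simp [Equiv.swap_apply_of_ne_of_ne, hab, hac, hbc.symm, hac.symm]
  simp [Equiv.swap_apply_of_ne_of_ne, h1, h2, h3]

/-- Of the six coefficients, one for each rearrangement of three letters, three agree identically
and the others follow from the three-term identity and the quadratic laws. The second alternative in
`h3` is there for three equal letters, where the identity fails but both operators are the same
scalar. -/
lemma adjOp_braid {x y : L → L → ℂ} {q : ℂ} {a b c : ι} (hab : a ≠ b) (hbc : b ≠ c) (hac : a ≠ c)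
    (t : ι → L)
    (h1 : y (t a) (t b) * (x (t a) (t b) + x (t b) (t a) - (1 - q)) = 0)
    (h2 : y (t a) (t b) * y (t b) (t a) = (1 - x (t a) (t b)) * (q + x (t a) (t b)))
    (h1' : y (t b) (t c) * (x (t b) (t c) + x (t c) (t b) - (1 - q)) = 0)
    (h2' : y (t b) (t c) * y (t c) (t b) = (1 - x (t b) (t c)) * (q + x (t b) (t c)))
    (h3 : x (t a) (t b) * x (t b) (t c) =
        x (t a) (t c) * (x (t a) (t b) + x (t b) (t c) + q - 1) ∨
      x (t a) (t b) = x (t b) (t c) ∧ y (t a) (t b) = 0 ∧ y (t b) (t c) = 0) :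
    adjOp x y a b (adjOp x y b c (adjOp x y a b (Finsupp.single t 1))) =
      adjOp x y b c (adjOp x y a b (adjOp x y b c (Finsupp.single t 1))) := by
  have v1 : ∀ s : ι → L, (s ∘ Equiv.swap a b) a = s b := fun s => by simp
  have v2 : ∀ s : ι → L, (s ∘ Equiv.swap a b) b = s a := fun s => by simp
  have v3 : ∀ s : ι → L, (s ∘ Equiv.swap a b) c = s c := fun s => by
    simp [Equiv.swap_apply_of_ne_of_ne hac.symm hbc.symm]
  have v4 : ∀ s : ι → L, (s ∘ Equiv.swap b c) b = s c := fun s => by simp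
  have v5 : ∀ s : ι → L, (s ∘ Equiv.swap b c) c = s b := fun s => by simp
  have v6 : ∀ s : ι → L, (s ∘ Equiv.swap b c) a = s a := fun s => by
    simp [Equiv.swap_apply_of_ne_of_ne hab hac]
  have w1 : ∀ s : ι → L, (s ∘ Equiv.swap a b) ∘ Equiv.swap a b = s := fun s => by
    funext i; simp
  have w2 : ∀ s : ι → L, (s ∘ Equiv.swap b c) ∘ Equiv.swap b c = s := fun s => by
    funext i; simp
  simp only [adjOp_single, map_add, map_smul, v1, v2, v3, v4, v5, v6, w1, w2,
    swap_comp_braid hab hbc hac]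
  -- The six words become free vectors. A proof coefficient by coefficient stays valid when some of
  -- the words coincide.
  generalize (Finsupp.single t (1 : ℂ)) = e0
  generalize (Finsupp.single (t ∘ Equiv.swap a b) (1 : ℂ)) = e1
  generalize (Finsupp.single (t ∘ Equiv.swap b c) (1 : ℂ)) = e2
  generalize (Finsupp.single ((t ∘ Equiv.swap a b) ∘ Equiv.swap b c) (1 : ℂ)) = e3
  generalize (Finsupp.single ((t ∘ Equiv.swap b c) ∘ Equiv.swap a b) (1 : ℂ)) = e4
  generalize (Finsupp.single (((t ∘ Equiv.swap b c) ∘ Equiv.swap a b) ∘ Equiv.swap b c)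
    (1 : ℂ)) = e5
  generalize x (t a) (t b) = X at *
  generalize x (t b) (t c) = Y at *
  generalize x (t a) (t c) = Z at *
  generalize x (t b) (t a) = X' at *
  generalize x (t c) (t b) = Y' at *
  generalize y (t a) (t b) = u at *
  generalize y (t b) (t c) = w at *
  generalize y (t a) (t c) = z at *
  generalize y (t b) (t a) = u' at *
  generalize y (t c) (t b) = w' at *
  rcases h3 with h3 | ⟨h3, h4, h5⟩
  · match_scalars
    · linear_combination (X - Y) * h3 + Z * h2 - Z * h2'
    · linear_combination u * h3 + Z * h1
    · linear_combination (-w) * h3 - Z * h1'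
    · ring
    · ring
    · ring
  · subst h3 h4 h5
    match_scalars <;> ring

lemma adjOp_comm_diag (x y : L → L → ℂ) (f : L → ℂ) {a b c : ι} (hac : a ≠ c) (hbc : b ≠ c)
    (t : ι → L) (D : Module.End ℂ ((ι → L) →₀ ℂ))
    (hD : ∀ s : ι → L, D (Finsupp.single s 1) = f (s c) • (Finsupp.single s 1 : (ι → L) →₀ ℂ)) :
    adjOp x y a b (D (Finsupp.single t 1)) = D (adjOp x y a b (Finsupp.single t 1)) := by
  simp only [adjOp_single, map_add, map_smul, hD]
  have h3 : (t ∘ Equiv.swap a b) c = t c := by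
    simp [Equiv.swap_apply_of_ne_of_ne hac.symm hbc.symm]
  rw [h3]
  module

/-- With D diagonal the coefficients of the word itself agree automatically. Those of the exchanged
word differ by f(t b) - f(t a) times the quantity in `h`. -/
lemma adjOp_braid_four {x y : L → L → ℂ} (f : L → ℂ) {a b : ι} (t : ι → L)
    (D : Module.End ℂ ((ι → L) →₀ ℂ))
    (hD : ∀ s : ι → L, D (Finsupp.single s 1) = f (s a) • (Finsupp.single s 1 : (ι → L) →₀ ℂ))
    (h : y (t a) (t b) * (f (t a) * x (t a) (t b) + f (t b) * x (t b) (t a)) = 0) :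
    D (adjOp x y a b (D (adjOp x y a b (Finsupp.single t 1)))) =
      adjOp x y a b (D (adjOp x y a b (D (Finsupp.single t 1)))) := by
  have v1 : ∀ s : ι → L, (s ∘ Equiv.swap a b) a = s b := fun s => by simp
  have v2 : ∀ s : ι → L, (s ∘ Equiv.swap a b) b = s a := fun s => by simp
  have w1 : ∀ s : ι → L, (s ∘ Equiv.swap a b) ∘ Equiv.swap a b = s := fun s => by
    funext i; simp
  simp only [adjOp_single, map_add, map_smul, hD, v1, v2, w1]
  match_scalars
  · ring
  · linear_combination (f (t b) - f (t a)) * h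

end Words

/-! ### Representations of Hecke algebras -/

namespace Hecke

variable {r n : ℕ} {u : Fin r → ℂ} {q : ℂ}

/-- An algebra homomorphism out of the Hecke algebra from operators satisfying the relations. -/
lemma exists_rep {W : Type*} [AddCommGroup W] [Module ℂ W] (f : Fin n → Module.End ℂ W)
    (hcomm : ∀ i j : Fin n, i.val + 1 < j.val → f i * f j = f j * f i)
    (hbraid : ∀ i j : Fin n, 1 ≤ i.val → j.val = i.val + 1 → f i * f j * f i = f j * f i * f j)
    (hfour : ∀ i j : Fin n, i.val = 0 → j.val = 1 →
      f i * f j * f i * f j = f j * f i * f j * f i)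
    (hcyc : ∀ i : Fin n, i.val = 0 → aeval (f i) (∏ k, (X - C (u k))) = 0)
    (hquad : ∀ i : Fin n, 1 ≤ i.val → f i * f i = (1 - q) • f i + q • 1) :
    ∃ ρ : Hecke n u q →ₐ[ℂ] Module.End ℂ W, ∀ i, ρ (T u q i) = f i := by
  refine ⟨lift f fun a b h => ?_, fun i => lift_T f _ i⟩
  cases h with
  | comm i j h => simpa using hcomm i j h
  | braid i j hi hj => simpa using hbraid i j hi hj
  | braid_four i j hi hj => simpa using hfour i j hi hj
  | cyclotomic i hi =>
    rw [map_zero, ← Polynomial.aeval_algHom_apply, FreeAlgebra.lift_ι_apply]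
    exact hcyc i hi
  | quadratic i hi =>
    simp only [map_mul, map_sub, map_add, map_one, AlgHom.commutes, map_zero,
      FreeAlgebra.lift_ι_apply]
    have := hquad i hi
    rw [Algebra.algebraMap_eq_smul_one, sub_mul, mul_add, mul_add, this]
    simp only [mul_smul_comm, mul_one, one_mul]
    module

lemma induction {P : Hecke n u q → Prop} (h : Hecke n u q)
    (hc : ∀ c, P (algebraMap ℂ _ c)) (hT : ∀ i, P (T u q i))
    (hadd : ∀ a b, P a → P b → P (a + b)) (hmul : ∀ a b, P a → P b → P (a * b)) : P h := by
  obtain ⟨x, rfl⟩ := RingQuot.mkAlgHom_surjective ℂ (HeckeRel (n := n) u q) h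
  change P (mk n u q x)
  induction x using FreeAlgebra.induction with
  | grade0 c => rw [AlgHom.commutes]; exact hc c
  | grade1 i => exact hT i
  | mul a b ha hb => rw [map_mul]; exact hmul _ _ ha hb
  | add a b ha hb => rw [map_add]; exact hadd _ _ ha hb

/-- Over a semisimple Hecke algebra every one-dimensional quotient of a module splits. -/
lemma exists_eigenvector [IsSemisimpleRing (Hecke n u q)] {W : Type*} [AddCommGroup W]
    [Module ℂ W] (ρ : Hecke n u q →ₐ[ℂ] Module.End ℂ W) (ε : W →ₗ[ℂ] ℂ) (χ : Fin n → ℂ)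
    (hε : ∀ i w, ε (ρ (T u q i) w) = χ i * ε w) (w₀ : W) (hw₀ : ε w₀ = 1) :
    ∃ w, ε w = 1 ∧ ∀ i, ρ (T u q i) w = χ i • w := by
  have hker : ∀ (h : Hecke n u q) (w : W), ε w = 0 → ε (ρ h w) = 0 := by
    intro h
    induction h using induction with
    | hc c => intro w hw; simp [Module.algebraMap_end_apply, hw]
    | hT i => intro w hw; rw [hε, hw, mul_zero]
    | hadd a b ha hb => intro w hw; simp [ha w hw, hb w hw]
    | hmul a b ha hb => intro w hw; rw [map_mul]; exact ha _ (hb w hw)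
  let N : Submodule (Hecke n u q) (RepSpace ρ) :=
    { carrier := {w | ε (RepSpace.toSpace ρ w) = 0}
      add_mem' := fun {a b} ha hb => by
        simp only [Set.mem_ofPred_eq, map_add] at *
        rw [ha, hb, add_zero]
      zero_mem' := by simp
      smul_mem' := fun h w hw => hker h _ hw }
  obtain ⟨N', hN⟩ := exists_isCompl N
  have hmem : (RepSpace.toSpace ρ).symm w₀ ∈ N ⊔ N' := by
    rw [hN.sup_eq_top]; trivial
  obtain ⟨a, ha, x, hx, hax⟩ := Submodule.mem_sup.1 hmem
  have ha' : ε (RepSpace.toSpace ρ a) = 0 := ha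
  have h1 : ε (RepSpace.toSpace ρ x) = 1 := by
    have := congrArg (fun z => ε (RepSpace.toSpace ρ z)) hax
    simp only [map_add, LinearEquiv.apply_symm_apply, ha', zero_add] at this
    rw [this, hw₀]
  refine ⟨RepSpace.toSpace ρ x, h1, fun i => ?_⟩
  -- This vector lies in the complement because x does, and in the kernel of ε because T acts on the
  -- quotient by χ, so it is zero.
  have h2 : T u q i • x - χ i • x ∈ N' :=
    N'.sub_mem (N'.smul_mem _ hx) (by
      have := N'.smul_mem (algebraMap ℂ (Hecke n u q) (χ i)) hx
      rwa [algebraMap_smul] at this)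
  have h3 : T u q i • x - χ i • x ∈ N := by
    change ε (RepSpace.toSpace ρ (T u q i • x - χ i • x)) = 0
    rw [map_sub, RepSpace.toSpace_smul, map_smul, map_sub, map_smul, hε, smul_eq_mul, sub_self]
  have h4 := Submodule.disjoint_def.1 hN.disjoint _ h3 h2
  have h5 := congrArg (RepSpace.toSpace ρ) (sub_eq_zero.1 h4)
  rwa [RepSpace.toSpace_smul, map_smul] at h5

end Hecke

/-! ### Representations carried by families of words. -/

section WordRep

variable {L κ : Type*} {r n : ℕ} {u : Fin r → ℂ} {q : ℂ}

/-- A family of words whose span is stable under the operators `D`, `adjOp x y` carries a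
representation of the Hecke algebra as soon as the relations hold locally. -/
lemma Hecke.exists_word_rep (word : κ → Fin n → L) (hinj : Function.Injective word)
    (x y : L → L → ℂ) (D : Module.End ℂ ((Fin n → L) →₀ ℂ))
    (f : Fin n → Module.End ℂ (κ →₀ ℂ))
    (hf0 : ∀ i : Fin n, i.val = 0 → ∀ k, Finsupp.lmapDomain ℂ ℂ word (f i (Finsupp.single k 1)) =
      D (Finsupp.single (word k) 1))
    (hf : ∀ i : Fin n, 1 ≤ i.val → ∀ k,
      Finsupp.lmapDomain ℂ ℂ word (f i (Finsupp.single k 1)) =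
        adjOp x y (prevIdx i) i (Finsupp.single (word k) 1))
    (h1 : ∀ k (i : Fin n), 1 ≤ i.val → y (word k (prevIdx i)) (word k i) *
      (x (word k (prevIdx i)) (word k i) + x (word k i) (word k (prevIdx i)) - (1 - q)) = 0)
    (h2 : ∀ k (i : Fin n), 1 ≤ i.val →
      y (word k (prevIdx i)) (word k i) * y (word k i) (word k (prevIdx i)) =
        (1 - x (word k (prevIdx i)) (word k i)) * (q + x (word k (prevIdx i)) (word k i)))
    (h3 : ∀ k (i j : Fin n), 1 ≤ i.val → j.val = i.val + 1 →
      x (word k (prevIdx i)) (word k i) * x (word k i) (word k j) =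
        x (word k (prevIdx i)) (word k j) *
          (x (word k (prevIdx i)) (word k i) + x (word k i) (word k j) + q - 1) ∨
      x (word k (prevIdx i)) (word k i) = x (word k i) (word k j) ∧
        y (word k (prevIdx i)) (word k i) = 0 ∧ y (word k i) (word k j) = 0)
    (hD : ∀ k (i j : Fin n), i.val = 0 → 1 < j.val →
      adjOp x y (prevIdx j) j (D (Finsupp.single (word k) 1)) =
        D (adjOp x y (prevIdx j) j (Finsupp.single (word k) 1)))
    (hfour : ∀ k (i j : Fin n), i.val = 0 → j.val = 1 →
      D (adjOp x y i j (D (adjOp x y i j (Finsupp.single (word k) 1)))) =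
        adjOp x y i j (D (adjOp x y i j (D (Finsupp.single (word k) 1)))))
    (hcyc : ∀ i : Fin n, i.val = 0 → aeval (f i) (∏ k, (X - C (u k))) = 0) :
    ∃ ρ : Hecke n u q →ₐ[ℂ] Module.End ℂ (κ →₀ ℂ), ∀ i, ρ (Hecke.T u q i) = f i := by
  -- The relations are verified after embedding into the space of all words. There the operators
  -- have uniform formulas, and only words of the family have to satisfy the local laws.
  have hJ : Function.Injective (Finsupp.lmapDomain ℂ ℂ word) := Finsupp.mapDomain_injective hinj
  have g0 : ∀ i : Fin n, i.val = 0 → ∀ w, Finsupp.lmapDomain ℂ ℂ word (f i w) =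
      D (Finsupp.lmapDomain ℂ ℂ word w) := by
    intro i hi w
    have : Finsupp.lmapDomain ℂ ℂ word ∘ₗ f i = D ∘ₗ Finsupp.lmapDomain ℂ ℂ word := by
      refine Finsupp.lhom_ext' fun k => LinearMap.ext_ring ?_
      simpa [Finsupp.mapDomain_single] using hf0 i hi k
    exact LinearMap.congr_fun this w
  have g1 : ∀ i : Fin n, 1 ≤ i.val → ∀ w, Finsupp.lmapDomain ℂ ℂ word (f i w) =
      adjOp x y (prevIdx i) i (Finsupp.lmapDomain ℂ ℂ word w) := by
    intro i hi w
    have : Finsupp.lmapDomain ℂ ℂ word ∘ₗ f i =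
        adjOp x y (prevIdx i) i ∘ₗ Finsupp.lmapDomain ℂ ℂ word := by
      refine Finsupp.lhom_ext' fun k => LinearMap.ext_ring ?_
      simpa [Finsupp.mapDomain_single] using hf i hi k
    exact LinearMap.congr_fun this w
  have js : ∀ k, Finsupp.lmapDomain ℂ ℂ word (Finsupp.single k 1) =
      Finsupp.single (word k) (1 : ℂ) := fun k => Finsupp.mapDomain_single
  apply Hecke.exists_rep
  · intro i j hij
    refine Finsupp.lhom_ext' fun k => LinearMap.ext_ring (hJ ?_)
    simp only [LinearMap.comp_apply, Finsupp.lsingle_apply, Module.End.mul_apply]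
    have hj : 1 ≤ j.val := by omega
    rcases Nat.eq_zero_or_pos i.val with hi | hi
    · rw [g0 i hi, g1 j hj, g1 j hj, g0 i hi, js]
      exact (hD k i j hi (by omega)).symm
    · rw [g1 i hi, g1 j hj, g1 j hj, g1 i hi, js]
      apply adjOp_comm <;> simp only [ne_eq, Fin.ext_iff, prevIdx] <;> omega
  · intro i j hi hj
    refine Finsupp.lhom_ext' fun k => LinearMap.ext_ring (hJ ?_)
    have hj' : 1 ≤ j.val := by omega
    have hp : prevIdx j = i := by
      apply Fin.ext; simp [prevIdx, hj]
    simp only [LinearMap.comp_apply, Finsupp.lsingle_apply, Module.End.mul_apply, g1 i hi,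
      g1 j hj', js, hp]
    have h1' := h1 k j hj'
    have h2' := h2 k j hj'
    rw [hp] at h1' h2'
    refine adjOp_braid ?_ ?_ ?_ _ (h1 k i hi) (h2 k i hi) h1' h2' (h3 k i j hi hj) <;>
      simp only [ne_eq, Fin.ext_iff, prevIdx] <;> omega
  · intro i j hi hj
    refine Finsupp.lhom_ext' fun k => LinearMap.ext_ring (hJ ?_)
    have hj' : 1 ≤ j.val := by omega
    have hp : prevIdx j = i := by
      apply Fin.ext; simp [prevIdx, hj, hi]
    simp only [LinearMap.comp_apply, Finsupp.lsingle_apply, Module.End.mul_apply, g0 i hi,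
      g1 j hj', js, hp]
    exact hfour k i j hi hj
  · exact hcyc
  · intro i hi
    refine Finsupp.lhom_ext' fun k => LinearMap.ext_ring (hJ ?_)
    simp only [LinearMap.comp_apply, Finsupp.lsingle_apply, Module.End.mul_apply, g1 i hi,
      js, LinearMap.add_apply, LinearMap.smul_apply, Module.End.one_apply, map_add, map_smul]
    exact adjOp_quadratic _ _ _ (h1 k i hi) (h2 k i hi)

/-- The transposed formula: w receives a contribution from the exchanged word, hence the reversed
arguments of y. It turns an eigenvector condition into equations between coefficients. -/
lemma adjOp_apply {ι : Type*} [DecidableEq ι] (x y : L → L → ℂ) (a b : ι) (X : (ι → L) →₀ ℂ)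
    (w : ι → L) : adjOp x y a b X w =
      x (w a) (w b) * X w + y (w b) (w a) * X (w ∘ Equiv.swap a b) := by
  classical
  have e2 : ∀ s : ι → L, (s ∘ Equiv.swap a b) ∘ Equiv.swap a b = s := fun s => by
    funext i; simp
  induction X using Finsupp.induction_linear with
  | zero => simp
  | add X Y hX hY => rw [map_add, Finsupp.add_apply, hX, hY]; simp; ring
  | single t c =>
    rw [← mul_one c, ← smul_eq_mul, ← Finsupp.smul_single, map_smul, adjOp_single]
    simp only [Finsupp.smul_apply, Finsupp.add_apply, Finsupp.single_apply, smul_eq_mul]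
    have e : t ∘ Equiv.swap a b = w ↔ t = w ∘ Equiv.swap a b := by
      constructor
      · rintro rfl; exact (e2 t).symm
      · rintro rfl; exact e2 w
    by_cases h1 : t = w
    · by_cases h2 : t ∘ Equiv.swap a b = w
      · have h3 := e.1 h2
        rw [if_pos h1, if_pos h2, if_pos h3]
        have : t b = w a := by rw [h3]; simp [← h1] at h2 ⊢
        subst h1
        have h4 : t a = t b := by
          conv_lhs => rw [← h2]
          simp
        rw [h4]; ring
      · have h3 := fun h => h2 (e.2 h)
        rw [if_pos h1, if_neg h2, if_neg h3, h1]; ring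
    · by_cases h2 : t ∘ Equiv.swap a b = w
      · have h3 := e.1 h2
        rw [if_neg h1, if_pos h2, if_pos h3]
        subst h3
        simp
        ring
      · have h3 := fun h => h2 (e.2 h)
        rw [if_neg h1, if_neg h2, if_neg h3]; ring

end WordRep

/-! ### The Poincaré polynomial of the symmetric group as a sum over words -/

section Weights

variable {L : Type*} [LinearOrder L]

/-- The weight of a pair of letters. -/
def pairWeight (q : ℂ) (A B : L) : ℂ := if A < B then q else if A = B then 0 else 1

/-- The weight of a word: `q` to the number of non-inversions for words with distinct letters, and
`0` for words with repeated letters. -/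
def wordWeight (q : ℂ) {m : ℕ} (w : Fin m → L) : ℂ :=
  ∏ i, ∏ j, if i < j then pairWeight q (w i) (w j) else 1

lemma wordWeight_eq_zero (q : ℂ) {m : ℕ} {w : Fin m → L} (hw : ¬ Function.Injective w) :
    wordWeight q w = 0 := by
  simp only [Function.Injective, not_forall] at hw
  obtain ⟨i, j, hij, hne⟩ := hw
  have key : ∀ i j : Fin m, i < j → w i = w j → wordWeight q w = 0 := by
    intro i j hlt h
    refine Finset.prod_eq_zero (Finset.mem_univ i) (Finset.prod_eq_zero (Finset.mem_univ j) ?_)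
    rw [if_pos hlt, pairWeight, h]
    simp
  rcases lt_or_gt_of_ne hne with h | h
  · exact key i j h hij
  · exact key j i h hij.symm

lemma wordWeight_ne_zero {q : ℂ} (hq : q ≠ 0) {m : ℕ} {w : Fin m → L}
    (hw : Function.Injective w) : wordWeight q w ≠ 0 := by
  refine Finset.prod_ne_zero_iff.2 fun i _ => Finset.prod_ne_zero_iff.2 fun j _ => ?_
  split_ifs with h
  · unfold pairWeight
    rw [if_neg (hw.ne h.ne)]
    split_ifs
    · exact hq
    · exact one_ne_zero
  · exact one_ne_zero

/-- The exchange of adjacent positions permutes the ordered pairs of positions, except for (a, b),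
whose weight falls from q to 1. -/
lemma wordWeight_swap (q : ℂ) {m : ℕ} (w : Fin m → L) {a b : Fin m} (hab : b.val = a.val + 1)
    (hlt : w a < w b) : wordWeight q w = q * wordWeight q (w ∘ Equiv.swap a b) := by
  have hprod : ∀ (h : Fin m → Fin m → ℂ), ∏ i, ∏ j, h i j = ∏ p : Fin m × Fin m, h p.1 p.2 :=
    fun h => (Fintype.prod_prod_type' h).symm
  unfold wordWeight
  have h2 : (∏ i, ∏ j, if i < j then pairWeight q ((w ∘ Equiv.swap a b) i)
      ((w ∘ Equiv.swap a b) j) else 1) =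
      ∏ i, ∏ j, if Equiv.swap a b i < Equiv.swap a b j then pairWeight q (w i) (w j) else 1 := by
    rw [← Equiv.prod_comp (Equiv.swap a b)]
    refine Finset.prod_congr rfl fun i _ => ?_
    rw [← Equiv.prod_comp (Equiv.swap a b)]
    simp
  rw [h2, hprod, hprod]
  -- The extra q is written as a product over pairs, so that the two sides can be compared factor by
  -- factor.
  have h3 : q = ∏ p : Fin m × Fin m, if p = (a, b) then q else 1 := by
    rw [Finset.prod_ite_eq' Finset.univ (a, b)]
    simp
  conv_rhs => enter [1]; rw [h3]
  rw [← Finset.prod_mul_distrib]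
  refine Finset.prod_congr rfl ?_
  rintro ⟨i, j⟩ -
  have hne : w a ≠ w b := hlt.ne
  by_cases h1 : (i, j) = (a, b)
  · rw [if_pos h1]
    simp only [Prod.mk.injEq] at h1
    obtain ⟨rfl, rfl⟩ := h1
    have e1 : i < j := by rw [Fin.lt_def]; omega
    simp [pairWeight, hlt, e1, e1.not_gt]
  · rw [if_neg h1, one_mul]
    by_cases h4 : i = b ∧ j = a
    · obtain ⟨rfl, rfl⟩ := h4
      have e1 : j < i := by rw [Fin.lt_def]; omega
      simp [pairWeight, hlt.not_gt, hne.symm, e1, e1.not_gt]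
    · have : i < j ↔ Equiv.swap a b i < Equiv.swap a b j := by
        simp only [Prod.mk.injEq] at h1
        simp only [Equiv.swap_apply_def, Fin.lt_def, Fin.ext_iff] at *
        split_ifs <;> omega
      simp only [this]

lemma wordWeight_cons (q : ℂ) {m : ℕ} (c : L) (w : Fin m → L) :
    wordWeight q (Fin.cons c w : Fin (m + 1) → L) =
      (∏ j, pairWeight q c (w j)) * wordWeight q w := by
  unfold wordWeight
  rw [Fin.prod_univ_succ, Fin.prod_univ_succ]
  simp [Fin.prod_univ_succ, Fin.succ_pos]

/-- The summand of c is q to the number of letters of S above c, so each exponent below |S| occurs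
once. A new maximum multiplies the old summands by q and contributes 1 itself. -/
lemma sum_prod_pairWeight (q : ℂ) (S : Finset L) :
    ∑ c ∈ S, ∏ b ∈ S.erase c, pairWeight q c b = ∑ i ∈ Finset.range S.card, q ^ i := by
  induction S using Finset.induction_on_max with
  | empty => simp
  | insert a s ha ih =>
    have hna : a ∉ s := fun h => lt_irrefl a (ha a h)
    rw [Finset.sum_insert hna, Finset.erase_insert hna, Finset.card_insert_of_notMem hna,
      Finset.sum_range_succ', add_comm]
    congr 1
    · simp only [pow_succ']
      rw [← Finset.mul_sum, ← ih, Finset.mul_sum]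
      refine Finset.sum_congr rfl fun c hc => ?_
      have hca : a ≠ c := fun h => hna (h ▸ hc)
      rw [Finset.erase_insert_of_ne hca, Finset.prod_insert (by simp [hna])]
      simp [pairWeight, ha c hc]
    · rw [pow_zero]
      refine Finset.prod_eq_one fun b hb => ?_
      have := ha b hb
      simp [pairWeight, this.not_gt, this.ne']

/-- Repeated letters have weight zero, so the sum is the inversion generating function of the
permutations of S. Splitting off the first letter contributes the q-integer [m]_q and leaves the
same sum for one letter fewer. -/
lemma sum_wordWeight (q : ℂ) (m : ℕ) (S : Finset L) (hS : S.card = m) :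
    ∑ w ∈ Fintype.piFinset (fun _ : Fin m => S), wordWeight q w =
      ∏ k ∈ Finset.range m, ∑ i ∈ Finset.range (k + 1), q ^ i := by
  induction m generalizing S with
  | zero => simp [wordWeight]
  | succ m ih =>
    have h1 : ∑ w ∈ Fintype.piFinset (fun _ : Fin (m + 1) => S), wordWeight q w =
        ∑ c ∈ S, ∑ w ∈ Fintype.piFinset (fun _ : Fin m => S),
          wordWeight q (Fin.cons c w : Fin (m + 1) → L) := by
      rw [← Finset.sum_product']
      refine Finset.sum_nbij' (fun w => (w 0, Fin.tail w))
        (fun x => (Fin.cons x.1 x.2 : Fin (m + 1) → L)) ?_ ?_ ?_ ?_ ?_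
      · intro w hw
        simp only [Fintype.mem_piFinset, Finset.mem_product] at hw ⊢
        exact ⟨hw 0, fun i => hw i.succ⟩
      · intro x hx
        simp only [Fintype.mem_piFinset, Finset.mem_product] at hx ⊢
        intro i
        refine Fin.cases ?_ (fun j => ?_) i
        · exact hx.1
        · exact hx.2 j
      · intro w _; exact Fin.cons_self_tail w
      · intro x _; rfl
      · intro w _; simp only [Fin.cons_self_tail]
    have h2 : ∀ c ∈ S, ∑ w ∈ Fintype.piFinset (fun _ : Fin m => S),
        wordWeight q (Fin.cons c w : Fin (m + 1) → L) =
        (∏ b ∈ S.erase c, pairWeight q c b) *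
          ∏ k ∈ Finset.range m, ∑ i ∈ Finset.range (k + 1), q ^ i := by
      intro c hc
      have hcard : (S.erase c).card = m := by rw [Finset.card_erase_of_mem hc, hS]; rfl
      rw [← ih (S.erase c) hcard, Finset.mul_sum]
      -- Tails that contain c again carry a factor zero, so the tail may be restricted to words in
      -- the remaining letters.
      rw [← Finset.sum_subset (s₁ := Fintype.piFinset (fun _ : Fin m => S.erase c))]
      · refine Finset.sum_congr rfl fun w hw => ?_
        rw [wordWeight_cons]
        by_cases hi : Function.Injective w
        · congr 1
          have himg : Finset.univ.image w = S.erase c := by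
            apply Finset.eq_of_subset_of_card_le
            · intro b hb
              obtain ⟨j, -, rfl⟩ := Finset.mem_image.1 hb
              exact Fintype.mem_piFinset.1 hw j
            · rw [Finset.card_image_of_injective _ hi, hcard]; simp
          rw [← himg, Finset.prod_image hi.injOn]
        · rw [wordWeight_eq_zero q hi, mul_zero, mul_zero]
      · exact Fintype.piFinset_subset _ _ fun _ => Finset.erase_subset _ _
      · intro w hw hw'
        rw [Fintype.mem_piFinset] at hw hw'
        push Not at hw'
        obtain ⟨j, hj⟩ := hw'
        have hj' : w j = c := by
          by_contra h
          exact hj (Finset.mem_erase.2 ⟨h, hw j⟩)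
        rw [wordWeight_cons, Finset.prod_eq_zero (Finset.mem_univ j), zero_mul]
        simp [pairWeight, hj']
    rw [h1, Finset.sum_congr rfl h2, ← Finset.sum_mul, sum_prod_pairWeight, hS,
      Finset.prod_range_succ, mul_comm]

end Weights

/-! ### Semisimplicity and the parameters -/

section Letters

variable {L : Type*} [LinearOrder L]

/-- Diagonal coefficients of the Hecke operators on words in an ordered alphabet. -/
def letterDiag (q : ℂ) (A B : L) : ℂ := if A < B then 0 else if A = B then 1 else 1 - q

/-- Off-diagonal coefficients of the Hecke operators on words in an ordered alphabet. -/
def letterSwap (q : ℂ) (A B : L) : ℂ := if A < B then 1 else if A = B then 0 else q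

lemma letter_law_one (q : ℂ) (A B : L) :
    letterSwap q A B * (letterDiag q A B + letterDiag q B A - (1 - q)) = 0 := by
  rcases lt_trichotomy A B with h | h | h
  · simp [letterSwap, letterDiag, h, h.not_gt, h.ne']
  · simp [letterSwap, h]
  · simp [letterSwap, letterDiag, h, h.not_gt, h.ne']

lemma letter_law_two (q : ℂ) (A B : L) : letterSwap q A B * letterSwap q B A =
    (1 - letterDiag q A B) * (q + letterDiag q A B) := by
  rcases lt_trichotomy A B with h | h | h
  · simp [letterSwap, letterDiag, h, h.not_gt, h.ne']
  · simp [letterSwap, letterDiag, h]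
  · simp [letterSwap, letterDiag, h, h.not_gt, h.ne']

/-- Only for A = B = C is the exceptional alternative used: all diagonal coefficients are 1 there
and the three-term identity would read 1 = 1 + q. -/
lemma letter_law_three (q : ℂ) (A B C : L) :
    letterDiag q A B * letterDiag q B C =
      letterDiag q A C * (letterDiag q A B + letterDiag q B C + q - 1) ∨
    letterDiag q A B = letterDiag q B C ∧ letterSwap q A B = 0 ∧ letterSwap q B C = 0 := by
  rcases lt_trichotomy A B with h | rfl | h
  · rcases lt_trichotomy B C with h' | rfl | h'
    · left; simp [letterDiag, h, h', h.trans h']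
    · left; simp [letterDiag, h]
    · rcases lt_trichotomy A C with h'' | rfl | h''
      · left; simp [letterDiag, h, h'', h'.not_gt, h'.ne']
      · left; simp [letterDiag, h, h'.not_gt, h'.ne']
      · left; simp [letterDiag, h, h''.not_gt, h''.ne', h'.not_gt, h'.ne']
  · rcases lt_trichotomy A C with h' | rfl | h'
    · left; simp [letterDiag, h']
    · right; simp [letterSwap]
    · left; simp only [letterDiag, h'.not_gt, h'.ne', lt_irrefl, if_true, if_false]; ring
  · rcases lt_trichotomy B C with h' | rfl | h'
    · rcases lt_trichotomy A C with h'' | rfl | h''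
      · left; simp [letterDiag, h', h'']
      · left; simp [letterDiag, h', h.not_gt, h.ne']
      · left; simp [letterDiag, h', h''.not_gt, h''.ne', h.not_gt, h.ne']
    · left; simp only [letterDiag, h.not_gt, h.ne', lt_irrefl, if_true, if_false]; ring
    · have h'' := h'.trans h
      left
      simp only [letterDiag, h'.not_gt, h'.ne', h''.not_gt, h''.ne', h.not_gt, h.ne', if_false]
      ring

end Letters

/-! ### What semisimplicity implies for q and for the parameters. -/

section Separation

variable {r n : ℕ} {u : Fin r → ℂ} {q : ℂ}

lemma aeval_prod_eq_zero {A : Type*} [Semiring A] [Algebra ℂ A] (a : A) (P : ℂ[X])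
    (hP : aeval a P = 0) (h : P ∣ ∏ k, (X - C (u k))) :
    aeval a (∏ k, (X - C (u k))) = 0 := by
  obtain ⟨Q, hQ⟩ := h
  rw [hQ, map_mul, hP, zero_mul]

lemma lmapDomain_id_single {κ : Type*} (f : κ →₀ ℂ) : Finsupp.lmapDomain ℂ ℂ (id : κ → κ) f = f := by
  simp

/-- The representation of the Hecke algebra on words in an ordered alphabet for which `T_1` acts
by a scalar. -/
lemma exists_letter_rep (L : Type*) [LinearOrder L] (k₀ : Fin r) :
    ∃ ρ : Hecke n u q →ₐ[ℂ] Module.End ℂ ((Fin n → L) →₀ ℂ),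
      ∀ i, ρ (Hecke.T u q i) = if i.val = 0 then u k₀ • 1 else
        adjOp (letterDiag q) (letterSwap q) (prevIdx i) i := by
  refine Hecke.exists_word_rep id Function.injective_id (letterDiag q) (letterSwap q) (u k₀ • 1)
    _ ?_ ?_ ?_ ?_ ?_ ?_ ?_ ?_
  · intro i hi k
    rw [lmapDomain_id_single, if_pos hi]
    rfl
  · intro i hi k
    rw [lmapDomain_id_single, if_neg (by omega)]
    rfl
  · intros; apply letter_law_one
  · intros; apply letter_law_two
  · intros; apply letter_law_three
  · intro k i j _ _
    simp only [LinearMap.smul_apply, Module.End.one_apply, map_smul]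
  · intro k i j _ _
    simp only [LinearMap.smul_apply, Module.End.one_apply, map_smul]
  · intro i hi
    rw [if_pos hi]
    apply aeval_prod_eq_zero (P := X - C (u k₀))
    · simp [Algebra.algebraMap_eq_smul_one]
    · exact Finset.dvd_prod_of_mem _ (Finset.mem_univ k₀)

lemma perm_induction {m : ℕ} {P : Equiv.Perm (Fin m) → Prop} (h1 : P 1)
    (hs : ∀ σ (a b : Fin m), b.val = a.val + 1 → P σ → P (σ * Equiv.swap a b))
    (σ : Equiv.Perm (Fin m)) : P σ := by
  cases m with
  | zero => rwa [Subsingleton.elim σ 1]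
  | succ m =>
    have : σ ∈ Submonoid.closure
        (Set.range fun i : Fin m => Equiv.swap i.castSucc i.succ) := by
      rw [Equiv.Perm.mclosure_swap_castSucc_succ]; trivial
    induction this using Submonoid.closure_induction_right with
    | one => exact h1
    | mul_right x hx y hy ih =>
      obtain ⟨i, rfl⟩ := hy
      exact hs _ _ _ (by simp) ih

/-- If the Hecke algebra is semisimple, the `q`-integers `[k]_q` with `1 ≤ k ≤ n` are nonzero. -/
theorem geom_sum_ne_zero_of_semisimple [IsSemisimpleRing (Hecke n u q)] (hq : q ≠ 0)
    (k₀ : Fin r) {k : ℕ} (hk : 1 ≤ k) (hkn : k ≤ n) : ∑ i ∈ Finset.range k, q ^ i ≠ 0 := by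
  classical
  obtain ⟨ρ, hρ⟩ := exists_letter_rep (n := n) (u := u) (q := q) (Fin n) k₀
  -- Adding up the coefficients of the words with distinct letters gives a quotient on which T_i, i
  -- ≥ 2, acts by 1.
  let ε : ((Fin n → Fin n) →₀ ℂ) →ₗ[ℂ] ℂ :=
    Finsupp.linearCombination ℂ fun w => if Function.Injective w then (1 : ℂ) else 0
  have hεs : ∀ w, ε (Finsupp.single w 1) = if Function.Injective w then (1 : ℂ) else 0 :=
    fun w => by simp [ε, Finsupp.linearCombination_single]
  have hadj : ∀ (i : Fin n), 1 ≤ i.val → ∀ w,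
      ε (adjOp (letterDiag q) (letterSwap q) (prevIdx i) i w) = ε w := by
    intro i hi w
    have hne : prevIdx i ≠ i := by
      simp only [ne_eq, Fin.ext_iff, prevIdx]; omega
    have : ε ∘ₗ adjOp (letterDiag q) (letterSwap q) (prevIdx i) i = ε := by
      refine Finsupp.lhom_ext' fun k => LinearMap.ext_ring ?_
      simp only [LinearMap.comp_apply, Finsupp.lsingle_apply, adjOp_single, map_add, map_smul, hεs,
        Equiv.injective_comp]
      split_ifs with h
      · have h' : k (prevIdx i) ≠ k i := h.ne hne
        rcases lt_or_gt_of_ne h' with h1 | h1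
        · simp [letterDiag, letterSwap, h1]
        · simp [letterDiag, letterSwap, h1.not_gt, h1.ne']
      · simp
    exact LinearMap.congr_fun this w
  obtain ⟨x, hx1, hx⟩ := Hecke.exists_eigenvector ρ ε (fun i => if i.val = 0 then u k₀ else 1)
    (by
      intro i w
      rw [hρ]
      split_ifs with hi
      · simp
      · rw [hadj i (by omega), one_mul])
    (Finsupp.single id 1) (by rw [hεs, if_pos Function.injective_id])
  have hswap : ∀ (w : Fin n → Fin n) (a b : Fin n), b.val = a.val + 1 → w a < w b →
      x w = q * x (w ∘ Equiv.swap a b) := by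
    intro w a b hab hlt
    have h1 := hx b
    have hp : prevIdx b = a := by apply Fin.ext; simp [prevIdx, hab]
    rw [hρ, if_neg (by omega), if_neg (by omega), one_smul, hp] at h1
    have h2 := DFunLike.congr_fun h1 w
    rw [adjOp_apply] at h2
    simp only [letterDiag, letterSwap, hlt, hlt.not_gt, hlt.ne', if_true, if_false] at h2
    rw [← h2]; ring
  -- The eigenvector equations are the recursion satisfied by `wordWeight`, so on permutations x is
  -- proportional to it. Writing this without division places the nonzero weight of the identity on
  -- the left.
  have hperm : ∀ σ : Equiv.Perm (Fin n), x σ * wordWeight q (id : Fin n → Fin n) =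
      x id * wordWeight q σ := by
    intro σ
    induction σ using perm_induction with
    | h1 => simp
    | hs σ a b hab ih =>
      have hne : a ≠ b := by simp only [ne_eq, Fin.ext_iff]; omega
      have hc : ((σ * Equiv.swap a b : Equiv.Perm (Fin n)) : Fin n → Fin n) =
        σ ∘ Equiv.swap a b := rfl
      have e2 : ((σ : Fin n → Fin n) ∘ Equiv.swap a b) ∘ Equiv.swap a b = σ := by funext i; simp
      -- Proportionality passes through an adjacent exchange in both directions; a factor q is
      -- cancelled in one and multiplied in the other.
      have key : ∀ z z' W W' : ℂ, ∀ c d : ℂ, z * c = d * W → (z = q * z' ∧ W = q * W' ∨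
          z' = q * z ∧ W' = q * W) → z' * c = d * W' := by
        rintro z z' W W' c d h (⟨rfl, rfl⟩ | ⟨rfl, rfl⟩)
        · apply mul_left_cancel₀ hq; linear_combination h
        · linear_combination q * h
      refine key _ _ _ _ _ _ ih ?_
      rw [hc]
      rcases lt_or_gt_of_ne (σ.injective.ne hne) with h | h
      · left
        exact ⟨hswap _ _ _ hab h, wordWeight_swap q _ hab h⟩
      · right
        have h' : ((σ : Fin n → Fin n) ∘ Equiv.swap a b) a <
          ((σ : Fin n → Fin n) ∘ Equiv.swap a b) b := by simpa using h
        have h3 := hswap _ _ _ hab h'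
        have h4 := wordWeight_swap q _ hab h'
        rw [e2] at h3 h4
        exact ⟨h3, h4⟩
  have hsum : ε x = ∑ w : Fin n → Fin n, if Function.Injective w then x w else 0 := by
    simp only [ε, Finsupp.linearCombination_apply]
    rw [Finsupp.sum_fintype _ _ (by simp)]
    refine Finset.sum_congr rfl fun w _ => ?_
    split_ifs <;> simp
  -- Summing over permutations produces the q-factorial. The left side is nonzero because ε x = 1,
  -- so no q-integer in the product can vanish.
  have hprod : wordWeight q (id : Fin n → Fin n) * ε x =
      x id * ∏ k ∈ Finset.range n, ∑ i ∈ Finset.range (k + 1), q ^ i := by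
    rw [hsum, ← sum_wordWeight q n (Finset.univ : Finset (Fin n)) (by simp), Finset.mul_sum,
      Finset.mul_sum, Fintype.piFinset_univ]
    refine Finset.sum_congr rfl fun w _ => ?_
    split_ifs with h
    · have := hperm (Equiv.ofBijective w (Finite.injective_iff_bijective.1 h))
      rw [mul_comm]
      exact this
    · rw [wordWeight_eq_zero q h, mul_zero, mul_zero]
  intro h0
  rw [Finset.prod_eq_zero (Finset.mem_range.2 (show k - 1 < n by omega))
    (by rwa [Nat.sub_add_cancel hk]), mul_zero, hx1, mul_one] at hprod
  exact wordWeight_ne_zero hq Function.injective_id hprod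

/-- The operator flipping a sign, with eigenvalues `a` and `b`. -/
noncomputable def flipOp {ι : Type*} [DecidableEq ι] (a b : ℂ) (z : ι) :
    Module.End ℂ ((ι → Bool) →₀ ℂ) :=
  Finsupp.linearCombination ℂ fun w : ι → Bool =>
    (if w z then a + b else 0) • (Finsupp.single w 1 : (ι → Bool) →₀ ℂ) +
      (if w z then -(a * b) else 1) • Finsupp.single (Function.update w z (!w z)) 1

lemma flipOp_single {ι : Type*} [DecidableEq ι] (a b : ℂ) (z : ι) (w : ι → Bool) :
    flipOp a b z (Finsupp.single w 1) =
      (if w z then a + b else 0) • (Finsupp.single w 1 : (ι → Bool) →₀ ℂ) +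
      (if w z then -(a * b) else 1) • Finsupp.single (Function.update w z (!w z)) 1 := by
  simp [flipOp, Finsupp.linearCombination_single]

/-- The order of the alphabet `{+, -}` (`false` is `+`) for which `-` comes first. -/
abbrev signDiag (q : ℂ) (A B : Bool) : ℂ := letterDiag q (!A) (!B)

/-- The off-diagonal coefficients for the alphabet `{+, -}`. -/
abbrev signSwap (q : ℂ) (A B : Bool) : ℂ := letterSwap q (!A) (!B)

lemma not_lt_true_false : ¬ (true < false) := by decide

/-- Coefficients at words with a minus at z already determine how an eigenvector changes when that
sign is flipped. -/
lemma flipOp_apply {ι : Type*} [DecidableEq ι] (a b : ℂ) (z : ι) (X : (ι → Bool) →₀ ℂ)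
    (w : ι → Bool) (hw : w z = true) :
    flipOp a b z X w = (a + b) * X w + X (Function.update w z false) := by
  classical
  induction X using Finsupp.induction_linear with
  | zero => simp
  | add X Y hX hY => simp only [map_add, Finsupp.add_apply, hX, hY]; ring
  | single t c =>
    have e : Function.update t z true = w ↔ Function.update t z false =
        Function.update w z false := by
      constructor
      · rintro rfl
        rw [Function.update_idem]
      · intro h
        have := congrArg (fun s => Function.update s z true) h
        simp only [Function.update_idem] at this
        rw [this, ← hw, Function.update_eq_self]
    rw [← mul_one c, ← smul_eq_mul, ← Finsupp.smul_single, map_smul, flipOp_single]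
    simp only [Finsupp.smul_apply, Finsupp.add_apply, Finsupp.single_apply, smul_eq_mul]
    cases htz : t z
    · have h1 : t ≠ w := fun h => by rw [h, hw] at htz; simp at htz
      rw [← htz, Function.update_eq_self, htz] at e
      simp [h1, e]
    · have h1 : Function.update t z false ≠ w := fun h => by rw [← h] at hw; simp at hw
      have h2 : t ≠ Function.update w z false := fun h => by rw [h] at htz; simp at htz
      simp [h1, h2]
      split_ifs <;> ring

/-- Both operators touch only the signs at i and j, so this is an identity on the four words e β γ
obtained by varying them. -/
lemma flipOp_braid_four {ι : Type*} [DecidableEq ι] (a b q : ℂ) {i j : ι} (hij : i ≠ j)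
    (w : ι → Bool) :
    flipOp a b i (adjOp (signDiag q) (signSwap q) i j (flipOp a b i
      (adjOp (signDiag q) (signSwap q) i j (Finsupp.single w 1)))) =
    adjOp (signDiag q) (signSwap q) i j (flipOp a b i
      (adjOp (signDiag q) (signSwap q) i j (flipOp a b i (Finsupp.single w 1)))) := by
  let e : Bool → Bool → ι → Bool := fun β γ => Function.update (Function.update w i β) j γ
  have he1 : ∀ β γ, e β γ i = β := fun β γ => by simp [e, hij]
  have he2 : ∀ β γ, e β γ j = γ := fun β γ => by simp [e]
  have hw : w = e (w i) (w j) := by simp [e]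
  have hupd : ∀ β γ δ, Function.update (e β γ) i δ = e δ γ := fun β γ δ => by
    simp only [e]
    rw [Function.update_comm hij.symm, Function.update_idem]
  have hsw : ∀ β γ, e β γ ∘ Equiv.swap i j = e γ β := fun β γ => by
    funext k
    by_cases h1 : k = i
    · subst h1; simp [he1, he2]
    by_cases h2 : k = j
    · subst h2; simp [he1, he2]
    simp [e, Equiv.swap_apply_of_ne_of_ne h1 h2, h1, h2]
  rw [hw]
  generalize w i = β
  generalize w j = γ
  cases β <;> cases γ <;>
  · simp only [flipOp_single, adjOp_single, map_add, map_smul, he1, he2, hupd, hsw, Bool.not_true,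
      Bool.not_false, letterDiag, letterSwap, signDiag, signSwap, not_lt_true_false,
      Bool.false_lt_true, lt_irrefl, if_true, if_false, Bool.true_eq_false, Bool.false_eq_true]
    module

/-- The representation of the Hecke algebra on words in `{+, -}` for which `T_1` flips the first
sign. -/
lemma exists_sign_rep {k₁ k₂ : Fin r} (hk : k₁ ≠ k₂) :
    ∃ ρ : Hecke n u q →ₐ[ℂ] Module.End ℂ ((Fin n → Bool) →₀ ℂ),
      ∀ i, ρ (Hecke.T u q i) = if i.val = 0 then flipOp (u k₁) (u k₂) i else
        adjOp (signDiag q) (signSwap q) (prevIdx i) i := by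
  rcases Nat.eq_zero_or_pos n with hn | hn
  · subst hn
    exact (Hecke.exists_rep (fun i => i.elim0) (fun i => i.elim0) (fun i => i.elim0)
      (fun i => i.elim0) (fun i => i.elim0) (fun i => i.elim0)).imp fun ρ _ => fun i => i.elim0
  let z : Fin n := ⟨0, hn⟩
  have hz : ∀ i : Fin n, i.val = 0 → i = z := fun i hi => Fin.ext hi
  refine Hecke.exists_word_rep id Function.injective_id (signDiag q) (signSwap q)
    (flipOp (u k₁) (u k₂) z) _ ?_ ?_ ?_ ?_ ?_ ?_ ?_ ?_
  · intro i hi k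
    rw [lmapDomain_id_single, if_pos hi, hz i hi]
    rfl
  · intro i hi k
    rw [lmapDomain_id_single, if_neg (by omega)]
    rfl
  · intros; apply letter_law_one
  · intros; apply letter_law_two
  · intros; apply letter_law_three
  · intro w i j _ hj
    have h1 : prevIdx j ≠ z := by simp only [ne_eq, Fin.ext_iff, prevIdx, z]; omega
    have h2 : j ≠ z := by simp only [ne_eq, Fin.ext_iff, z]; omega
    have h3 : Equiv.swap (prevIdx j) j z = z := Equiv.swap_apply_of_ne_of_ne h1.symm h2.symm
    simp only [id, flipOp_single, adjOp_single, map_add, map_smul, Function.comp, h3]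
    rw [Function.update_of_ne h1, Function.update_of_ne h2]
    have h4 : Function.update w z (!w z) ∘ Equiv.swap (prevIdx j) j =
        Function.update (w ∘ Equiv.swap (prevIdx j) j) z (!w z) := by
      have := Function.update_comp_equiv w (Equiv.swap (prevIdx j) j) z (!w z)
      rw [Equiv.symm_swap, h3] at this
      exact this
    rw [h4]
    module
  · intro w i j hi hj
    rw [← hz i hi]
    apply flipOp_braid_four
    simp only [ne_eq, Fin.ext_iff]; omega
  · intro i hi
    rw [if_pos hi]
    -- The flip is annihilated by the quadratic polynomial with roots u k₁ and u k₂, which divides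
    -- the cyclotomic polynomial because the indices differ.
    apply aeval_prod_eq_zero (P := (X - C (u k₁)) * (X - C (u k₂)))
    · rw [map_mul]
      refine Finsupp.lhom_ext' fun w => LinearMap.ext_ring ?_
      simp only [LinearMap.comp_apply, Finsupp.lsingle_apply, Module.End.mul_apply, map_sub,
        aeval_X, aeval_C, LinearMap.sub_apply, Module.algebraMap_end_apply, flipOp_single, map_add,
        map_smul, Function.update_self, Function.update_idem, LinearMap.zero_apply]
      cases h : w i <;>
      · have h' := Function.update_eq_self i w
        rw [h] at h'
        simp only [Bool.not_true, Bool.not_false, h', if_true, if_false, Bool.false_eq_true]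
        module
    · rw [← Finset.mul_prod_erase _ _ (Finset.mem_univ k₁),
        ← Finset.mul_prod_erase _ _ (Finset.mem_erase.2 ⟨hk.symm, Finset.mem_univ k₂⟩), ← mul_assoc]
      exact dvd_mul_right _ _

/-- If the Hecke algebra is semisimple, its parameters are separated. -/
theorem param_ne_of_semisimple [IsSemisimpleRing (Hecke n u q)] (hq : q ≠ 0)
    {k₁ k₂ : Fin r} (hk : k₁ ≠ k₂) (hu : u k₂ ≠ 0) {m : ℕ} (hm : m < n) :
    u k₁ ≠ q ^ m * u k₂ := by
  classical
  obtain ⟨ρ, hρ⟩ := exists_sign_rep (n := n) (u := u) (q := q) hk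
  let z : Fin n := ⟨0, by omega⟩
  set a := u k₁ with ha
  set b := u k₂ with hb
  -- The functional weights a word by a to the number of its minus signs. On the resulting quotient
  -- T_1 acts by a and the other generators by 1.
  let η : (Fin n → Bool) → ℂ := fun w => ∏ i, if w i then a else 1
  let ε : ((Fin n → Bool) →₀ ℂ) →ₗ[ℂ] ℂ := Finsupp.linearCombination ℂ η
  have hεs : ∀ w, ε (Finsupp.single w 1) = η w :=
    fun w => by simp [ε, Finsupp.linearCombination_single]
  have hηswap : ∀ w (σ : Equiv.Perm (Fin n)), η (w ∘ σ) = η w := fun w σ =>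
    Equiv.prod_comp σ (fun i => if w i then a else 1)
  have hηupd : ∀ (w : Fin n → Bool) (i : Fin n) (β : Bool), η (Function.update w i β) =
      (if β then a else 1) * ∏ j ∈ Finset.univ.erase i, if w j then a else 1 := by
    intro w i β
    simp only [η]
    rw [← Finset.mul_prod_erase _ _ (Finset.mem_univ i), Function.update_self]
    congr 1
    refine Finset.prod_congr rfl fun j hj => ?_
    rw [Function.update_of_ne (Finset.ne_of_mem_erase hj)]
  obtain ⟨x, hx1, hx⟩ := Hecke.exists_eigenvector ρ ε (fun i => if i.val = 0 then a else 1)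
    (by
      intro i w
      rw [hρ, ← smul_eq_mul, ← LinearMap.smul_apply, ← LinearMap.comp_apply]
      congr 1
      refine Finsupp.lhom_ext' fun w => LinearMap.ext_ring ?_
      simp only [LinearMap.comp_apply, Finsupp.lsingle_apply, LinearMap.smul_apply]
      split_ifs with hi
      · simp only [flipOp_single, map_add, map_smul, hεs, hηupd]
        have hself := hηupd w i (w i)
        rw [Function.update_eq_self] at hself
        rw [hself]
        cases w i <;> simp
        ring
      · simp only [adjOp_single, map_add, map_smul, hεs, hηswap]
        cases w (prevIdx i) <;> cases w i <;> simp [letterDiag, letterSwap, not_lt_true_false]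
        ring)
    (Finsupp.single (fun _ => false) 1) (by rw [hεs]; simp [η])
  -- The factor by which the eigenvector changes when the sign at position i turns from plus to
  -- minus: -b⁻¹ comes from T_1, and each step to the right costs q⁻¹.
  let κ : Fin n → ℂ := fun i => -(b⁻¹ * (q ^ i.val)⁻¹)
  have hflip0 : ∀ w : Fin n → Bool, x (Function.update w z true) =
      κ z * x (Function.update w z false) := by
    intro w
    have h1 := hx z
    rw [hρ, if_pos rfl, if_pos rfl] at h1
    have h2 := DFunLike.congr_fun h1 (Function.update w z true)
    rw [flipOp_apply _ _ _ _ _ (by simp), Finsupp.smul_apply, smul_eq_mul,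
      Function.update_idem] at h2
    simp only [κ, z, pow_zero, inv_one, mul_one] at h2 ⊢
    field_simp
    linear_combination h2
  have hswap : ∀ (w : Fin n → Bool) (i j : Fin n), j.val = i.val + 1 → w i = false → w j = true →
      x (w ∘ Equiv.swap i j) = q * x w := by
    intro w i j hij hi hj
    have h1 := hx j
    have hp : prevIdx j = i := by apply Fin.ext; simp [prevIdx, hij]
    rw [hρ, if_neg (by omega), if_neg (by omega), one_smul, hp] at h1
    have h2 := DFunLike.congr_fun h1 (w ∘ Equiv.swap i j)
    have e2 : ((w : Fin n → Bool) ∘ Equiv.swap i j) ∘ Equiv.swap i j = w := by funext i; simp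
    rw [adjOp_apply, e2] at h2
    simp only [Function.comp, Equiv.swap_apply_left, Equiv.swap_apply_right, hi, hj, letterDiag,
      letterSwap, not_lt_true_false, Bool.false_lt_true, Bool.not_true, Bool.not_false, if_true,
      if_false, Bool.true_eq_false] at h2
    rw [← h2]
    ring
  -- Exchanging neighbouring letters carries a flip at i + 1 to a flip at i, so the first position
  -- determines the rest.
  have hflip : ∀ (i : Fin n) (w : Fin n → Bool), x (Function.update w i true) =
      κ i * x (Function.update w i false) := by
    rintro ⟨i, hi⟩
    induction i with
    | zero => exact hflip0
    | succ i ih =>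
      intro w
      let j : Fin n := ⟨i, by omega⟩
      let k : Fin n := ⟨i + 1, hi⟩
      have hjk : j ≠ k := by simp [j, k, Fin.ext_iff]
      have hκ : q * κ k = κ j := by
        simp only [κ, j, k, pow_succ]
        field_simp
      have hsw : ∀ β γ, Function.update (Function.update w k β) j γ ∘ Equiv.swap j k =
          Function.update (Function.update w k γ) j β := by
        intro β γ
        funext l
        by_cases h1 : l = j
        · subst h1; simp [hjk.symm]
        by_cases h2 : l = k
        · subst h2; simp [hjk.symm]
        simp [Equiv.swap_apply_of_ne_of_ne h1 h2, h1, h2]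
      have h1 := hswap (Function.update (Function.update w k true) j false) j k rfl (by simp)
        (by simp [hjk.symm])
      rw [hsw] at h1
      have h2 := ih (by omega) (Function.update w k false)
      have h3 := ih (by omega) (Function.update w k true)
      change x (Function.update (Function.update w k false) j true) = κ j * _ at h2
      change x (Function.update (Function.update w k true) j true) = κ j * _ at h3
      change x (Function.update w k true) = κ k * x (Function.update w k false)
      apply mul_left_cancel₀ hq
      rw [← mul_assoc, hκ]
      have hw : ∀ β, Function.update w k β = Function.update (Function.update w k β) j (w j) := by
        intro β
        have : w j = Function.update w k β j := by rw [Function.update_of_ne hjk]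
        rw [this, Function.update_eq_self]
      rw [hw true, hw false]
      cases w j
      · exact h1.symm.trans h2
      · rw [h3]
        exact (mul_left_comm _ _ _).trans (congrArg _ h1.symm)
  have hxw : ∀ w : Fin n → Bool, x w = x (fun _ => false) * ∏ i, if w i then κ i else 1 := by
    have key : ∀ s : Finset (Fin n), x (fun i => decide (i ∈ s)) =
        x (fun _ => false) * ∏ i ∈ s, κ i := by
      intro s
      induction s using Finset.induction_on with
      | empty => simp
      | insert i s hi ih =>
        have h1 := hflip i (fun j => decide (j ∈ s))
        have e1 : Function.update (fun j => decide (j ∈ s)) i true =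
            fun j => decide (j ∈ insert i s) := by
          funext j
          by_cases h : j = i
          · subst h; simp
          · simp [h]
        have e2 : Function.update (fun j => decide (j ∈ s)) i false = fun j => decide (j ∈ s) := by
          funext j
          by_cases h : j = i
          · subst h; simp [hi]
          · simp [h]
        rw [e1, e2, ih] at h1
        rw [h1, Finset.prod_insert hi]
        ring
    intro w
    have := key (Finset.univ.filter fun i => w i = true)
    simp only [Finset.mem_filter, Finset.mem_univ, true_and, Bool.decide_eq_true,
      Finset.prod_filter] at this
    exact this
  -- The coefficients of x and the weights η are both products over positions, so the sum over words
  -- factors.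
  have hsum : ε x = x (fun _ => false) * ∏ i, (1 + a * κ i) := by
    have h1 : ∏ i, (1 + a * κ i) = ∏ i : Fin n, ∑ β : Bool, if β then a * κ i else 1 := by
      refine Finset.prod_congr rfl fun i _ => ?_
      simp [add_comm]
    rw [h1, Finset.prod_univ_sum, Finset.mul_sum]
    simp only [ε, Finsupp.linearCombination_apply]
    rw [Finsupp.sum_fintype _ _ (by simp), Fintype.piFinset_univ]
    refine Finset.sum_congr rfl fun w _ => ?_
    rw [hxw w, smul_eq_mul, mul_assoc, ← Finset.prod_mul_distrib]
    congr 1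
    refine Finset.prod_congr rfl fun i _ => ?_
    cases w i <;> simp [mul_comm]
  -- If a = q^m b, the factor at position m is 1 - a b⁻¹ q⁻ᵐ = 0, against ε x = 1.
  intro h0
  rw [Finset.prod_eq_zero (Finset.mem_univ (⟨m, hm⟩ : Fin n)), mul_zero, hx1] at hsum
  · exact one_ne_zero hsum
  · rw [h0]
    simp only [κ]
    have := pow_ne_zero m hq
    field_simp
    ring

end Separation

/-! ### Bounds for contents -/

section Bounds

variable {p d : ℕ}

/-- Each integer between the two contents is the content of a cell of D in a first row or a first
column, so D has at least that many cells. When the components differ, the corner of one of them has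
not been counted. -/
lemma content_bound_aux [DecidableEq (Cell p d)] (D : Finset (Cell p d))
    (hD : ∀ A ∈ D, ∀ k l : ℕ, k ≤ A.2.1 → l ≤ A.2.2 → (A.1, (k, l)) ∈ D)
    {A B : Cell p d} (hA : A ∈ D) (hB : B ∈ D) (h : content A ≤ content B) :
    content B - content A + 1 ≤ D.card ∧
      (A.1 ≠ B.1 → content B - content A + 2 ≤ D.card) := by
  -- For k ≥ 0 the cell in the first row of the component of B, for k < 0 the cell in the first
  -- column of the component of A. Both lie north-west of the given cell.
  let f : ℤ → Cell p d := fun k => (if 0 ≤ k then B.1 else A.1, ((-k).toNat, k.toNat))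
  have hf : Function.Injective f := by
    intro k l hkl
    have h1 : (-k).toNat = (-l).toNat := congrArg (fun z => z.2.1) hkl
    have h2 : k.toNat = l.toNat := congrArg (fun z => z.2.2) hkl
    omega
  have hcard : ((Finset.Icc (content A) (content B)).image f).card =
      (content B - content A + 1).toNat := by
    rw [Finset.card_image_of_injective _ hf, Int.card_Icc]
    congr 1
    ring
  have hsub : (Finset.Icc (content A) (content B)).image f ⊆ D := by
    intro C hC
    obtain ⟨k, hk, rfl⟩ := Finset.mem_image.1 hC
    rw [Finset.mem_Icc] at hk
    simp only [content] at hk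
    simp only [f]
    split_ifs with h0
    · exact hD B hB _ _ (by omega) (by omega)
    · exact hD A hA _ _ (by omega) (by omega)
  constructor
  · have := Finset.card_le_card hsub
    omega
  · intro hne
    have key : ∀ E ∈ D, E ∉ (Finset.Icc (content A) (content B)).image f →
        content B - content A + 2 ≤ D.card := by
      intro E hE hE'
      have := Finset.card_le_card (Finset.insert_subset hE hsub)
      rw [Finset.card_insert_of_notMem hE'] at this
      omega
    -- If content B ≥ 0, the component of A is met only at negative contents and its corner is new.
    -- Otherwise every chosen cell lies in the component of A and the corner of B is new.
    by_cases h0 : 0 ≤ content B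
    · refine key (A.1, (0, 0)) (hD A hA 0 0 (by omega) (by omega)) fun hm => ?_
      obtain ⟨k, hk, h1⟩ := Finset.mem_image.1 hm
      have h2 : (-k).toNat = 0 := congrArg (fun z => z.2.1) h1
      have h3 : k.toNat = 0 := congrArg (fun z => z.2.2) h1
      have h4 : k = 0 := by omega
      subst h4
      exact hne (Prod.ext_iff.1 h1).1.symm
    · refine key (B.1, (0, 0)) (hD B hB 0 0 (by omega) (by omega)) fun hm => ?_
      obtain ⟨k, hk, h1⟩ := Finset.mem_image.1 hm
      rw [Finset.mem_Icc] at hk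
      have h2 := (Prod.ext_iff.1 h1).1
      simp only [f] at h2
      rw [if_neg (by omega)] at h2
      exact hne h2

lemma content_bound [DecidableEq (Cell p d)] (D : Finset (Cell p d))
    (hD : ∀ A ∈ D, ∀ k l : ℕ, k ≤ A.2.1 → l ≤ A.2.2 → (A.1, (k, l)) ∈ D)
    {A B : Cell p d} (hA : A ∈ D) (hB : B ∈ D) :
    |content B - content A| + 1 ≤ D.card ∧
      (A.1 ≠ B.1 → |content B - content A| + 2 ≤ D.card) := by
  rcases le_total (content A) (content B) with h | h
  · rw [abs_of_nonneg (by omega)]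
    exact content_bound_aux D hD hA hB h
  · rw [abs_of_nonpos (by omega), neg_sub]
    have := content_bound_aux D hD hB hA h
    exact ⟨this.1, fun hne => this.2 hne.symm⟩

end Bounds

/-! ### Combinatorics of standard tableaux -/

section Combinatorics

variable {p d n : ℕ} [NeZero p] {lam : MultiDiagram p d n}

/-- `B` is the right or the lower neighbour of `A`. -/
def Nbr (A B : Cell p d) : Prop :=
  A.1 = B.1 ∧ (B.2 = (A.2.1, A.2.2 + 1) ∨ B.2 = (A.2.1 + 1, A.2.2))

namespace IsStandard

variable {t : Fin n → Cell p d}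

lemma injective (h : IsStandard lam t) : Function.Injective t :=
  Set.injOn_univ.1 h.bij.injOn

lemma lt_of_nbr (h : IsStandard lam t) {a b : Fin n} (hab : Nbr (t a) (t b)) : a < b := by
  rcases hab with ⟨h1, h2 | h2⟩
  · exact h.row a b h1 h2
  · exact h.col a b h1 h2

lemma mem_cells (h : IsStandard lam t) (a : Fin n) : t a ∈ lam.cells :=
  h.bij.mapsTo (Set.mem_univ a)

lemma exists_eq (h : IsStandard lam t) {A : Cell p d} (hA : A ∈ lam.cells) : ∃ a, t a = A := by
  obtain ⟨a, -, ha⟩ := h.bij.surjOn hA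
  exact ⟨a, ha⟩

lemma exists_eq_of_le (h : IsStandard lam t) {a : Fin n} {k l : ℕ} (hk : k ≤ (t a).2.1)
    (hl : l ≤ (t a).2.2) : ∃ b, t b = ((t a).1, (k, l)) := by
  apply h.exists_eq
  have := h.mem_cells a
  simp only [MultiDiagram.cells, Set.mem_ofPred_eq] at this ⊢
  exact (lam.diag (t a).1.1 (t a).1.2).isLowerSet (show ((k, l) : ℕ × ℕ) ≤ (t a).2 from ⟨hk, hl⟩)
    this

/-- Numbers increase from a cell to the cells to the south-east of it. -/
lemma le_of_le (h : IsStandard lam t) {a b : Fin n} (h0 : (t b).1 = (t a).1)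
    (h1 : (t b).2.1 ≤ (t a).2.1) (h2 : (t b).2.2 ≤ (t a).2.2) : b ≤ a := by
  obtain ⟨i, hi⟩ := Nat.exists_eq_add_of_le h1
  obtain ⟨j, hj⟩ := Nat.exists_eq_add_of_le h2
  induction i generalizing a with
  | zero =>
    induction j generalizing a with
    | zero =>
      have : t b = t a := Prod.ext h0 (Prod.ext (by omega) (by omega))
      rw [h.injective this]
    | succ j ih =>
      obtain ⟨c, hc⟩ := h.exists_eq_of_le (a := a) (k := (t a).2.1) (l := (t b).2.2 + j) le_rfl
        (by omega)
      have hca : c < a := h.row c a (by rw [hc]) (by rw [hc]; ext <;> simp; omega)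
      exact (ih (by rw [hc, h0]) (by rw [hc]; exact h1) (by rw [hc]; simp) (by rw [hc]; exact hi)
        (by rw [hc])).trans hca.le
  | succ i ih =>
    obtain ⟨c, hc⟩ := h.exists_eq_of_le (a := a) (k := (t b).2.1 + i) (l := (t a).2.2) (by omega)
      le_rfl
    have hca : c < a := h.col c a (by rw [hc]) (by rw [hc]; ext <;> simp; omega)
    exact (ih (by rw [hc, h0]) (by rw [hc]; simp) (by rw [hc]; exact h2) (by rw [hc])
      (by rw [hc]; exact hj)).trans hca.le

/-- If one cell lies weakly south-east of the other, a neighbour of the first on the way carries a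
number in between and must be the second cell. Otherwise the cells are in strict north-east,
south-west position. -/
lemma consecutive (h : IsStandard lam t) {a b : Fin n} (hab : b.val = a.val + 1)
    (h0 : (t a).1 = (t b).1) : Nbr (t a) (t b) ∨
      ((t a).2.1 < (t b).2.1 ∧ (t b).2.2 < (t a).2.2) ∨
      ((t b).2.1 < (t a).2.1 ∧ (t a).2.2 < (t b).2.2) := by
  by_cases h1 : (t b).2.1 ≤ (t a).2.1 ∧ (t b).2.2 ≤ (t a).2.2
  · have := h.le_of_le h0.symm h1.1 h1.2
    rw [Fin.le_def] at this
    omega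
  by_cases h2 : (t a).2.1 ≤ (t b).2.1 ∧ (t a).2.2 ≤ (t b).2.2
  · left
    refine ⟨h0, ?_⟩
    by_cases h3 : (t a).2.2 < (t b).2.2
    · left
      obtain ⟨c, hc⟩ := h.exists_eq_of_le (a := b) (k := (t a).2.1) (l := (t a).2.2 + 1) h2.1
        (by omega)
      have h4 : a < c := h.row a c (by rw [hc, h0]) (by rw [hc])
      have h5 : c ≤ b := h.le_of_le (by rw [hc]) (by rw [hc]; exact h2.1) (by rw [hc]; exact h3)
      have h6 : c = b := by
        rw [Fin.lt_def] at h4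
        rw [Fin.le_def] at h5
        apply Fin.ext
        omega
      rw [← h6, hc]
    · right
      obtain ⟨c, hc⟩ := h.exists_eq_of_le (a := b) (k := (t a).2.1 + 1) (l := (t a).2.2) (by omega)
        h2.2
      have h4 : a < c := h.col a c (by rw [hc, h0]) (by rw [hc])
      have h5 : c ≤ b := h.le_of_le (by rw [hc]) (by rw [hc]; show _ + 1 ≤ _; omega)
        (by rw [hc]; exact h2.2)
      have h6 : c = b := by
        rw [Fin.lt_def] at h4
        rw [Fin.le_def] at h5
        apply Fin.ext
        omega
      rw [← h6, hc]
  · omega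

/-- On a common diagonal the right and the lower neighbour of the first cell would both carry a
number strictly between a and c, but there is only one such number. -/
lemma content_ne_of_two_apart (h : IsStandard lam t) {a b c : Fin n} (hab : b.val = a.val + 1)
    (hbc : c.val = b.val + 1) (h0 : (t a).1 = (t c).1) : content (t a) ≠ content (t c) := by
  intro hc
  simp only [content] at hc
  by_cases h1 : (t c).2.1 ≤ (t a).2.1
  · have := h.le_of_le h0.symm h1 (by omega)
    rw [Fin.le_def] at this
    omega
  · obtain ⟨x, hx⟩ := h.exists_eq_of_le (a := c) (k := (t a).2.1) (l := (t a).2.2 + 1) (by omega)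
      (by omega)
    obtain ⟨y, hy⟩ := h.exists_eq_of_le (a := c) (k := (t a).2.1 + 1) (l := (t a).2.2) (by omega)
      (by omega)
    have h4 : a < x := h.row a x (by rw [hx, h0]) (by rw [hx])
    have h5 : a < y := h.col a y (by rw [hy, h0]) (by rw [hy])
    have h6 : x ≤ c := h.le_of_le (by rw [hx]) (by rw [hx]; show (t a).2.1 ≤ _; omega)
      (by rw [hx]; show (t a).2.2 + 1 ≤ _; omega)
    have h7 : y ≤ c := h.le_of_le (by rw [hy]) (by rw [hy]; show (t a).2.1 + 1 ≤ _; omega)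
      (by rw [hy]; show (t a).2.2 ≤ _; omega)
    have h8 : x ≠ c := by
      rintro rfl
      have : (t x).2.1 = (t a).2.1 := congrArg (fun z => z.2.1) hx
      omega
    have h9 : y ≠ c := by
      rintro rfl
      have : (t y).2.2 = (t a).2.2 := congrArg (fun z => z.2.2) hy
      omega
    have h10 : x = y := by
      rw [Fin.lt_def] at h4 h5
      rw [Fin.le_def] at h6 h7
      rw [ne_eq, Fin.ext_iff] at h8 h9
      apply Fin.ext
      omega
    subst h10
    have := congrArg (fun z => z.2.1) (hx.symm.trans hy)
    simp at this

/-- Exchanging consecutive numbers reverses the order of that pair only, so standardness can fail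
only if their cells are adjacent. -/
lemma swap_iff (h : IsStandard lam t) {a b : Fin n} (hab : b.val = a.val + 1) :
    IsStandard lam (t ∘ Equiv.swap a b) ↔ ¬ Nbr (t a) (t b) := by
  constructor
  · intro h' hn
    have : b < a := h'.lt_of_nbr (by simpa using hn)
    rw [Fin.lt_def] at this
    omega
  · intro hn
    have key : ∀ i j, Nbr (t (Equiv.swap a b i)) (t (Equiv.swap a b j)) → i < j := by
      intro i j hij
      have h1 := h.lt_of_nbr hij
      have h2 : ¬ (Equiv.swap a b i = a ∧ Equiv.swap a b j = b) := by
        rintro ⟨h3, h4⟩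
        rw [h3, h4] at hij
        exact hn hij
      simp only [Equiv.swap_apply_def, Fin.lt_def, Fin.ext_iff] at *
      split_ifs at * <;> omega
    refine ⟨?_, fun i j h1 h2 => key i j ⟨h1, Or.inl h2⟩, fun i j h1 h2 => key i j ⟨h1, Or.inr h2⟩⟩
    exact h.bij.comp ((Set.bijOn_univ).2 (Equiv.swap a b).bijective)

end IsStandard

/-- Any two standard tableaux of the same shape are connected by exchanges of consecutive
numbers. -/
lemma tableau_induction {P : StdTableau lam → Prop}
    (hs : ∀ (t : StdTableau lam) (a b : Fin n) (_ : b.val = a.val + 1)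
      (h : IsStandard lam (t.1 ∘ Equiv.swap a b)), P t → P ⟨_, h⟩)
    (s t : StdTableau lam) (h : P s) : P t := by
  -- The cell that should carry M is moved up from its current number m by e exchanges, leaving the
  -- numbers above M untouched.
  have inner : ∀ (M : Fin n) (e : ℕ) (m : Fin n) (s : StdTableau lam), m.val + e = M.val → P s →
      (∀ i, M < i → s.1 i = t.1 i) → s.1 m = t.1 M →
      ∃ s' : StdTableau lam, P s' ∧ ∀ i, M ≤ i → s'.1 i = t.1 i := by
    intro M e
    induction e with
    | zero =>
      intro m s hm hP hagree hsm
      have : m = M := Fin.ext (by omega)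
      subst this
      refine ⟨s, hP, fun i hi => ?_⟩
      rcases hi.eq_or_lt with rfl | hi
      · exact hsm
      · exact hagree i hi
    | succ e ih =>
      intro m s hm hP hagree hsm
      let m' : Fin n := ⟨m.val + 1, by omega⟩
      -- If the two cells were adjacent, t would put a number above M into the second one. There s
      -- agrees with t, yet s has m + 1 ≤ M in that cell.
      have hstd : IsStandard lam (s.1 ∘ Equiv.swap m m') := by
        rw [s.2.swap_iff rfl]
        intro hn
        obtain ⟨j, hj⟩ := t.2.exists_eq (s.2.mem_cells m')
        rw [hsm, ← hj] at hn
        have h1 := t.2.lt_of_nbr hn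
        rw [← hagree j h1] at hj
        have h2 := s.2.injective hj
        rw [h2, Fin.lt_def] at h1
        simp only [m'] at h1
        omega
      refine ih m' ⟨_, hstd⟩ (by simp only [m']; omega) (hs s m m' rfl hstd hP) ?_ ?_
      · intro i hi
        rw [← hagree i hi]
        have h1 : i ≠ m := by rintro rfl; rw [Fin.lt_def] at hi; omega
        have h2 : i ≠ m' := by
          rintro rfl
          rw [Fin.lt_def] at hi
          simp only [m'] at hi
          omega
        simp [Equiv.swap_apply_of_ne_of_ne h1 h2]
      · simpa using hsm
  -- The numbers are put in place from the largest downwards.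
  have outer : ∀ k ≤ n, ∃ s' : StdTableau lam, P s' ∧ ∀ i : Fin n, n - k ≤ i.val →
      s'.1 i = t.1 i := by
    intro k
    induction k with
    | zero => exact fun _ => ⟨s, h, fun i hi => by omega⟩
    | succ k ih =>
      intro hk
      obtain ⟨s', hP, hagree⟩ := ih (by omega)
      let M : Fin n := ⟨n - (k + 1), by omega⟩
      obtain ⟨m, hm⟩ := s'.2.exists_eq (t.2.mem_cells M)
      have hmM : m.val ≤ M.val := by
        by_contra hlt
        have h1 := hagree m (by simp only [M] at hlt; omega)
        rw [hm] at h1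
        have := t.2.injective h1
        rw [this] at hlt
        exact hlt le_rfl
      obtain ⟨s'', hP', h'⟩ := inner M (M.val - m.val) m s' (by omega) hP
        (fun i hi => hagree i (by rw [Fin.lt_def] at hi; simp only [M] at hi; omega)) hm
      exact ⟨s'', hP', fun i hi => h' i (by rw [Fin.le_def]; exact hi)⟩
  obtain ⟨s', hP, h'⟩ := outer n le_rfl
  have : s' = t := Subtype.ext (funext fun i => h' i (by omega))
  rwa [← this]

/-! ### Existence of standard tableaux -/

lemma exists_isStandard (lam : MultiDiagram p d n) : ∃ t, IsStandard lam t := by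
  classical
  let D : Finset (Cell p d) := Finset.univ.biUnion fun c : ZMod p × Fin d =>
    (lam.diag c.1 c.2).cells.image (Prod.mk c)
  have hD : ∀ A, A ∈ D ↔ A ∈ lam.cells := by
    rintro ⟨c, x⟩
    simp only [D, Finset.mem_biUnion, Finset.mem_univ, true_and, Finset.mem_image,
      MultiDiagram.cells, Set.mem_ofPred_eq]
    constructor
    · rintro ⟨c', x', h, h'⟩
      obtain ⟨rfl, rfl⟩ := Prod.ext_iff.1 h'
      exact h
    · intro h; exact ⟨c, x, h, rfl⟩
  have hcard : D.card = n := by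
    rw [Finset.card_biUnion]
    · refine Eq.trans ?_ lam.size
      rw [Fintype.sum_prod_type]
      refine Finset.sum_congr rfl fun i _ => Finset.sum_congr rfl fun j _ => ?_
      rw [Finset.card_image_of_injective _ (Prod.mk_right_injective _)]
    · intro c _ c' _ hne
      rw [Function.onFun, Finset.disjoint_left]
      intro A hA hA'
      obtain ⟨x, -, rfl⟩ := Finset.mem_image.1 hA
      obtain ⟨x', -, h⟩ := Finset.mem_image.1 hA'
      exact hne (Prod.ext_iff.1 h).1.symm
  -- Cells are numbered in lexicographic order of component, row and column, an order that increases
  -- to right and lower neighbours.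
  let key : Cell p d → ℕ ×ₗ (ℕ ×ₗ (ℕ ×ₗ ℕ)) := fun A =>
    toLex (A.1.1.val, toLex (A.1.2.val, toLex (A.2.1, A.2.2)))
  have hkey : Function.Injective key := by
    rintro ⟨⟨a, b⟩, k, l⟩ ⟨⟨a', b'⟩, k', l'⟩ h
    simp only [key, EmbeddingLike.apply_eq_iff_eq, Prod.mk.injEq] at h
    obtain ⟨h1, h2, h3, h4⟩ := h
    rw [ZMod.val_injective p h1, Fin.ext h2, h3, h4]
  let f := (D.image key).orderEmbOfFin (k := n) (by rw [Finset.card_image_of_injective _ hkey, hcard])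
  have hf : ∀ i, ∃ A ∈ D, key A = f i := fun i =>
    Finset.mem_image.1 (Finset.orderEmbOfFin_mem _ _ i)
  choose t htD ht using hf
  have hlt : ∀ a b, key (t a) < key (t b) → a < b := by
    intro a b h
    rw [ht, ht] at h
    exact f.lt_iff_lt.1 h
  refine ⟨t, ⟨fun a _ => (hD _).1 (htD a), ?_, ?_⟩, ?_, ?_⟩
  · intro a _ b _ h
    apply f.injective
    rw [← ht, ← ht, h]
  · intro A hA
    have : key A ∈ Set.range f := by
      rw [Finset.range_orderEmbOfFin]
      exact Finset.mem_coe.2 (Finset.mem_image_of_mem _ ((hD A).2 hA))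
    obtain ⟨a, ha⟩ := this
    exact ⟨a, Set.mem_univ a, hkey ((ht a).trans ha)⟩
  · intro a b h1 h2
    apply hlt
    simp only [key, h1, h2, Prod.Lex.toLex_lt_toLex]
    simp
  · intro a b h1 h2
    apply hlt
    simp only [key, h1, h2, Prod.Lex.toLex_lt_toLex]
    simp

instance : Nonempty (StdTableau lam) :=
  let ⟨t, ht⟩ := exists_isStandard lam
  ⟨⟨t, ht⟩⟩

lemma IsStandard.content_bound {t : Fin n → Cell p d} (h : IsStandard lam t) (a b : Fin n) :
    |content (t b) - content (t a)| + 1 ≤ n ∧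
      ((t a).1 ≠ (t b).1 → |content (t b) - content (t a)| + 2 ≤ n) := by
  classical
  have hcard : (Finset.univ.image t).card = n := by
    rw [Finset.card_image_of_injective _ h.injective]; simp
  have := CyclotomicHecke.content_bound (Finset.univ.image t) (by
    intro A hA k l hk hl
    obtain ⟨a, -, rfl⟩ := Finset.mem_image.1 hA
    obtain ⟨b, hb⟩ := h.exists_eq_of_le hk hl
    exact Finset.mem_image.2 ⟨b, Finset.mem_univ b, hb⟩)
    (Finset.mem_image_of_mem t (Finset.mem_univ a)) (Finset.mem_image_of_mem t (Finset.mem_univ b))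
  rwa [hcard] at this

/-- Two standard tableaux, possibly of different shapes, that differ for the first time at `i`. -/
lemma IsStandard.content_bound_first_diff {mu : MultiDiagram p d n} {s t : Fin n → Cell p d}
    (hs : IsStandard lam s) (ht : IsStandard mu t) (i : Fin n) (heq : ∀ j < i, s j = t j) :
    |content (t i) - content (s i)| ≤ n ∧
      ((s i).1 ≠ (t i).1 → |content (t i) - content (s i)| < n) := by
  classical
  -- The common part together with both cells at i is closed to the north-west. It has at most n + 1
  -- cells, one more than a single tableau.
  let D : Finset (Cell p d) := insert (t i) ((Finset.univ.filter fun j => j ≤ i).image s)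
  have hcard : D.card ≤ n + 1 := by
    refine (Finset.card_insert_le _ _).trans (Nat.succ_le_succ ?_)
    refine Finset.card_image_le.trans ((Finset.card_filter_le _ _).trans ?_)
    simp
  have hmem : ∀ j ≤ i, s j ∈ D := fun j hj =>
    Finset.mem_insert_of_mem (Finset.mem_image.2 ⟨j, by simpa using hj, rfl⟩)
  have := CyclotomicHecke.content_bound D (A := s i) (B := t i) (by
    intro A hA k l hk hl
    rcases Finset.mem_insert.1 hA with rfl | hA
    · obtain ⟨b, hb⟩ := ht.exists_eq_of_le hk hl
      have hbi : b ≤ i := ht.le_of_le (by rw [hb]) (by rw [hb]; exact hk) (by rw [hb]; exact hl)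
      rw [← hb]
      rcases hbi.eq_or_lt with rfl | hlt
      · exact Finset.mem_insert_self _ _
      · rw [← heq b hlt]
        exact hmem b hbi
    · obtain ⟨a, ha, rfl⟩ := Finset.mem_image.1 hA
      obtain ⟨b, hb⟩ := hs.exists_eq_of_le hk hl
      have hbi : b ≤ a := hs.le_of_le (by rw [hb]) (by rw [hb]; exact hk) (by rw [hb]; exact hl)
      rw [← hb]
      exact hmem b (hbi.trans (by simpa using ha)))
    (hmem i le_rfl) (Finset.mem_insert_self _ _)
  refine ⟨?_, fun hne => ?_⟩
  · have h1 := this.1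
    omega
  · have h1 := this.2 hne
    omega

/-- Of two cells on one diagonal, one is north-west of the other. It would have to be filled before
i, hence in both tableaux, although it is the cell of i in one of them. -/
lemma IsStandard.content_ne_first_diff {mu : MultiDiagram p d n} {s t : Fin n → Cell p d}
    (hs : IsStandard lam s) (ht : IsStandard mu t) (i : Fin n) (heq : ∀ j < i, s j = t j)
    (hne : s i ≠ t i) (h0 : (s i).1 = (t i).1) : content (s i) ≠ content (t i) := by
  have key : ∀ {lam mu : MultiDiagram p d n} {s t : Fin n → Cell p d}, IsStandard lam s →
      IsStandard mu t → (∀ j < i, s j = t j) → s i ≠ t i → (s i).1 = (t i).1 →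
      content (s i) = content (t i) → (s i).2.1 ≤ (t i).2.1 → False := by
    intro lam mu s t hs ht heq hne h0 hc hle
    simp only [content] at hc
    obtain ⟨b, hb⟩ := ht.exists_eq_of_le (a := i) hle (show (s i).2.2 ≤ _ by omega)
    have hb' : t b = s i := by rw [hb, ← h0]
    have hbi : b ≤ i := ht.le_of_le (by rw [hb]) (by rw [hb]; exact hle)
      (by rw [hb]; show (s i).2.2 ≤ _; omega)
    rcases hbi.eq_or_lt with rfl | hlt
    · exact hne hb'.symm
    · rw [← heq b hlt] at hb'
      exact hlt.ne (hs.injective hb')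
  intro hc
  rcases le_total (s i).2.1 (t i).2.1 with h | h
  · exact key hs ht heq hne h0 hc h
  · exact key ht hs (fun j hj => (heq j hj).symm) hne.symm h0.symm hc.symm h

end Combinatorics

/-! ### Separated parameters and the seminormal coefficients -/

section Coefficients

variable {p d : ℕ} {n : ℕ} {ξ : ℂ} {v : Fin d → ℂ} {q : ℂ}

/-- The conditions on the parameters under which the seminormal formulas make sense and give
simple modules. -/
structure Separated (p n : ℕ) {d : ℕ} (ξ : ℂ) (v : Fin d → ℂ) (q : ℂ) : Prop where
  q_ne : q ≠ 0
  param_ne : ∀ A : Cell p d, compParam ξ v A ≠ 0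
  qInt_ne : ∀ k : ℤ, k ≠ 0 → |k| ≤ n → qInt q k ≠ 0
  param_sep : ∀ A B : Cell p d, A.1 ≠ B.1 → ∀ k : ℤ, |k| < n →
    compParam ξ v A ≠ q ^ k * compParam ξ v B

/-- If the cyclotomic Hecke algebra is semisimple, its parameters are separated. -/
theorem separated_of_semisimple [NeZero p] (hd : 0 < d) (hq : q ≠ 0) (hξ : IsPrimitiveRoot ξ p)
    (hv : ∀ j, v j ≠ 0) (hss : IsSemisimpleRing (HeckeR1n p n ξ v q)) : Separated p n ξ v q := by
  have hξ0 : ξ ≠ 0 := hξ.ne_zero (NeZero.ne p)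
  have hparam : ∀ A : Cell p d, compParam ξ v A ≠ 0 := fun A =>
    mul_ne_zero (pow_ne_zero _ hξ0) (hv _)
  -- The position of the component's parameter in the list of cyclotomic parameters.
  let idx : Cell p d → Fin (d * p) := fun A =>
    finProdFinEquiv (A.1.2, ⟨A.1.1.val, ZMod.val_lt A.1.1⟩)
  have hidx : ∀ A, cycParam p ξ v (idx A) = compParam ξ v A := by
    intro A
    have h := finProdFinEquiv.symm_apply_apply ((A.1.2, ⟨A.1.1.val, ZMod.val_lt A.1.1⟩) : Fin d × Fin p)
    simp only [finProdFinEquiv_symm_apply, Prod.mk.injEq] at h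
    simp only [cycParam, idx, h.1, h.2, compParam]
  have hidxne : ∀ A B : Cell p d, A.1 ≠ B.1 → idx A ≠ idx B := by
    intro A B hne h
    have h1 := finProdFinEquiv.injective h
    simp only [Prod.mk.injEq, Fin.mk.injEq] at h1
    exact hne (Prod.ext (ZMod.val_injective p h1.2) h1.1)
  refine ⟨hq, hparam, ?_, ?_⟩
  · intro k hk hkn
    unfold qInt
    split_ifs with h1
    · exact_mod_cast hk
    · refine div_ne_zero ?_ (sub_ne_zero.2 h1)
      have key : ∀ m : ℕ, 1 ≤ m → m ≤ n → q ^ m ≠ 1 := by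
        intro m hm1 hmn h
        have h2 := geom_sum_ne_zero_of_semisimple (u := cycParam p ξ v) hq
          (⟨0, Nat.mul_pos hd (NeZero.pos p)⟩ : Fin (d * p)) hm1 hmn
        apply h2
        have h3 := geom_sum_mul q m
        rw [h, sub_self] at h3
        exact (mul_eq_zero.1 h3).resolve_right (sub_ne_zero.2 h1)
      rw [sub_ne_zero]
      obtain ⟨m, rfl | rfl⟩ := k.eq_nat_or_neg
      · rw [zpow_natCast]
        apply key <;> simp at hk hkn <;> omega
      · rw [zpow_neg, zpow_natCast, ne_eq, inv_eq_one]
        apply key <;> simp at hk hkn <;> omega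
  · intro A B hne k hk
    rw [← hidx A, ← hidx B]
    -- A negative exponent is treated by exchanging the roles of the two cells.
    obtain ⟨m, rfl | rfl⟩ := k.eq_nat_or_neg
    · rw [zpow_natCast]
      exact param_ne_of_semisimple hq (hidxne A B hne) (by rw [hidx]; exact hparam B)
        (by simp at hk; omega)
    · have h2 := param_ne_of_semisimple (n := n) (u := cycParam p ξ v) hq (hidxne B A (Ne.symm hne))
        (by rw [hidx]; exact hparam A) (m := m) (by simp at hk; omega)
      intro h
      apply h2
      rw [h, zpow_neg, zpow_natCast, mul_inv_cancel_left₀ (pow_ne_zero _ hq)]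

/-- The residue of a cell. -/
noncomputable def residue (ξ : ℂ) (v : Fin d → ℂ) (q : ℂ) (A : Cell p d) : ℂ :=
  compParam ξ v A * q ^ (-content A)

/-- Pairs of cells for which the seminormal coefficients have nonvanishing denominators. -/
structure GoodPair (ξ : ℂ) (v : Fin d → ℂ) (q : ℂ) (A B : Cell p d) : Prop where
  content_ne : A.1 = B.1 → content A ≠ content B
  residue_ne : q ≠ 1 → residue ξ v q A ≠ residue ξ v q B

lemma GoodPair.symm {A B : Cell p d} (h : GoodPair ξ v q A B) : GoodPair ξ v q B A :=
  ⟨fun h0 => (h.content_ne h0.symm).symm, fun h1 => (h.residue_ne h1).symm⟩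

lemma compParam_congr {A B : Cell p d} (h : A.1 = B.1) : compParam ξ v A = compParam ξ v B := by
  simp only [compParam, h]

lemma Separated.zpow_ne_one (hS : Separated p n ξ v q) (hq1 : q ≠ 1) {k : ℤ} (hk : k ≠ 0) (hkn : |k| ≤ n) : q ^ k ≠ 1 := by
  have := hS.qInt_ne k hk hkn
  rw [qInt, if_neg hq1] at this
  intro h
  simp [h] at this

lemma Separated.residue_ne_of_fst_ne (hS : Separated p n ξ v q) {A B : Cell p d} (h : A.1 ≠ B.1)
    (hc : |content B - content A| < n) : residue ξ v q A ≠ residue ξ v q B := by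
  intro he
  apply hS.param_sep A B h (-(content B - content A)) (by rwa [abs_neg])
  unfold residue at he
  rw [neg_sub, sub_eq_add_neg, zpow_add₀ hS.q_ne, mul_assoc, mul_comm (q ^ (-content B)), ← he,
    mul_left_comm, ← zpow_add₀ hS.q_ne, add_neg_cancel, zpow_zero, mul_one]

/-- For different components, diagonal coefficient 1 would mean that one residue is q times the
other. The additional q is what costs one unit in the content bound. -/
lemma Separated.residue_ne_mul (hS : Separated p n ξ v q) {A B : Cell p d} (h : A.1 ≠ B.1)
    (hc : |content B - content A| + 1 < n) : residue ξ v q A ≠ q * residue ξ v q B := by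
  intro he
  apply hS.param_sep A B h (-(content B - content A) + 1) (by
    refine lt_of_le_of_lt (abs_add_le _ _) ?_
    rwa [abs_neg, abs_one])
  unfold residue at he
  rw [neg_sub, zpow_add_one₀ hS.q_ne, sub_eq_add_neg, zpow_add₀ hS.q_ne]
  have h1 : q ^ content A * q ^ (-content A) = 1 := by
    rw [← zpow_add₀ hS.q_ne, add_neg_cancel, zpow_zero]
  linear_combination q ^ content A * he - compParam ξ v A * h1

lemma Separated.residue_ne_of_content_ne (hS : Separated p n ξ v q) {A B : Cell p d} (hq1 : q ≠ 1) (h : A.1 = B.1)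
    (hc : |content B - content A| ≤ n) (hne : content A ≠ content B) :
    residue ξ v q A ≠ residue ξ v q B := by
  intro he
  apply hS.zpow_ne_one hq1 (sub_ne_zero.2 hne.symm) hc
  unfold residue at he
  rw [compParam_congr h] at he
  have h2 := mul_left_cancel₀ (hS.param_ne B) he
  rw [sub_eq_add_neg, zpow_add₀ hS.q_ne, h2, ← zpow_add₀ hS.q_ne, add_neg_cancel, zpow_zero]

lemma Separated.goodPair (hS : Separated p n ξ v q) {A B : Cell p d} (h1 : A.1 = B.1 → content A ≠ content B)
    (h2 : |content B - content A| ≤ n) (h3 : A.1 ≠ B.1 → |content B - content A| < n) :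
    GoodPair ξ v q A B := by
  refine ⟨h1, fun hq1 => ?_⟩
  by_cases h : A.1 = B.1
  · exact hS.residue_ne_of_content_ne hq1 h h2 (h1 h)
  · exact hS.residue_ne_of_fst_ne h (h3 h)

/-- For q ≠ 1 one formula in the residues covers both cases, because a common component parameter
cancels. The coefficient identities then become identities of rational functions. -/
lemma Separated.diagCoeff_eq (hS : Separated p n ξ v q) (hq1 : q ≠ 1) (A B : Cell p d) : diagCoeff ξ v q A B =
    ((q - 1) * residue ξ v q B) / (residue ξ v q A - residue ξ v q B) := by
  unfold diagCoeff
  split_ifs with h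
  · have h1 := hS.param_ne B
    have h2 : q ^ (-content B) ≠ 0 := zpow_ne_zero _ hS.q_ne
    have h3 : residue ξ v q A - residue ξ v q B =
        (compParam ξ v B * q ^ (-content B)) * (q ^ (content B - content A) - 1) := by
      simp only [residue, compParam_congr h]
      rw [mul_sub, mul_assoc, ← zpow_add₀ hS.q_ne, mul_one]
      congr 3
      ring
    rw [h3, qInt, if_neg hq1, inv_div, residue, mul_comm (q - 1), mul_div_mul_left]
    exact mul_ne_zero h1 h2
  · rfl

lemma diagCoeff_one_of_eq {A B : Cell p d} (h : A.1 = B.1) :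
    diagCoeff ξ v 1 A B = ((content B - content A : ℤ) : ℂ)⁻¹ := by
  simp [diagCoeff, h, qInt]

lemma diagCoeff_one_of_ne {A B : Cell p d} (h : A.1 ≠ B.1) : diagCoeff ξ v 1 A B = 0 := by
  simp [diagCoeff, h]

lemma Separated.diagCoeff_add (hS : Separated p n ξ v q) {A B : Cell p d} (h : GoodPair ξ v q A B) :
    diagCoeff ξ v q A B + diagCoeff ξ v q B A = 1 - q := by
  by_cases hq1 : q = 1
  · subst hq1
    by_cases h0 : A.1 = B.1
    · rw [diagCoeff_one_of_eq h0, diagCoeff_one_of_eq h0.symm, ← neg_sub, Int.cast_neg, inv_neg]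
      ring
    · rw [diagCoeff_one_of_ne h0, diagCoeff_one_of_ne (Ne.symm h0)]
      ring
  · have h1 := sub_ne_zero.2 (h.residue_ne hq1)
    have h2 := sub_ne_zero.2 (h.residue_ne hq1).symm
    rw [hS.diagCoeff_eq hq1, hS.diagCoeff_eq hq1]
    field_simp
    ring

/-- A form without denominators, which also holds at q = 1, where both sides vanish. -/
lemma Separated.residue_mul_diagCoeff (hS : Separated p n ξ v q) {A B : Cell p d} (h : GoodPair ξ v q A B) :
    (residue ξ v q A - residue ξ v q B) * diagCoeff ξ v q A B = (q - 1) * residue ξ v q B := by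
  by_cases hq1 : q = 1
  · subst hq1
    by_cases h0 : A.1 = B.1
    · simp [residue, compParam_congr h0]
    · rw [diagCoeff_one_of_ne h0]
      ring
  · have h1 := sub_ne_zero.2 (h.residue_ne hq1)
    rw [hS.diagCoeff_eq hq1]
    field_simp

/-- At q = 1 in a single component this is 1/(jk) = (1/j + 1/k)/(j + k) for the content differences
j and k; coefficients between different components are zero. -/
lemma Separated.diagCoeff_braid (hS : Separated p n ξ v q) {A B C : Cell p d} (h1 : GoodPair ξ v q A B)
    (h2 : GoodPair ξ v q B C) (h3 : GoodPair ξ v q A C) :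
    diagCoeff ξ v q A B * diagCoeff ξ v q B C =
      diagCoeff ξ v q A C * (diagCoeff ξ v q A B + diagCoeff ξ v q B C + q - 1) := by
  by_cases hq1 : q = 1
  · subst hq1
    by_cases hab : A.1 = B.1
    · by_cases hbc : B.1 = C.1
      · have e1 : ((content B - content A : ℤ) : ℂ) ≠ 0 :=
          Int.cast_ne_zero.2 (sub_ne_zero.2 (h1.content_ne hab).symm)
        have e2 : ((content C - content B : ℤ) : ℂ) ≠ 0 :=
          Int.cast_ne_zero.2 (sub_ne_zero.2 (h2.content_ne hbc).symm)
        have e3 : ((content C - content A : ℤ) : ℂ) ≠ 0 :=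
          Int.cast_ne_zero.2 (sub_ne_zero.2 (h3.content_ne (hab.trans hbc)).symm)
        rw [diagCoeff_one_of_eq hab, diagCoeff_one_of_eq hbc, diagCoeff_one_of_eq (hab.trans hbc)]
        field_simp
        push_cast
        ring
      · rw [diagCoeff_one_of_ne hbc, diagCoeff_one_of_ne (A := A) (fun h => hbc (hab.symm.trans h))]
        ring
    · by_cases hbc : B.1 = C.1
      · rw [diagCoeff_one_of_ne hab, diagCoeff_one_of_ne (A := A) (B := C) (fun h => hab (h.trans hbc.symm))]
        ring
      · rw [diagCoeff_one_of_ne hab, diagCoeff_one_of_ne hbc]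
        ring
  · have e1 := sub_ne_zero.2 (h1.residue_ne hq1)
    have e2 := sub_ne_zero.2 (h2.residue_ne hq1)
    have e3 := sub_ne_zero.2 (h3.residue_ne hq1)
    rw [hS.diagCoeff_eq hq1, hS.diagCoeff_eq hq1, hS.diagCoeff_eq hq1]
    field_simp
    ring

/-- A right neighbour has content difference 1 and coefficient 1, a lower neighbour has difference
-1 and coefficient -q. These are the roots of the quadratic relation. -/
lemma Separated.diagCoeff_nbr (hS : Separated p n ξ v q) {A B : Cell p d} (h : Nbr A B) :
    (1 - diagCoeff ξ v q A B) * (q + diagCoeff ξ v q A B) = 0 := by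
  obtain ⟨h0, h1⟩ := h
  have hq := hS.q_ne
  rw [diagCoeff, if_pos h0]
  rcases h1 with h1 | h1
  · have : content B - content A = 1 := by simp only [content, h1]; push_cast; ring
    rw [this]
    by_cases hq1 : q = 1
    · simp [qInt, hq1]
    · have := sub_ne_zero.2 hq1
      simp [qInt, hq1, this]
  · have : content B - content A = -1 := by simp only [content, h1]; push_cast; ring
    rw [this]
    by_cases hq1 : q = 1
    · simp [qInt, hq1]
    · have h2 := sub_ne_zero.2 hq1
      have h3 : (q ^ (-1 : ℤ) - 1) / (q - 1) = -q⁻¹ := by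
        rw [zpow_neg_one]
        field_simp
        ring
      rw [qInt, if_neg hq1, h3, inv_neg, inv_inv]
      ring

open Classical in
/-- The off-diagonal coefficients of the seminormal operators. -/
noncomputable def swapCoeff (ξ : ℂ) (v : Fin d → ℂ) (q : ℂ) (A B : Cell p d) : ℂ :=
  if Nbr A B ∨ Nbr B A then 0 else 1 - diagCoeff ξ v q A B

/-- The vanishing rule is symmetric in the two cells: for neighbours both sides are zero, and
otherwise the product follows from the sum of the diagonal coefficients. -/
lemma Separated.swapCoeff_mul (hS : Separated p n ξ v q) {A B : Cell p d} (h : GoodPair ξ v q A B) :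
    swapCoeff ξ v q A B * swapCoeff ξ v q B A =
      (1 - diagCoeff ξ v q A B) * (q + diagCoeff ξ v q A B) := by
  have hs := hS.diagCoeff_add h
  unfold swapCoeff
  by_cases h1 : Nbr A B
  · simp [h1, hS.diagCoeff_nbr h1]
  · by_cases h2 : Nbr B A
    · have := hS.diagCoeff_nbr h2
      simp only [h1, h2, or_true, true_or, if_true, zero_mul]
      rw [← eq_sub_iff_add_eq'] at hs
      rw [hs] at this
      linear_combination -this
    · simp only [h1, h2, or_self, if_false]
      linear_combination (1 - diagCoeff ξ v q A B) * hs * (-1)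

end Coefficients

/-! ### The seminormal representation for separated parameters. -/

section Seminormal

variable {p d n : ℕ} [NeZero p] {ξ : ℂ} {v : Fin d → ℂ} {q : ℂ} {lam : MultiDiagram p d n}
  {t : Fin n → Cell p d}

lemma Separated.goodPair_of_consecutive (hS : Separated p n ξ v q) (h : IsStandard lam t)
    {a b : Fin n} (hab : b.val = a.val + 1) : GoodPair ξ v q (t a) (t b) := by
  have hb := h.content_bound a b
  refine hS.goodPair (fun h0 => ?_) (by omega) (fun h0 => by have := hb.2 h0; omega)
  rcases h.consecutive hab h0 with h1 | h1
  · rcases h1.2 with h2 | h2 <;> simp only [content, h2] <;> push_cast <;> omega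
  · simp only [content]
    omega

lemma Separated.goodPair_of_two_apart (hS : Separated p n ξ v q) (h : IsStandard lam t)
    {a b c : Fin n} (hab : b.val = a.val + 1) (hbc : c.val = b.val + 1) :
    GoodPair ξ v q (t a) (t c) := by
  have hb := h.content_bound a c
  exact hS.goodPair (fun h0 => h.content_ne_of_two_apart hab hbc h0) (by omega)
    (fun h0 => by have := hb.2 h0; omega)

/-- This makes the coefficient of the exchanged tableau nonzero, so that generators connect
tableaux. In one component the value 1 would need content difference 1, which non-adjacent
consecutive cells do not have. -/
lemma Separated.diagCoeff_ne_one (hS : Separated p n ξ v q) (h : IsStandard lam t)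
    {a b : Fin n} (hab : b.val = a.val + 1) (hn : ¬ Nbr (t a) (t b)) :
    diagCoeff ξ v q (t a) (t b) ≠ 1 := by
  have hb := h.content_bound a b
  by_cases h0 : (t a).1 = (t b).1
  · have hc := (h.consecutive hab h0).resolve_left hn
    rw [diagCoeff, if_pos h0, ne_eq, inv_eq_one]
    have h2 : content (t b) - content (t a) ≠ 1 := by
      simp only [content]
      omega
    have h3 := hS.qInt_ne (content (t b) - content (t a) - 1) (by omega) (by
      have := hb.1
      have h4 := abs_sub (content (t b) - content (t a)) 1
      simp only [abs_one] at h4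
      omega)
    unfold qInt at h3 ⊢
    split_ifs at h3 ⊢ with hq1
    · exact_mod_cast h2
    · intro h5
      apply h3
      have h6 := sub_ne_zero.2 hq1
      rw [div_eq_one_iff_eq h6, sub_left_inj] at h5
      rw [zpow_sub_one₀ hS.q_ne, h5, mul_inv_cancel₀ hS.q_ne, sub_self, zero_div]
  · intro h1
    have h2 := hS.residue_mul_diagCoeff (hS.goodPair_of_consecutive h hab)
    rw [h1] at h2
    apply hS.residue_ne_mul h0 (by have := hb.2 h0; omega)
    linear_combination h2

lemma swapCoeff_of_swap (h : IsStandard lam t) {a b : Fin n} (hab : b.val = a.val + 1)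
    (hsw : IsStandard lam (t ∘ Equiv.swap a b)) :
    swapCoeff ξ v q (t a) (t b) = 1 - diagCoeff ξ v q (t a) (t b) := by
  have h1 := (h.swap_iff hab).1 hsw
  have h2 : ¬ Nbr (t b) (t a) := fun hn => by
    have := h.lt_of_nbr hn
    rw [Fin.lt_def] at this
    omega
  simp [swapCoeff, h1, h2]

lemma swapCoeff_of_not_swap (h : IsStandard lam t) {a b : Fin n} (hab : b.val = a.val + 1)
    (hsw : ¬ IsStandard lam (t ∘ Equiv.swap a b)) : swapCoeff ξ v q (t a) (t b) = 0 := by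
  have h1 := not_not.1 (mt (h.swap_iff hab).2 hsw)
  simp [swapCoeff, h1]

lemma prevIdx_val {i : Fin n} (hi : 1 ≤ i.val) : i.val = (prevIdx i).val + 1 := by
  simp only [prevIdx]
  omega

lemma seminormalOp_single_zero (i : Fin n) (hi : i.val = 0) (t : StdTableau lam) :
    seminormalOp ξ v q lam i (Finsupp.single t 1) =
      compParam ξ v (t.1 i) • (Finsupp.single t 1 : V lam) := by
  simp [seminormalOp, Finsupp.linearCombination_single, hi]

lemma seminormalOp_single (i : Fin n) (hi : 1 ≤ i.val) (t : StdTableau lam) :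
    seminormalOp ξ v q lam i (Finsupp.single t 1) =
      diagCoeff ξ v q (t.1 (prevIdx i)) (t.1 i) • (Finsupp.single t 1 : V lam) +
      (1 - diagCoeff ξ v q (t.1 (prevIdx i)) (t.1 i)) •
        basisOrZero lam (t.1 ∘ Equiv.swap (prevIdx i) i) := by
  have : i.val ≠ 0 := by omega
  simp [seminormalOp, Finsupp.linearCombination_single, this]

/-- For separated parameters the seminormal operators define a representation. -/
theorem exists_seminormal (hξ : IsPrimitiveRoot ξ p) (hS : Separated p n ξ v q)
    (lam : MultiDiagram p d n) :
    ∃ ρ : HeckeR1n p n ξ v q →ₐ[ℂ] Module.End ℂ (V lam), IsSeminormal lam ρ := by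
  classical
  rcases Nat.eq_zero_or_pos n with hn | hn
  · subst hn
    exact (Hecke.exists_rep (fun i => i.elim0) (fun i => i.elim0) (fun i => i.elim0)
      (fun i => i.elim0) (fun i => i.elim0) (fun i => i.elim0)).imp fun ρ _ => fun i => i.elim0
  let z : Fin n := ⟨0, hn⟩
  have hz : ∀ i : Fin n, i.val = 0 → i = z := fun i hi => Fin.ext hi
  -- T_1 extended to all words; it reads only the component of the first cell.
  let D : Module.End ℂ ((Fin n → Cell p d) →₀ ℂ) :=
    Finsupp.linearCombination ℂ fun t => compParam ξ v (t z) • Finsupp.single t 1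
  have hD : ∀ s : Fin n → Cell p d, D (Finsupp.single s 1) =
      compParam ξ v (s z) • (Finsupp.single s 1 : (Fin n → Cell p d) →₀ ℂ) := fun s => by
    simp [D, Finsupp.linearCombination_single]
  refine Hecke.exists_word_rep (fun t : StdTableau lam => t.1) Subtype.val_injective
    (diagCoeff ξ v q) (swapCoeff ξ v q) D (seminormalOp ξ v q lam) ?_ ?_ ?_ ?_ ?_ ?_ ?_ ?_
  · intro i hi t
    rw [seminormalOp_single_zero i hi, hD, hz i hi, map_smul]
    simp [Finsupp.mapDomain_single]
  · intro i hi t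
    rw [seminormalOp_single i hi, adjOp_single, map_add, map_smul, map_smul]
    congr 1
    · simp [Finsupp.mapDomain_single]
    · unfold basisOrZero
      split_ifs with h
      · rw [swapCoeff_of_swap t.2 (prevIdx_val hi) h]
        simp [Finsupp.mapDomain_single]
      · rw [swapCoeff_of_not_swap t.2 (prevIdx_val hi) h]
        simp
  · intro t i hi
    rw [hS.diagCoeff_add (hS.goodPair_of_consecutive t.2 (prevIdx_val hi)), sub_self, mul_zero]
  · intro t i hi
    exact hS.swapCoeff_mul (hS.goodPair_of_consecutive t.2 (prevIdx_val hi))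
  · intro t i j hi hj
    left
    exact hS.diagCoeff_braid (hS.goodPair_of_consecutive t.2 (prevIdx_val hi))
      (hS.goodPair_of_consecutive t.2 hj) (hS.goodPair_of_two_apart t.2 (prevIdx_val hi) hj)
  · intro t i j hi hj
    refine adjOp_comm_diag _ _ (compParam ξ v) (c := z) ?_ ?_ _ D hD <;>
      simp only [ne_eq, Fin.ext_iff, prevIdx, z] <;> omega
  · intro t i j hi hj
    refine adjOp_braid_four (compParam ξ v) _ D (by rw [hz i hi]; exact hD) ?_
    -- If the exchange is standard, both cells can hold the number 1, so their contents are zero and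
    -- their residues are the component parameters. If not, the swap coefficient vanishes.
    by_cases hsw : IsStandard lam (t.1 ∘ Equiv.swap i j)
    · have hG := hS.goodPair_of_consecutive t.2 (a := i) (b := j) (by omega)
      have h1 := hS.residue_mul_diagCoeff hG
      have h2 := hS.residue_mul_diagCoeff hG.symm
      have hc : ∀ s, IsStandard lam s → content (s i) = 0 := by
        intro s hs
        obtain ⟨c, hc⟩ := hs.exists_eq_of_le (a := i) (Nat.zero_le _) (Nat.zero_le _)
        have h3 : c ≤ i := hs.le_of_le (by rw [hc]) (by rw [hc]; exact Nat.zero_le _)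
          (by rw [hc]; exact Nat.zero_le _)
        have h4 : c = i := by
          rw [Fin.le_def] at h3
          exact Fin.ext (by omega)
        rw [← h4, hc]
        simp [content]
      have hc1 := hc _ t.2
      have hc2 := hc _ hsw
      simp only [Function.comp, Equiv.swap_apply_left] at hc2
      simp only [residue, hc1, hc2, neg_zero, zpow_zero, mul_one] at h1 h2
      have h3 := hS.diagCoeff_add hG
      have h4 : compParam ξ v (t.1 i) * diagCoeff ξ v q (t.1 i) (t.1 j) +
          compParam ξ v (t.1 j) * diagCoeff ξ v q (t.1 j) (t.1 i) = 0 := by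
        linear_combination compParam ξ v (t.1 j) * h3 + h1
      rw [h4, mul_zero]
    · rw [swapCoeff_of_not_swap t.2 (by omega) hsw, zero_mul]
  · intro i hi
    have h0 : ∀ P : ℂ[X], ∀ t : StdTableau lam,
        aeval (seminormalOp ξ v q lam i) P (Finsupp.single t 1) =
          P.eval (compParam ξ v (t.1 i)) • (Finsupp.single t 1 : V lam) := by
      intro P t
      exact Module.End.aeval_apply_of_hasEigenvector
        ⟨Module.End.mem_eigenspace_iff.2 (seminormalOp_single_zero i hi t), by simp⟩
    refine Finsupp.lhom_ext' fun t => LinearMap.ext_ring ?_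
    rw [LinearMap.comp_apply, Finsupp.lsingle_apply, h0, prod_cycParam hξ, Polynomial.eval_prod,
      Finset.prod_eq_zero (Finset.mem_univ (t.1 i).1.2), zero_smul]
    · simp
    · simp only [eval_sub, eval_pow, eval_X, eval_C, compParam, mul_pow]
      rw [← pow_mul, mul_comm _ p, pow_mul, hξ.pow_eq_one, one_pow, one_mul, sub_self]

end Seminormal

/-! ### Matrix units in the image of the Hecke algebra -/

section

variable {p d n : ℕ} {ξ : ℂ} {v : Fin d → ℂ} {q : ℂ}

lemma Separated.compParam_eq_iff (hS : Separated p n ξ v q) (hn : 0 < n) (A B : Cell p d) :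
    compParam ξ v A = compParam ξ v B ↔ A.1 = B.1 := by
  refine ⟨fun h => ?_, compParam_congr⟩
  by_contra hne
  exact hS.param_sep A B hne 0 (by simpa using hn) (by simpa using h)

end

section MatrixUnits

variable {p d n : ℕ} [NeZero p] {ξ : ℂ} {v : Fin d → ℂ} {q : ℂ}

lemma IsStandard.fst_lt {lam : MultiDiagram p d n} {t : Fin n → Cell p d} (h : IsStandard lam t)
    (a : Fin n) : (t a).2.1 < n ∧ (t a).2.2 < n := by
  obtain ⟨b, hb⟩ := h.exists_eq_of_le (a := a) (k := (t a).2.1) (l := 0) le_rfl (Nat.zero_le _)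
  obtain ⟨c, hc⟩ := h.exists_eq_of_le (a := a) (k := 0) (l := (t a).2.2) (Nat.zero_le _) le_rfl
  obtain ⟨e, he⟩ := h.exists_eq_of_le (a := a) (k := 0) (l := 0) (Nat.zero_le _) (Nat.zero_le _)
  have h1 := (h.content_bound e b).1
  have h2 := (h.content_bound e c).1
  simp only [content, hb, hc, he] at h1 h2
  have h1' := abs_lt.1 (Int.lt_iff_add_one_le.2 h1)
  have h2' := abs_lt.1 (Int.lt_iff_add_one_le.2 h2)
  omega

lemma IsStandard.shape_unique {lam mu : MultiDiagram p d n} {t : Fin n → Cell p d}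
    (h : IsStandard lam t) (h' : IsStandard mu t) : lam = mu := by
  have hc : lam.cells = mu.cells := h.bij.image_eq.symm.trans h'.bij.image_eq
  ext i j x
  have := Set.ext_iff.1 hc ((i, j), x)
  simpa [MultiDiagram.cells] using this

lemma basisOrZero_of_isStandard {lam : MultiDiagram p d n} {t : Fin n → Cell p d}
    (h : IsStandard lam t) : basisOrZero lam t = Finsupp.single ⟨t, h⟩ 1 := by
  simp [basisOrZero, h]

lemma basisOrZero_of_not_isStandard {lam : MultiDiagram p d n} {t : Fin n → Cell p d}
    (h : ¬ IsStandard lam t) : basisOrZero lam t = 0 := by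
  simp [basisOrZero, h]

variable (ρ : ∀ lam : MultiDiagram p d n, HeckeR1n p n ξ v q →ₐ[ℂ] Module.End ℂ (V lam))

/-- The element `h` acts diagonally on all the seminormal modules, with eigenvalue `f t` on
`v(t)`. -/
def ActsDiag (h : HeckeR1n p n ξ v q) (f : (Fin n → Cell p d) → ℂ) : Prop :=
  ∀ (mu : MultiDiagram p d n) (t : StdTableau mu),
    ρ mu h (Finsupp.single t 1) = f t.1 • (Finsupp.single t 1 : V mu)

namespace ActsDiag

variable {ρ} {h h' : HeckeR1n p n ξ v q} {f f' : (Fin n → Cell p d) → ℂ}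

lemma const (c : ℂ) : ActsDiag ρ (algebraMap ℂ _ c) fun _ => c := fun mu t => by
  rw [AlgHom.commutes, Module.algebraMap_end_apply]

lemma add (H : ActsDiag ρ h f) (H' : ActsDiag ρ h' f') :
    ActsDiag ρ (h + h') fun t => f t + f' t := fun mu t => by
  rw [map_add, LinearMap.add_apply, H, H', add_smul]

lemma sum {ι : Type*} {S : Finset ι} {h : ι → HeckeR1n p n ξ v q}
    {f : ι → (Fin n → Cell p d) → ℂ} (H : ∀ i ∈ S, ActsDiag ρ (h i) (f i)) :
    ActsDiag ρ (∑ i ∈ S, h i) fun t => ∑ i ∈ S, f i t := fun mu t => by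
  rw [map_sum, LinearMap.sum_apply, Finset.sum_smul]
  exact Finset.sum_congr rfl fun i hi => H i hi mu t

lemma mul (H : ActsDiag ρ h f) (H' : ActsDiag ρ h' f') :
    ActsDiag ρ (h * h') fun t => f t * f' t := fun mu t => by
  rw [map_mul, Module.End.mul_apply, H', map_smul, H, smul_smul, mul_comm]

lemma aeval (H : ActsDiag ρ h f) (P : ℂ[X]) :
    ActsDiag ρ (Polynomial.aeval h P) fun t => P.eval (f t) := fun mu t => by
  rw [← Polynomial.aeval_algHom_apply]
  exact Module.End.aeval_apply_of_hasEigenvector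
    ⟨Module.End.mem_eigenspace_iff.2 (H mu t), by simp⟩

/-- When the eigenvalues lie in a finite set, Lagrange interpolation realizes any function of them
by a polynomial in h. -/
lemma exists_comp (H : ActsDiag ρ h f) (S : Finset ℂ)
    (hfS : ∀ (mu : MultiDiagram p d n) (t : StdTableau mu), f t.1 ∈ S) (g : ℂ → ℂ) :
    ∃ h', ActsDiag ρ h' fun t => g (f t) := by
  refine ⟨Polynomial.aeval h (Lagrange.interpolate S id g), fun mu t => ?_⟩
  have h2 := Lagrange.eval_interpolate_at_node (v := id) g (Set.injOn_id _) (hfS mu t)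
  simp only [id] at h2
  have h1 := H.aeval (Lagrange.interpolate S id g) mu t
  simp only [h2] at h1
  exact h1

end ActsDiag

variable {ρ}

lemma first_number {lam : MultiDiagram p d n} {t : Fin n → Cell p d} (h : IsStandard lam t)
    {i : Fin n} (hi : i.val = 0) : content (t i) = 0 := by
  obtain ⟨c, hc⟩ := h.exists_eq_of_le (a := i) (Nat.zero_le _) (Nat.zero_le _)
  have h3 : c ≤ i := h.le_of_le (by rw [hc]) (by rw [hc]; exact Nat.zero_le _)
    (by rw [hc]; exact Nat.zero_le _)
  have h4 : c = i := by
    rw [Fin.le_def] at h3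
    exact Fin.ext (by omega)
  rw [← h4, hc]
  simp [content]

lemma T_single (hρ : ∀ lam, IsSeminormal lam (ρ lam)) (hS : Separated p n ξ v q)
    {mu : MultiDiagram p d n} (t : StdTableau mu) {i : Fin n} (hi : 1 ≤ i.val) :
    (∃ hs : IsStandard mu (t.1 ∘ Equiv.swap (prevIdx i) i),
      ρ mu (Hecke.T _ q i) (Finsupp.single t 1) =
        diagCoeff ξ v q (t.1 (prevIdx i)) (t.1 i) • (Finsupp.single t 1 : V mu) +
        (1 - diagCoeff ξ v q (t.1 (prevIdx i)) (t.1 i)) •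
          Finsupp.single (⟨_, hs⟩ : StdTableau mu) 1 ∧
      ρ mu (Hecke.T _ q i) (Finsupp.single (⟨_, hs⟩ : StdTableau mu) 1) =
        diagCoeff ξ v q (t.1 i) (t.1 (prevIdx i)) •
          (Finsupp.single (⟨_, hs⟩ : StdTableau mu) 1 : V mu) +
        (1 - diagCoeff ξ v q (t.1 i) (t.1 (prevIdx i))) • Finsupp.single t 1 ∧
      diagCoeff ξ v q (t.1 (prevIdx i)) (t.1 i) ≠ 1) ∨
    (ρ mu (Hecke.T _ q i) (Finsupp.single t 1) =
        diagCoeff ξ v q (t.1 (prevIdx i)) (t.1 i) • (Finsupp.single t 1 : V mu) ∧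
      (1 - diagCoeff ξ v q (t.1 (prevIdx i)) (t.1 i)) *
        (q + diagCoeff ξ v q (t.1 (prevIdx i)) (t.1 i)) = 0) := by
  have hab := prevIdx_val hi
  rw [hρ mu i, seminormalOp_single i hi]
  by_cases hs : IsStandard mu (t.1 ∘ Equiv.swap (prevIdx i) i)
  · left
    refine ⟨hs, by rw [basisOrZero_of_isStandard hs], ?_, ?_⟩
    · have e2 : (t.1 ∘ Equiv.swap (prevIdx i) i) ∘ Equiv.swap (prevIdx i) i = t.1 := by
        funext i; simp
      rw [seminormalOp_single i hi]
      simp only [e2, Function.comp_apply, Equiv.swap_apply_left, Equiv.swap_apply_right]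
      rw [basisOrZero_of_isStandard t.2]
    · exact hS.diagCoeff_ne_one t.2 hab ((t.2.swap_iff hab).1 hs)
  · right
    have hn := not_not.1 (mt (t.2.swap_iff hab).2 hs)
    rw [basisOrZero_of_not_isStandard hs, smul_zero, add_zero]
    exact ⟨rfl, hS.diagCoeff_nbr hn⟩

/-- The Jucys–Murphy elements act by the residues. -/
lemma exists_actsDiag_residue (hρ : ∀ lam, IsSeminormal lam (ρ lam)) (hS : Separated p n ξ v q)
    (i : Fin n) : ∃ h, ActsDiag ρ h fun t => residue ξ v q (t i) := by
  obtain ⟨i, hi⟩ := i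
  induction i with
  | zero =>
    refine ⟨Hecke.T _ q ⟨0, hi⟩, fun mu t => ?_⟩
    rw [hρ mu, seminormalOp_single_zero _ rfl]
    simp only [residue, first_number t.2 (i := ⟨0, hi⟩) rfl]
    simp
  | succ i ih =>
    obtain ⟨L, hL⟩ := ih (by omega)
    let j : Fin n := ⟨i + 1, hi⟩
    have hj : 1 ≤ j.val := by simp [j]
    have hpj : prevIdx j = ⟨i, by omega⟩ := by simp [prevIdx, j]
    -- The Jucys–Murphy recursion. On a two-dimensional block the off-diagonal part cancels by the
    -- residue identity and the sum rule.
    refine ⟨q⁻¹ • (Hecke.T _ q j * L * Hecke.T _ q j), fun mu t => ?_⟩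
    rw [← hpj] at hL
    have hG := hS.goodPair_of_consecutive t.2 (prevIdx_val hj)
    have h1 := hS.residue_mul_diagCoeff hG
    have hq := hS.q_ne
    simp only [map_smul, map_mul, LinearMap.smul_apply, Module.End.mul_apply]
    rcases T_single hρ hS t hj with ⟨hs, h2, h3, -⟩ | ⟨h2, h3⟩
    · have h4 := hS.diagCoeff_add hG
      have h5 := hL mu ⟨_, hs⟩
      simp only [Function.comp_apply, Equiv.swap_apply_left] at h5
      rw [h2]
      simp only [map_add, map_smul]
      rw [hL mu t, h5]
      simp only [map_smul]
      rw [h2, h3]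
      change _ = residue ξ v q (t.1 j) • _
      generalize diagCoeff ξ v q (t.1 (prevIdx j)) (t.1 j) = x at *
      generalize diagCoeff ξ v q (t.1 j) (t.1 (prevIdx j)) = x' at *
      generalize residue ξ v q (t.1 (prevIdx j)) = a at *
      generalize residue ξ v q (t.1 j) = b at *
      match_scalars
      · field_simp
        linear_combination x * h1 - (1 - x) * b * h4
      · field_simp
        linear_combination (1 - x) * h1 + (1 - x) * b * h4
    · rw [h2]
      simp only [map_smul]
      rw [hL mu t]
      simp only [map_smul]
      rw [h2]
      change _ = residue ξ v q (t.1 j) • _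
      match_scalars
      field_simp
      linear_combination diagCoeff ξ v q (t.1 (prevIdx j)) (t.1 j) * h1 -
        residue ξ v q (t.1 j) * h3

/-- At q = 1 the residue is the component parameter, so interpolation gives projectors onto the
tableaux with a given number in a given component. Products of these, summed over components, detect
equality. -/
lemma exists_actsDiag_same_component (hS : Separated p n ξ v 1) {ρ : ∀ lam : MultiDiagram p d n,
      HeckeR1n p n ξ v 1 →ₐ[ℂ] Module.End ℂ (V lam)} (hρ : ∀ lam, IsSeminormal lam (ρ lam))
    (i j : Fin n) [DecidableEq (ZMod p × Fin d)] :
    ∃ h, ActsDiag ρ h fun t => if (t i).1 = (t j).1 then 1 else 0 := by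
  classical
  let w : ZMod p × Fin d → ℂ := fun c => compParam ξ v (c, (0, 0))
  have hw : ∀ A : Cell p d, residue ξ v 1 A = w A.1 := fun A => by
    simp only [residue, one_zpow, mul_one]
    exact compParam_congr rfl
  have hwi : ∀ c c', w c = w c' ↔ c = c' := fun c c' =>
    hS.compParam_eq_iff (i.pos) (c, (0, 0)) (c', (0, 0))
  have key : ∀ (k : Fin n) (c : ZMod p × Fin d),
      ∃ h, ActsDiag ρ h fun t => if (t k).1 = c then 1 else 0 := by
    intro k c
    obtain ⟨L, hL⟩ := exists_actsDiag_residue hρ hS k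
    obtain ⟨h', hh'⟩ := hL.exists_comp (Finset.univ.image w)
      (fun mu t => by rw [hw]; exact Finset.mem_image_of_mem _ (Finset.mem_univ _))
      (fun z => if z = w c then 1 else 0)
    simp only [hw, hwi] at hh'
    exact ⟨h', hh'⟩
  choose e he using key
  refine ⟨∑ c, e i c * e j c, fun mu t => ?_⟩
  rw [ActsDiag.sum (fun c _ => (he i c).mul (he j c)) mu t]
  congr 1
  simp [eq_comm]

/-- For `q = 1` there are elements acting by the contents. -/
lemma exists_actsDiag_content (hS : Separated p n ξ v 1) {ρ : ∀ lam : MultiDiagram p d n,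
      HeckeR1n p n ξ v 1 →ₐ[ℂ] Module.End ℂ (V lam)} (hρ : ∀ lam, IsSeminormal lam (ρ lam))
    (i : Fin n) : ∃ h, ActsDiag ρ h fun t => (content (t i) : ℂ) := by
  classical
  obtain ⟨i, hi⟩ := i
  induction i with
  | zero =>
    refine ⟨algebraMap ℂ _ 0, fun mu t => ?_⟩
    rw [ActsDiag.const 0 mu t]
    simp only [first_number t.2 (i := ⟨0, hi⟩) rfl]
    simp
  | succ i ih =>
    obtain ⟨M, hM⟩ := ih (by omega)
    let j : Fin n := ⟨i + 1, hi⟩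
    have hj : 1 ≤ j.val := by simp [j]
    have hpj : prevIdx j = ⟨i, by omega⟩ := by simp [prevIdx, j]
    rw [← hpj] at hM
    obtain ⟨e, he⟩ := exists_actsDiag_same_component hS hρ (prevIdx j) j
    -- The additive form of the recursion: the correction T e is switched on only when the two
    -- numbers share a component.
    refine ⟨Hecke.T _ 1 j * M * Hecke.T _ 1 j + Hecke.T _ 1 j * e, fun mu t => ?_⟩
    have hG := hS.goodPair_of_consecutive t.2 (prevIdx_val hj)
    simp only [map_add, map_mul, LinearMap.add_apply, Module.End.mul_apply]
    rw [he mu t]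
    have h6 : (t.1 (prevIdx j)).1 = (t.1 j).1 →
        ((content (t.1 j) : ℂ) - content (t.1 (prevIdx j))) *
          diagCoeff ξ v 1 (t.1 (prevIdx j)) (t.1 j) = 1 := by
      intro h0
      have h7 : ((content (t.1 j) - content (t.1 (prevIdx j)) : ℤ) : ℂ) ≠ 0 :=
        Int.cast_ne_zero.2 (sub_ne_zero.2 (hG.content_ne h0).symm)
      rw [diagCoeff_one_of_eq h0, ← Int.cast_sub, mul_inv_cancel₀ h7]
    have h7 : (t.1 (prevIdx j)).1 ≠ (t.1 j).1 →
        diagCoeff ξ v 1 (t.1 (prevIdx j)) (t.1 j) = 0 := diagCoeff_one_of_ne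
    change _ = (content (t.1 j) : ℂ) • _
    rcases T_single hρ hS t hj with ⟨hs, h2, h3, -⟩ | ⟨h2, h3⟩
    · have h4 := hS.diagCoeff_add hG
      rw [sub_self] at h4
      have h5 := hM mu ⟨_, hs⟩
      simp only [Function.comp_apply, Equiv.swap_apply_left] at h5
      rw [h2]
      simp only [map_add, map_smul]
      rw [hM mu t, h5]
      simp only [map_smul]
      rw [h2, h3]
      have h8 := eq_neg_of_add_eq_zero_right h4
      rw [h8]
      split_ifs with h0
      · have h9 := h6 h0
        match_scalars
        · linear_combination -diagCoeff ξ v 1 (t.1 (prevIdx j)) (t.1 j) * h9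
        · linear_combination -(1 - diagCoeff ξ v 1 (t.1 (prevIdx j)) (t.1 j)) * h9
      · rw [h7 h0]
        module
    · rw [h2]
      simp only [map_smul]
      rw [hM mu t]
      simp only [map_smul]
      rw [h2]
      split_ifs with h0
      · have h9 := h6 h0
        match_scalars
        linear_combination (-diagCoeff ξ v 1 (t.1 (prevIdx j)) (t.1 j)) * h9 -
          (content (t.1 j) : ℂ) * h3
      · rw [h7 h0] at h3
        norm_num at h3

/-- Diagonally acting elements separate the standard tableaux of all shapes. -/
lemma exists_actsDiag_separating (hρ : ∀ lam, IsSeminormal lam (ρ lam))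
    (hS : Separated p n ξ v q) {lam mu : MultiDiagram p d n} (t : StdTableau lam)
    (r : StdTableau mu) (hne : r.1 ≠ t.1) : ∃ h f, ActsDiag ρ h f ∧ f t.1 = 1 ∧ f r.1 = 0 := by
  suffices ∃ h f, ActsDiag ρ h f ∧ f r.1 ≠ f t.1 by
    obtain ⟨h, f, hf, hne⟩ := this
    have h1 := sub_ne_zero.2 hne.symm
    refine ⟨_, _, (ActsDiag.const (f t.1 - f r.1)⁻¹).mul (hf.add (ActsDiag.const (-f r.1))), ?_, ?_⟩
    · field_simp
      ring
    · ring
  -- At the first difference the two cells extend the same partial tableau, which bounds their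
  -- content difference even for different shapes.
  obtain ⟨i, hi, hmin⟩ := wellFounded_lt.has_min {i | r.1 i ≠ t.1 i} (Function.ne_iff.1 hne)
  have heq : ∀ j < i, r.1 j = t.1 j := fun j hj => by
    by_contra h
    exact hmin j h hj
  have hb := r.2.content_bound_first_diff t.2 i heq
  obtain ⟨L, hL⟩ := exists_actsDiag_residue hρ hS i
  by_cases h0 : (r.1 i).1 = (t.1 i).1
  · have hc := r.2.content_ne_first_diff t.2 i heq hi h0
    by_cases hq1 : q = 1
    · subst hq1
      obtain ⟨M, hM⟩ := exists_actsDiag_content hS hρ i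
      exact ⟨M, _, hM, by exact_mod_cast hc⟩
    · exact ⟨L, _, hL, hS.residue_ne_of_content_ne hq1 h0 hb.1 hc⟩
  · exact ⟨L, _, hL, hS.residue_ne_of_fst_ne h0 (hb.2 h0)⟩

variable (ρ) in
/-- The element `h` acts as the matrix unit `v(t) ↦ v(s)` on `V(lam)` and by zero on the other
seminormal modules. -/
structure IsMatrixUnit {lam : MultiDiagram p d n} (h : HeckeR1n p n ξ v q)
    (s t : StdTableau lam) : Prop where
  apply : ∀ x : V lam, ρ lam h x = x t • Finsupp.single s 1
  eq_zero : ∀ mu, mu ≠ lam → ρ mu h = 0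

lemma exists_isMatrixUnit_self (hρ : ∀ lam, IsSeminormal lam (ρ lam))
    (hS : Separated p n ξ v q) {lam : MultiDiagram p d n} (t : StdTableau lam) :
    ∃ h, IsMatrixUnit ρ h t t := by
  classical
  have key : ∀ R : Finset (Fin n → Cell p d), t.1 ∉ R → ∃ h f, ActsDiag ρ h f ∧ f t.1 = 1 ∧
      ∀ (mu : MultiDiagram p d n) (r : StdTableau mu), r.1 ∈ R → f r.1 = 0 := by
    intro R
    induction R using Finset.induction_on with
    | empty => exact fun _ => ⟨_, _, ActsDiag.const 1, rfl, by simp⟩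
    | insert r R hr ih =>
      intro ht
      rw [Finset.mem_insert, not_or] at ht
      obtain ⟨h, f, hf, hft, hfR⟩ := ih ht.2
      by_cases hstd : ∃ mu, IsStandard mu r
      · obtain ⟨mu, hmu⟩ := hstd
        obtain ⟨h', f', hf', hft', hfr'⟩ :=
          exists_actsDiag_separating hρ hS t (⟨r, hmu⟩ : StdTableau mu) (Ne.symm ht.1)
        refine ⟨_, _, hf.mul hf', by rw [hft, hft', one_mul], fun nu s hs => ?_⟩
        rcases Finset.mem_insert.1 hs with h1 | h1
        · rw [h1, hfr', mul_zero]
        · rw [hfR nu s h1, zero_mul]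
      · refine ⟨h, f, hf, hft, fun nu s hs => ?_⟩
        rcases Finset.mem_insert.1 hs with h1 | h1
        · exact absurd ⟨nu, h1 ▸ s.2⟩ hstd
        · exact hfR nu s h1
  -- A finite set containing the tableaux of all shapes at once, so finitely many separating factors
  -- suffice.
  let R : Finset (Fin n → Cell p d) := Fintype.piFinset fun _ =>
    Finset.univ ×ˢ (Finset.range n ×ˢ Finset.range n)
  have hR : ∀ (mu : MultiDiagram p d n) (r : StdTableau mu), r.1 ∈ R := by
    intro mu r
    simp only [R, Fintype.mem_piFinset, Finset.mem_product, Finset.mem_univ, true_and,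
      Finset.mem_range]
    exact r.2.fst_lt
  obtain ⟨h, f, hf, hft, hfR⟩ := key (R.erase t.1) (by simp)
  have hz : ∀ (mu : MultiDiagram p d n) (r : StdTableau mu), r.1 ≠ t.1 →
      ρ mu h (Finsupp.single r 1) = 0 := fun mu r hne => by
    rw [hf mu r, hfR mu r (Finset.mem_erase.2 ⟨hne, hR mu r⟩), zero_smul]
  refine ⟨h, fun x => ?_, fun mu hmu => ?_⟩
  · induction x using Finsupp.induction_linear with
    | zero => simp
    | add x y hx hy => rw [map_add, hx, hy, Finsupp.add_apply, add_smul]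
    | single r c =>
      have hc : (Finsupp.single r c : V lam) = c • Finsupp.single r 1 := by simp
      rw [hc, map_smul]
      by_cases hr : r = t
      · subst hr
        rw [hf lam r, hft]
        simp
      · rw [hz lam r fun h => hr (Subtype.ext h)]
        simp [hr]
  · refine Finsupp.lhom_ext' fun r => LinearMap.ext_ring ?_
    simp only [LinearMap.comp_apply, Finsupp.lsingle_apply]
    rw [hz mu r fun h1 => hmu (r.2.shape_unique (h1 ▸ t.2))]
    rfl

/-- All matrix units lie in the image of the Hecke algebra. -/
theorem exists_isMatrixUnit (hρ : ∀ lam, IsSeminormal lam (ρ lam))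
    (hS : Separated p n ξ v q) {lam : MultiDiagram p d n} (s t : StdTableau lam) :
    ∃ h, IsMatrixUnit ρ h s t := by
  refine tableau_induction (P := fun s => ∃ h, IsMatrixUnit ρ h s t) ?_ t s
    (exists_isMatrixUnit_self hρ hS t)
  rintro s a b hab hsw ⟨h, hh⟩
  obtain ⟨e, he⟩ := exists_isMatrixUnit_self hρ hS (⟨_, hsw⟩ : StdTableau lam)
  have hb : 1 ≤ b.val := by omega
  have hp : prevIdx b = a := by
    apply Fin.ext
    simp [prevIdx, hab]
  subst hp
  rcases T_single hρ hS s hb with ⟨hs, h2, -, h3⟩ | ⟨h2, h3⟩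
  · have hne : s ≠ ⟨s.1 ∘ Equiv.swap (prevIdx b) b, hs⟩ := by
      intro h
      have h1 := congrFun (congrArg Subtype.val h) b
      simp only [Function.comp_apply, Equiv.swap_apply_right] at h1
      have h2 := s.2.injective h1
      rw [← h2] at hab
      omega
    -- Here h leads from t to s, the generator produces the exchanged tableau with coefficient 1 -
    -- x, and e removes what remains at s.
    refine ⟨(1 - diagCoeff ξ v q (s.1 (prevIdx b)) (s.1 b))⁻¹ • (e * Hecke.T _ q b * h), fun x => ?_,
      fun mu hmu => ?_⟩
    · simp only [map_smul, map_mul, LinearMap.smul_apply, Module.End.mul_apply]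
      rw [hh.apply, map_smul, map_smul, h2, he.apply]
      have h4 := sub_ne_zero.2 h3.symm
      rw [Finsupp.add_apply, Finsupp.smul_apply, Finsupp.smul_apply, Finsupp.single_apply,
        if_neg hne, Finsupp.single_eq_same]
      match_scalars
      field_simp
      ring
    · rw [map_smul, map_mul, hh.eq_zero mu hmu, mul_zero, smul_zero]
  · exfalso
    have h4 := (s.2.swap_iff hab).1 hsw
    rw [hρ lam b, seminormalOp_single b hb, basisOrZero_of_isStandard hsw,
      add_eq_left, smul_eq_zero, sub_eq_zero] at h2
    rcases h2 with h2 | h2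
    · exact hS.diagCoeff_ne_one s.2 hab h4 h2.symm
    · simp at h2

/-- The seminormal modules are simple. -/
theorem isSimpleModule_seminormal (hρ : ∀ lam, IsSeminormal lam (ρ lam))
    (hS : Separated p n ξ v q) (lam : MultiDiagram p d n) :
    IsSimpleModule (HeckeR1n p n ξ v q) (RepSpace (ρ lam)) := by
  rw [isSimpleModule_iff_toSpanSingleton_surjective]
  refine ⟨inferInstanceAs (Nontrivial (V lam)), fun x hx => ?_⟩
  obtain ⟨t, h1⟩ := Finsupp.ne_iff.1 (show RepSpace.toSpace (ρ lam) x ≠ 0 from hx)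
  rw [Finsupp.zero_apply] at h1
  rw [← LinearMap.range_eq_top, eq_top_iff]
  rintro y -
  induction y using Finsupp.induction_linear with
  | zero => exact Submodule.zero_mem _
  | add y z hy hz => exact Submodule.add_mem _ hy hz
  | single s c =>
    obtain ⟨h, hh⟩ := exists_isMatrixUnit hρ hS s t
    refine ⟨(c * (RepSpace.toSpace (ρ lam) x t)⁻¹) • h, ?_⟩
    change ρ lam ((c * (RepSpace.toSpace (ρ lam) x t)⁻¹) • h) (RepSpace.toSpace (ρ lam) x) = _
    rw [map_smul, LinearMap.smul_apply, hh.apply, smul_smul, mul_assoc, inv_mul_cancel₀ h1]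
    simp

end MatrixUnits

/-! ### The subalgebra `H_{r,p,n}` and averaging over `G` -/

section Averaging

variable {p d n : ℕ} {ξ : ℂ} {v : Fin d → ℂ} {q : ℂ}

lemma sum_eq_zero_of_mul {G : Type*} [Group G] [Fintype G] (c : G → ℂ)
    (hc : ∀ g h, c (g * h) = c g * c h) (g₀ : G) (h₀ : c g₀ ≠ 1) : ∑ g, c g = 0 := by
  have h1 : ∑ g, c g = c g₀ * ∑ g, c g := by
    rw [Finset.mul_sum, ← Equiv.sum_comp (Equiv.mulLeft g₀)]
    exact Finset.sum_congr rfl fun g _ => hc g₀ g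
  have h2 : (1 - c g₀) * ∑ g, c g = 0 := by linear_combination h1
  exact (mul_eq_zero.1 h2).resolve_left (sub_ne_zero.2 h₀.symm)

lemma Hecke.isUnit_T_zero {r : ℕ} {u : Fin r → ℂ} (hu : ∀ k, u k ≠ 0) {i : Fin n}
    (hi : i.val = 0) : IsUnit (Hecke.T u q i) := by
  have h1 := Hecke.mk_rel (HeckeRel.cyclotomic (u := u) (q := q) i hi)
  rw [map_zero, ← Polynomial.aeval_algHom_apply] at h1
  change aeval (Hecke.T u q i) _ = 0 at h1
  set P : ℂ[X] := ∏ k, (X - C (u k)) with hP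
  have hc : P.coeff 0 ≠ 0 := by
    rw [coeff_zero_eq_eval_zero, hP, eval_prod]
    exact Finset.prod_ne_zero_iff.2 fun k _ => by simpa using hu k
  have h2 := congrArg (aeval (Hecke.T u q i)) (divX_mul_X_add P)
  rw [h1, map_add, map_mul, aeval_X, aeval_C] at h2
  have hcomm : Commute (aeval (Hecke.T u q i) P.divX) (Hecke.T u q i) := by
    have := (Commute.all P.divX X).map (aeval (Hecke.T u q i))
    rwa [aeval_X] at this
  have h3 : aeval (Hecke.T u q i) P.divX * Hecke.T u q i = -algebraMap ℂ _ (P.coeff 0) :=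
    eq_neg_of_add_eq_zero_left h2
  have h4 : algebraMap ℂ (Hecke n u q) (-(P.coeff 0)⁻¹) * -algebraMap ℂ _ (P.coeff 0) = 1 := by
    rw [← map_neg, ← map_mul, neg_mul_neg, inv_mul_cancel₀ hc, map_one]
  refine ⟨⟨Hecke.T u q i, algebraMap ℂ _ (-(P.coeff 0)⁻¹) * aeval (Hecke.T u q i) P.divX, ?_, ?_⟩,
    rfl⟩
  · rw [Algebra.left_comm, ← hcomm.eq, h3, h4]
  · rw [mul_assoc, h3, h4]

lemma Hecke.T_mul_T_add {r : ℕ} {u : Fin r → ℂ} {i : Fin n} (hi : 1 ≤ i.val) :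
    Hecke.T u q i * (Hecke.T u q i + algebraMap ℂ _ (q - 1)) = algebraMap ℂ _ q := by
  have h1 := Hecke.mk_rel (HeckeRel.quadratic (u := u) (q := q) i hi)
  simp only [map_mul, map_sub, map_add, map_one, map_zero, AlgHom.commutes] at h1
  change (Hecke.T u q i - 1) * (Hecke.T u q i + algebraMap ℂ _ q) = 0 at h1
  rw [map_sub, map_one, ← sub_eq_zero, ← h1]
  have := Algebra.commutes q (Hecke.T u q i)
  noncomm_ring

lemma T_mem_heckeRpn {i : Fin n} (hi : 1 ≤ i.val) :
    Hecke.T (cycParam p ξ v) q i ∈ heckeRpn p n ξ v q :=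
  Algebra.subset_adjoin (Or.inr ⟨i, hi, rfl⟩)

lemma T_pow_mem_heckeRpn {i : Fin n} (hi : i.val = 0) :
    Hecke.T (cycParam p ξ v) q i ^ p ∈ heckeRpn p n ξ v q :=
  Algebra.subset_adjoin (Or.inl (Or.inl ⟨i, hi, rfl⟩))

/-- Only T_1 T_2 T_1⁻¹ needs an argument. The braid relation of length four expresses it through
T_1⁻¹ T_2 T_1 and T_2, whose inverse is a polynomial in T_2 because q ≠ 0. -/
lemma conj_mem_heckeRpn {i : Fin n} (hi : i.val = 0) (hq : q ≠ 0)
    (τ : (HeckeR1n p n ξ v q)ˣ) (hτ : (τ : HeckeR1n p n ξ v q) = Hecke.T _ q i)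
    {h : HeckeR1n p n ξ v q} (hh : h ∈ heckeRpn p n ξ v q) :
    τ.val * h * τ⁻¹.val ∈ heckeRpn p n ξ v q := by
  induction hh using Algebra.adjoin_induction with
  | mem x hx =>
    rcases hx with (⟨k, hk, rfl⟩ | ⟨k, j, hk, hj, rfl⟩) | ⟨k, hk, rfl⟩
    · have : k = i := Fin.ext (by omega)
      subst this
      rw [← hτ, ← pow_succ', pow_succ, Units.mul_inv_cancel_right, hτ]
      exact T_pow_mem_heckeRpn hi
    · have : k = i := Fin.ext (by omega)
      subst this
      rw [← hτ, Ring.inverse_unit, ← mul_assoc, Units.mul_inv_cancel_left,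
        Units.mul_inv_cancel_right]
      exact T_mem_heckeRpn (by omega)
    · by_cases hk1 : k.val = 1
      · have h4 := Hecke.mk_rel (HeckeRel.braid_four (u := cycParam p ξ v) (q := q) i k hi hk1)
        simp only [map_mul] at h4
        change Hecke.T _ q i * Hecke.T _ q k * Hecke.T _ q i * Hecke.T _ q k =
          Hecke.T _ q k * Hecke.T _ q i * Hecke.T _ q k * Hecke.T _ q i at h4
        have hS : Ring.inverse (Hecke.T (cycParam p ξ v) q i) * Hecke.T _ q k * Hecke.T _ q i ∈
            heckeRpn p n ξ v q :=
          Algebra.subset_adjoin (Or.inl (Or.inr ⟨i, k, hi, hk1, rfl⟩))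
        have hU := T_mem_heckeRpn (p := p) (ξ := ξ) (v := v) (q := q) hk
        have h8 : (Hecke.T (cycParam p ξ v) q k + algebraMap ℂ _ (q - 1)) *
            Hecke.T (cycParam p ξ v) q k = algebraMap ℂ _ q := by
          rw [← Hecke.T_mul_T_add hk, add_mul, mul_add, Algebra.commutes]
        rw [← hτ, Ring.inverse_unit] at hS
        rw [← hτ] at h4
        generalize Hecke.T (cycParam p ξ v) q k = U at h4 hS hU h8 ⊢
        have h5 : U * (τ.val * U * τ⁻¹.val) = (τ⁻¹.val * U * τ.val) * U := by
          have h6 : τ.val * (U * (τ.val * U * τ⁻¹.val)) * τ.val =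
              τ.val * ((τ⁻¹.val * U * τ.val) * U) * τ.val := by
            simp only [mul_assoc, Units.inv_mul, mul_one, Units.mul_inv_cancel_left]
            simpa only [mul_assoc] using h4
          exact τ.isUnit.mul_left_cancel (τ.isUnit.mul_right_cancel h6)
        have h7 : τ.val * U * τ⁻¹.val = algebraMap ℂ _ q⁻¹ *
            ((U + algebraMap ℂ _ (q - 1)) * ((τ⁻¹.val * U * τ.val) * U)) := by
          rw [← h5, ← mul_assoc _ U, h8, ← mul_assoc, ← map_mul, inv_mul_cancel₀ hq,
            map_one, one_mul]
        rw [h7]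
        exact mul_mem (algebraMap_mem _ _) (mul_mem (add_mem hU
          (algebraMap_mem _ _)) (mul_mem hS hU))
      · have h4 := Hecke.mk_rel (HeckeRel.comm (u := cycParam p ξ v) (q := q) i k (by omega))
        simp only [map_mul] at h4
        change Hecke.T _ q i * Hecke.T _ q k = Hecke.T _ q k * Hecke.T _ q i at h4
        rw [hτ, h4, ← hτ, Units.mul_inv_cancel_right]
        exact T_mem_heckeRpn hk
  | algebraMap c =>
    rw [← Algebra.commutes, Units.mul_inv_cancel_right]
    exact algebraMap_mem _ _
  | add x y _ _ hx hy =>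
    rw [mul_add, add_mul]
    exact add_mem hx hy
  | mul x y _ _ hx hy =>
    have := mul_mem hx hy
    simpa only [mul_assoc, Units.inv_mul_cancel_left] using this

/-- `H_{r,1,n}` is spanned by the cosets `H_{r,p,n} T_1^k`. -/
lemma span_heckeRpn_pow {i : Fin n} (hi : i.val = 0) (hq : q ≠ 0)
    (hT : IsUnit (Hecke.T (cycParam p ξ v) q i)) :
    Submodule.span ℂ {x | ∃ h ∈ heckeRpn p n ξ v q, ∃ k : ℕ, x = h * Hecke.T _ q i ^ k} = ⊤ := by
  obtain ⟨τ, hτ⟩ := hT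
  set M := Submodule.span ℂ {x | ∃ h ∈ heckeRpn p n ξ v q, ∃ k : ℕ, x = h * Hecke.T _ q i ^ k}
  -- The span is a left ideal containing 1. For T_1 one writes T_1 h T_1^k = (T_1 h T_1⁻¹)
  -- T_1^(k+1).
  have h1 : ∀ a : HeckeR1n p n ξ v q, ∀ x ∈ M, a * x ∈ M := by
    intro a
    induction a using Hecke.induction with
    | hc c =>
      intro x hx
      rw [← Algebra.smul_def]
      exact M.smul_mem c hx
    | hT j =>
      intro x hx
      induction hx using Submodule.span_induction with
      | mem x hx =>
        obtain ⟨h, hh, k, rfl⟩ := hx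
        apply Submodule.subset_span
        by_cases hj : j.val = 0
        · have : j = i := Fin.ext (by omega)
          subst this
          refine ⟨_, conj_mem_heckeRpn hi hq τ hτ hh, k + 1, ?_⟩
          rw [pow_succ', ← hτ]
          simp only [mul_assoc, Units.inv_mul_cancel_left]
        · exact ⟨_, mul_mem (T_mem_heckeRpn (by omega)) hh, k, (mul_assoc _ _ _).symm⟩
      | zero => rw [mul_zero]; exact M.zero_mem
      | add x y _ _ hx hy => rw [mul_add]; exact M.add_mem hx hy
      | smul c x _ hx => rw [mul_smul_comm]; exact M.smul_mem c hx
    | hadd a b ha hb =>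
      intro x hx
      rw [add_mul]
      exact M.add_mem (ha x hx) (hb x hx)
    | hmul a b ha hb =>
      intro x hx
      rw [mul_assoc]
      exact ha _ (hb x hx)
  rw [eq_top_iff]
  rintro x -
  rw [← mul_one x]
  exact h1 x 1 (Submodule.subset_span ⟨1, one_mem _, 0, by simp⟩)

variable [NeZero p]

/-- The sum over `G` of the images of an element lies in `H_{r,p,n}`. -/
lemma sum_heckeAut_mem (hn : 0 < n) (hξ : IsPrimitiveRoot ξ p) (hv : ∀ j, v j ≠ 0) (hq : q ≠ 0)
    (x : HeckeR1n p n ξ v q) : ∑ g, heckeAut n hξ v q g x ∈ heckeRpn p n ξ v q := by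
  let i : Fin n := ⟨0, hn⟩
  have hi : i.val = 0 := rfl
  have hT : IsUnit (Hecke.T (cycParam p ξ v) q i) := Hecke.isUnit_T_zero (fun k =>
    mul_ne_zero (pow_ne_zero _ (hξ.ne_zero (NeZero.ne p))) (hv _)) hi
  have hx : x ∈ Submodule.span ℂ {x | ∃ h ∈ heckeRpn p n ξ v q, ∃ k : ℕ,
      x = h * Hecke.T _ q i ^ k} := by
    rw [span_heckeRpn_pow hi hq hT]
    trivial
  induction hx using Submodule.span_induction with
  | mem x hx =>
    obtain ⟨h, hh, k, rfl⟩ := hx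
    -- G acts on h T_1^k through the character χ^k, so the sum vanishes unless p divides k, and then
    -- T_1^k lies in the subalgebra.
    have h1 : ∀ g, heckeAut n hξ v q g (h * Hecke.T _ q i ^ k) =
        chi ξ g ^ k • (h * Hecke.T _ q i ^ k) := by
      intro g
      rw [map_mul, map_pow, heckeAut_fixes hξ v q g h hh, heckeAut_T, if_pos hi,
        _root_.smul_pow, mul_smul_comm]
    simp only [h1]
    rw [← Finset.sum_smul]
    by_cases hk : p ∣ k
    · obtain ⟨m, rfl⟩ := hk
      refine Subalgebra.smul_mem _ (mul_mem hh ?_) _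
      rw [pow_mul]
      exact pow_mem (T_pow_mem_heckeRpn hi) m
    · rw [sum_eq_zero_of_mul (fun g => chi ξ g ^ k) (fun g g' => by
        rw [chi_mul hξ.pow_eq_one, mul_pow]) (Multiplicative.ofAdd (1 : ZMod p)), zero_smul]
      · exact zero_mem _
      · have hp : p ≠ 1 := by
          rintro rfl
          exact hk (one_dvd k)
        have : Fact (1 < p) := ⟨by have := NeZero.pos p; omega⟩
        simp only [chi, toAdd_ofAdd, ZMod.val_one, pow_one]
        exact fun h => hk (hξ.dvd_of_pow_eq_one k h)
  | zero => simp only [map_zero, Finset.sum_const_zero]; exact zero_mem _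
  | add x y _ _ hx hy => simp only [map_add, Finset.sum_add_distrib]; exact add_mem hx hy
  | smul c x _ hx =>
    simp only [map_smul, ← Finset.smul_sum]
    exact Subalgebra.smul_mem _ hx c

end Averaging

/-! ### Shifts between the seminormal modules -/

section Shift

variable {p d n : ℕ} [NeZero p] {ξ : ℂ} {v : Fin d → ℂ} {q : ℂ}

/-- The bijection between the standard tableaux of shape `lam` and those of shape `g • lam`. -/
def shiftTabEquiv (g : CycGroup p) (lam : MultiDiagram p d n) :
    StdTableau lam ≃ StdTableau (g • lam) where
  toFun t := ⟨shiftCell g ∘ t.1, t.2.shift g⟩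
  invFun t := ⟨shiftCell g⁻¹ ∘ t.1, by
    have := t.2.shift g⁻¹
    rwa [inv_smul_smul] at this⟩
  left_inv t := by
    apply Subtype.ext
    funext a
    simp only [Function.comp]
    rw [← shiftCell_mul, inv_mul_cancel, shiftCell_one]
  right_inv t := by
    apply Subtype.ext
    funext a
    simp only [Function.comp]
    rw [← shiftCell_mul, mul_inv_cancel, shiftCell_one]

/-- The linear isomorphism `V(lam) ≃ V(g • lam)` induced by the shift. -/
noncomputable def shiftV (g : CycGroup p) (lam : MultiDiagram p d n) : V lam ≃ₗ[ℂ] V (g • lam) :=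
  Finsupp.domLCongr (shiftTabEquiv g lam)

lemma shiftV_single (g : CycGroup p) (lam : MultiDiagram p d n) (t : StdTableau lam) (c : ℂ) :
    shiftV g lam (Finsupp.single t c) = Finsupp.single (shiftTabEquiv g lam t) c :=
  Finsupp.domLCongr_single _ _ _

lemma shiftV_basisOrZero (g : CycGroup p) (lam : MultiDiagram p d n) (t : Fin n → Cell p d) :
    shiftV g lam (basisOrZero lam t) = basisOrZero (g • lam) (shiftCell g ∘ t) := by
  by_cases h : IsStandard lam t
  · rw [basisOrZero_of_isStandard h, basisOrZero_of_isStandard (h.shift g), shiftV_single]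
    rfl
  · rw [basisOrZero_of_not_isStandard h, basisOrZero_of_not_isStandard, map_zero]
    intro h'
    apply h
    have h2 := h'.shift g⁻¹
    rw [inv_smul_smul] at h2
    convert h2
    funext a
    simp only [Function.comp]
    rw [← shiftCell_mul, inv_mul_cancel, shiftCell_one]

lemma shiftV_act (hξ : IsPrimitiveRoot ξ p)
    {ρ : ∀ lam : MultiDiagram p d n, HeckeR1n p n ξ v q →ₐ[ℂ] Module.End ℂ (V lam)}
    (hρ : ∀ lam, IsSeminormal lam (ρ lam)) (g : CycGroup p) (lam : MultiDiagram p d n)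
    (h : HeckeR1n p n ξ v q) (x : V lam) :
    shiftV g lam (ρ lam h x) = ρ (g • lam) (heckeAut n hξ v q g h) (shiftV g lam x) := by
  induction h using Hecke.induction generalizing x with
  | hc c => simp [Module.algebraMap_end_apply]
  | hT i =>
    rw [heckeAut_T, hρ lam]
    induction x using Finsupp.induction_linear with
    | zero => simp
    | add x y hx hy => simp only [map_add, hx, hy]
    | single t c =>
      have hc : (Finsupp.single t c : V lam) = c • Finsupp.single t 1 := by simp
      rw [hc]
      simp only [map_smul]
      congr 1
      have hcomp : ∀ a, (shiftTabEquiv g lam t).1 a = shiftCell g (t.1 a) := fun _ => rfl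
      split_ifs with hi
      · rw [seminormalOp_single_zero i hi, map_smul (ρ (g • lam)), LinearMap.smul_apply, hρ,
          shiftV_single,
          seminormalOp_single_zero i hi, hcomp, smul_smul, map_smul, shiftV_single,
          compParam_shift hξ.pow_eq_one v g (t.1 i)]
      · have hi' : 1 ≤ i.val := by omega
        rw [seminormalOp_single i hi', map_add, map_smul, map_smul, hρ, shiftV_single,
          seminormalOp_single i hi', hcomp, hcomp, diagCoeff_shift hξ.pow_eq_one,
          shiftV_basisOrZero]
        rfl
  | hadd a b ha hb => simp only [map_add, LinearMap.add_apply, ha, hb]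
  | hmul a b ha hb => simp only [map_mul, Module.End.mul_apply, ha, hb]

lemma act_heckeAut_eq_zero (hξ : IsPrimitiveRoot ξ p)
    {ρ : ∀ lam : MultiDiagram p d n, HeckeR1n p n ξ v q →ₐ[ℂ] Module.End ℂ (V lam)}
    (hρ : ∀ lam, IsSeminormal lam (ρ lam)) (g : CycGroup p) {lam mu : MultiDiagram p d n}
    (hmu : g • mu = lam) {h : HeckeR1n p n ξ v q} (h0 : ρ mu h = 0) :
    ρ lam (heckeAut n hξ v q g h) = 0 := by
  subst hmu
  refine LinearMap.ext fun x => ?_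
  have := shiftV_act hξ hρ g mu h ((shiftV g mu).symm x)
  rw [LinearEquiv.apply_symm_apply, h0, LinearMap.zero_apply, map_zero] at this
  exact this.symm

/-- Averaged matrix units lie in the image of `H_{r,p,n}`. -/
theorem exists_rpn_unit (hn : 0 < n) (hξ : IsPrimitiveRoot ξ p) (hv : ∀ j, v j ≠ 0)
    {ρ : ∀ lam : MultiDiagram p d n, HeckeR1n p n ξ v q →ₐ[ℂ] Module.End ℂ (V lam)}
    (hρ : ∀ lam, IsSeminormal lam (ρ lam)) (hS : Separated p n ξ v q)
    {lam : MultiDiagram p d n} [Fintype (stab lam)] (s t : StdTableau lam) :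
    ∃ h ∈ heckeRpn p n ξ v q, ∀ x : V lam, ρ lam h x =
      ∑ g : stab lam, ((shiftOp g).symm x) t • Finsupp.single (shiftTab g s) 1 := by
  classical
  obtain ⟨h, hh⟩ := exists_isMatrixUnit hρ hS s t
  refine ⟨_, sum_heckeAut_mem hn hξ hv hS.q_ne h, fun x => ?_⟩
  rw [map_sum, LinearMap.sum_apply]
  -- Up to the shift, this is the action of h on the different shape g⁻¹ • lam, where a matrix unit
  -- of lam is zero.
  have h1 : ∀ g : CycGroup p, g ∉ stab lam → ρ lam (heckeAut n hξ v q g h) x = 0 := by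
    intro g hg
    rw [act_heckeAut_eq_zero hξ hρ g (mu := g⁻¹ • lam) (smul_inv_smul g lam)
      (hh.eq_zero _ fun he => hg ?_), LinearMap.zero_apply]
    rw [inv_smul_eq_iff] at he
    exact he.symm
  have h2 : ∀ g : stab lam, ρ lam (heckeAut n hξ v q g h) x =
      ((shiftOp g).symm x) t • Finsupp.single (shiftTab g s) 1 := by
    intro g
    have := shiftOp_act hξ (hρ lam) g h ((shiftOp g).symm x)
    rw [LinearEquiv.apply_symm_apply, hh.apply, map_smul, shiftOp_single] at this
    exact this.symm
  rw [← Finset.sum_subset (Finset.subset_univ (Finset.univ.filter fun g => g ∈ stab lam))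
    (fun g _ hg => h1 g (by simpa using hg)), ← Finset.sum_subtype_eq_sum_filter]
  have h3 : (Finset.subtype (fun g => g ∈ stab lam) Finset.univ : Finset (stab lam)) =
      Finset.univ := by
    ext g
    simp
  rw [h3]
  exact Finset.sum_congr rfl fun g _ => h2 g

end Shift

/-! ### The characters of the stabilizer -/

section Characters

variable {p d n : ℕ} [NeZero p] {ξ : ℂ}

lemma chi_injective (hξ : IsPrimitiveRoot ξ p) :
    Function.Injective (chi ξ : CycGroup p → ℂ) := fun _ _ hgh =>
  Multiplicative.toAdd.injective (ZMod.val_injective p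
    (hξ.pow_inj (ZMod.val_lt _) (ZMod.val_lt _) hgh))

lemma chi_pow_apply (hξ : ξ ^ p = 1) (g : CycGroup p) (l : ℕ) : chi ξ (g ^ l) = chi ξ g ^ l := by
  induction l with
  | zero => simp [chi_one]
  | succ l ih => rw [pow_succ, pow_succ, chi_mul hξ, ih]

lemma eNum_eq_card (lam : MultiDiagram p d n) : eNum lam = Nat.card (stab lam) := by
  have h1 := Nat.card_congr (MulAction.orbitProdStabilizerEquivGroup (CycGroup p) lam)
  rw [Nat.card_prod] at h1
  have h2 : Nat.card (CycGroup p) = p := Nat.card_zmod p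
  have h3 : 0 < Nat.card (MulAction.orbit (CycGroup p) lam) := by
    apply Nat.pos_of_ne_zero
    intro h
    rw [h, zero_mul, h2] at h1
    exact NeZero.ne p h1.symm
  rw [eNum]
  nth_rewrite 1 [← h2]
  rw [← h1, Nat.mul_div_cancel_left _ h3]

lemma eNum_pos (lam : MultiDiagram p d n) : 0 < eNum lam := by
  rw [eNum_eq_card]
  exact Nat.card_pos

/-- The characters `chi ^ l`, `1 ≤ l ≤ e`, of the stabilizer are distinct. -/
lemma eq_of_chi_pow_eq (hξ : IsPrimitiveRoot ξ p) {lam : MultiDiagram p d n} {l m : ℕ}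
    (hl : l ∈ Finset.Icc 1 (eNum lam)) (hm : m ∈ Finset.Icc 1 (eNum lam))
    (h : ∀ g : stab lam, chi ξ (g : CycGroup p) ^ l = chi ξ (g : CycGroup p) ^ m) : l = m := by
  have : IsCyclic (CycGroup p) := inferInstance
  -- Since χ is injective, equality of the characters at a generator is a congruence of exponents
  -- modulo e; the interval 1, …, e meets each class once.
  obtain ⟨γ, hγ⟩ := IsCyclic.exists_ofOrder_eq_natCard (α := stab lam)
  have h1 : γ ^ l = γ ^ m := by
    apply Subtype.ext
    apply chi_injective hξ
    rw [Subgroup.coe_pow, Subgroup.coe_pow, chi_pow_apply hξ.pow_eq_one,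
      chi_pow_apply hξ.pow_eq_one, h]
  rw [pow_eq_pow_iff_modEq, hγ, ← eNum_eq_card] at h1
  rw [Finset.mem_Icc] at hl hm
  have h2 : l - 1 ≡ m - 1 [MOD eNum lam] := by
    apply Nat.ModEq.add_right_cancel' 1
    rwa [Nat.sub_add_cancel hl.1, Nat.sub_add_cancel hm.1]
  have := h2.eq_of_lt_of_lt (by omega) (by omega)
  omega

lemma chi_pow_eNum (hξ : IsPrimitiveRoot ξ p) {lam : MultiDiagram p d n} (g : stab lam) :
    chi ξ (g : CycGroup p) ^ eNum lam = 1 := by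
  rw [← chi_pow_apply hξ.pow_eq_one, ← Subgroup.coe_pow, eNum_eq_card, pow_card_eq_one',
    Subgroup.coe_one, chi_one]

/-- Column orthogonality of the characters of the stabilizer. -/
lemma sum_chi_pow_inv (hξ : IsPrimitiveRoot ξ p) {lam : MultiDiagram p d n} (g : stab lam)
    (hg : g ≠ 1) : ∑ l ∈ Finset.Icc 1 (eNum lam), (chi ξ (g : CycGroup p) ^ l)⁻¹ = 0 := by
  have h1 : chi ξ (g : CycGroup p) ≠ 1 := fun h => hg (Subtype.ext (chi_injective hξ (by
    rw [h, Subgroup.coe_one, chi_one])))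
  have h2 : Finset.Icc 1 (eNum lam) = Finset.Ico (0 + 1) (eNum lam + 1) := by
    ext l
    simp only [Finset.mem_Icc, Finset.mem_Ico]
    omega
  have h3 := geom_sum_mul (chi ξ (g : CycGroup p))⁻¹ (eNum lam)
  rw [inv_pow, chi_pow_eNum hξ, inv_one, sub_self] at h3
  rw [h2, ← Finset.sum_Ico_add' (fun l => (chi ξ (g : CycGroup p) ^ l)⁻¹) 0 (eNum lam) 1,
    ← Finset.range_eq_Ico]
  have h4 := (mul_eq_zero.1 h3).resolve_right
    (sub_ne_zero.2 fun h => h1 (inv_eq_one.1 h))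
  simp only [pow_succ, mul_inv, ← inv_pow, ← Finset.sum_mul, h4, zero_mul]

end Characters

/-! ### The eigenspaces of the shift operators -/

section Eigenspaces

variable {p d n : ℕ} [NeZero p] {ξ : ℂ} {v : Fin d → ℂ} {q : ℂ}

lemma shiftOp_mul {lam : MultiDiagram p d n} (g h : stab lam) (x : V lam) :
    shiftOp g (shiftOp h x) = shiftOp (g * h) x := by
  induction x using Finsupp.induction_linear with
  | zero => simp
  | add x y hx hy => simp only [map_add, hx, hy]
  | single t c =>
    rw [shiftOp_single, shiftOp_single, shiftOp_single]
    congr 1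
    apply Subtype.ext
    funext a
    exact (shiftCell_mul (g : CycGroup p) (h : CycGroup p) (t.1 a)).symm

lemma shiftOp_one {lam : MultiDiagram p d n} (x : V lam) : shiftOp (1 : stab lam) x = x := by
  apply (shiftOp 1).injective
  rw [shiftOp_mul, one_mul]

/-- The stabilizer acts freely on the standard tableaux. -/
lemma eq_one_of_shiftTab_eq (hn : 0 < n) {lam : MultiDiagram p d n} {g : stab lam}
    {s : StdTableau lam} (h : shiftTab g s = s) : g = 1 := by
  have h1 := congrFun (congrArg Subtype.val h) ⟨0, hn⟩
  have h2 : (s.1 ⟨0, hn⟩).1.1 - (g : CycGroup p).toAdd = (s.1 ⟨0, hn⟩).1.1 :=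
    congrArg (fun c => c.1.1) h1
  rw [sub_eq_self] at h2
  exact Subtype.ext (Multiplicative.toAdd.injective h2)

variable (ξ) in
/-- The vectors on which the stabilizer acts through the character `chi ^ l`. -/
def IsWeight {lam : MultiDiagram p d n} (l : ℕ) (x : V lam) : Prop :=
  ∀ g : stab lam, shiftOp g x = chi ξ (g : CycGroup p) ^ l • x

variable (ξ) in
/-- The projector onto the vectors of weight `l`. -/
noncomputable def weightProj (lam : MultiDiagram p d n) [Fintype (stab lam)] (l : ℕ) :
    V lam →ₗ[ℂ] V lam :=
  (eNum lam : ℂ)⁻¹ • ∑ g : stab lam,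
    (chi ξ (g : CycGroup p) ^ l)⁻¹ • (shiftOp g : V lam →ₗ[ℂ] V lam)

section Projector

variable {lam : MultiDiagram p d n} [Fintype (stab lam)]

lemma weightProj_apply (l : ℕ) (x : V lam) : weightProj ξ lam l x =
    (eNum lam : ℂ)⁻¹ • ∑ g : stab lam, (chi ξ (g : CycGroup p) ^ l)⁻¹ • shiftOp g x := by
  simp [weightProj]

lemma eNum_cast_ne_zero (lam : MultiDiagram p d n) : (eNum lam : ℂ) ≠ 0 :=
  Nat.cast_ne_zero.2 (eNum_pos lam).ne'

lemma weightProj_shiftOp (hξ : IsPrimitiveRoot ξ p) (l : ℕ) (h : stab lam) (x : V lam) :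
    weightProj ξ lam l (shiftOp h x) = chi ξ (h : CycGroup p) ^ l • weightProj ξ lam l x := by
  rw [weightProj_apply, weightProj_apply, smul_comm]
  congr 1
  rw [Finset.smul_sum, ← Equiv.sum_comp (Equiv.mulRight h)
    (fun g : stab lam => chi ξ (h : CycGroup p) ^ l • (chi ξ (g : CycGroup p) ^ l)⁻¹ • shiftOp g x)]
  refine Finset.sum_congr rfl fun g _ => ?_
  rw [shiftOp_mul, Equiv.coe_mulRight, smul_smul, Subgroup.coe_mul, chi_mul hξ.pow_eq_one]
  congr 1
  have := chi_ne_zero hξ.pow_eq_one (h : CycGroup p)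
  have := chi_ne_zero hξ.pow_eq_one (g : CycGroup p)
  rw [mul_pow]
  field_simp

lemma shiftOp_weightProj (l : ℕ) (h : stab lam) (x : V lam) :
    shiftOp h (weightProj ξ lam l x) = weightProj ξ lam l (shiftOp h x) := by
  simp only [weightProj_apply, map_smul, map_sum, shiftOp_mul, mul_comm h]

lemma isWeight_weightProj (hξ : IsPrimitiveRoot ξ p) (l : ℕ) (x : V lam) :
    IsWeight ξ l (weightProj ξ lam l x) := fun h => by
  rw [shiftOp_weightProj, weightProj_shiftOp hξ]

lemma weightProj_of_isWeight (hξ : IsPrimitiveRoot ξ p) {l : ℕ} {x : V lam}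
    (hx : IsWeight ξ l x) : weightProj ξ lam l x = x := by
  rw [weightProj_apply]
  have h1 : ∀ g : stab lam, (chi ξ (g : CycGroup p) ^ l)⁻¹ • shiftOp g x = x := fun g => by
    rw [hx g, inv_smul_smul₀ (pow_ne_zero _ (chi_ne_zero hξ.pow_eq_one _))]
  rw [Finset.sum_congr rfl fun g _ => h1 g, Finset.sum_const, Finset.card_univ,
    ← Nat.card_eq_fintype_card, ← eNum_eq_card, ← Nat.cast_smul_eq_nsmul ℂ,
    inv_smul_smul₀ (eNum_cast_ne_zero lam)]

lemma weightProj_of_isWeight_ne (hξ : IsPrimitiveRoot ξ p) {l m : ℕ}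
    (hl : l ∈ Finset.Icc 1 (eNum lam)) (hm : m ∈ Finset.Icc 1 (eNum lam)) (hlm : l ≠ m)
    {x : V lam} (hx : IsWeight ξ m x) : weightProj ξ lam l x = 0 := by
  by_contra h0
  refine hlm (eq_of_chi_pow_eq hξ hl hm fun g => ?_)
  have h1 := isWeight_weightProj hξ l x g
  rw [shiftOp_weightProj, hx g, map_smul] at h1
  exact (smul_left_injective ℂ h0 h1).symm

lemma sum_weightProj (hξ : IsPrimitiveRoot ξ p) (x : V lam) :
    ∑ l ∈ Finset.Icc 1 (eNum lam), weightProj ξ lam l x = x := by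
  simp only [weightProj_apply]
  rw [← Finset.smul_sum, Finset.sum_comm]
  simp only [← Finset.sum_smul]
  rw [Finset.sum_eq_single 1 (fun g _ hg => by rw [sum_chi_pow_inv hξ g hg, zero_smul])
    (fun h => absurd (Finset.mem_univ _) h), shiftOp_one]
  simp only [Subgroup.coe_one, chi_one, one_pow, inv_one, Finset.sum_const, Nat.card_Icc,
    Nat.add_sub_cancel, nsmul_eq_mul, mul_one]
  rw [inv_smul_smul₀ (eNum_cast_ne_zero lam)]

/-- The stabilizer acts freely on tableaux, so only the identity contributes at s. In particular
every weight occurs in `V lam`. -/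
lemma weightProj_single_self (hn : 0 < n) (l : ℕ) (s : StdTableau lam) :
    weightProj ξ lam l (Finsupp.single s 1) s = (eNum lam : ℂ)⁻¹ := by
  rw [weightProj_apply, Finsupp.smul_apply, Finsupp.finsetSum_apply,
    Finset.sum_eq_single 1]
  · simp [shiftOp_one, chi_one]
  · intro g _ hg
    rw [shiftOp_single, Finsupp.smul_apply, Finsupp.single_eq_of_ne, smul_zero]
    exact fun h => hg (eq_one_of_shiftTab_eq hn h.symm)
  · exact fun h => absurd (Finset.mem_univ _) h

/-- On the vectors of weight `l`, the algebra `H_{r,p,n}` contains projected matrix units. -/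
lemma exists_rpn_unit_weight (hn : 0 < n) (hξ : IsPrimitiveRoot ξ p) (hv : ∀ j, v j ≠ 0)
    {ρ : ∀ lam : MultiDiagram p d n, HeckeR1n p n ξ v q →ₐ[ℂ] Module.End ℂ (V lam)}
    (hρ : ∀ lam, IsSeminormal lam (ρ lam)) (hS : Separated p n ξ v q) (s t : StdTableau lam) :
    ∃ h ∈ heckeRpn p n ξ v q, ∀ l, ∀ x : V lam, IsWeight ξ l x →
      ρ lam h x = x t • weightProj ξ lam l (Finsupp.single s 1) := by
  obtain ⟨h, hh, hx⟩ := exists_rpn_unit hn hξ hv hρ hS s t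
  -- One element serves all weights l simultaneously, which is what allows modules of different
  -- weight to be compared.
  refine ⟨(eNum lam : ℂ)⁻¹ • h, Subalgebra.smul_mem _ hh _, fun l x hl => ?_⟩
  rw [map_smul, LinearMap.smul_apply, hx, weightProj_apply, smul_comm (x t)]
  congr 1
  rw [Finset.smul_sum]
  refine Finset.sum_congr rfl fun g _ => ?_
  have h1 : (shiftOp g).symm x = (chi ξ (g : CycGroup p) ^ l)⁻¹ • x := by
    rw [LinearEquiv.symm_apply_eq, map_smul, hl g,
      inv_smul_smul₀ (pow_ne_zero _ (chi_ne_zero hξ.pow_eq_one _))]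
  rw [h1, Finsupp.smul_apply, smul_eq_mul, mul_comm, mul_smul, shiftOp_single]

end Projector

variable {ρ : ∀ lam : MultiDiagram p d n, HeckeR1n p n ξ v q →ₐ[ℂ] Module.End ℂ (V lam)}

lemma arikiModule_ne_zero_iff (hξ : IsPrimitiveRoot ξ p) (hρ : ∀ lam, IsSeminormal lam (ρ lam))
    {lam : MultiDiagram p d n} {l : ℕ} (x : arikiModule hξ (hρ lam) l) :
    x ≠ 0 ↔ ∃ t, RepSpace.toSpace (ρ lam) x.1 t ≠ 0 := by
  rw [← Subtype.coe_ne_coe, ← (RepSpace.toSpace (ρ lam)).injective.ne_iff]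
  exact Finsupp.ne_iff

/-- The modules `V(λ̄, l)` are irreducible. -/
theorem isSimpleModule_arikiModule (hn : 0 < n) (hξ : IsPrimitiveRoot ξ p) (hv : ∀ j, v j ≠ 0)
    (hρ : ∀ lam, IsSeminormal lam (ρ lam)) (hS : Separated p n ξ v q)
    (lam : MultiDiagram p d n) (l : ℕ) :
    IsSimpleModule (heckeRpn p n ξ v q) (arikiModule hξ (hρ lam) l) := by
  have := Fintype.ofFinite (stab lam)
  rw [isSimpleModule_iff_toSpanSingleton_surjective]
  constructor
  · obtain ⟨t⟩ := (inferInstance : Nonempty (StdTableau lam))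
    let x : arikiModule hξ (hρ lam) l := ⟨(RepSpace.toSpace (ρ lam)).symm
      (weightProj ξ lam l (Finsupp.single t 1)), isWeight_weightProj hξ l _⟩
    refine ⟨x, 0, (arikiModule_ne_zero_iff hξ hρ x).2 ⟨t, ?_⟩⟩
    change weightProj ξ lam l (Finsupp.single t 1) t ≠ 0
    rw [weightProj_single_self hn]
    exact inv_ne_zero (eNum_cast_ne_zero lam)
  · intro x hx y
    obtain ⟨t, ht⟩ := (arikiModule_ne_zero_iff hξ hρ x).1 hx
    have key : ∀ z : V lam, ∃ h ∈ heckeRpn p n ξ v q,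
        ρ lam h (RepSpace.toSpace (ρ lam) x.1) = weightProj ξ lam l z := by
      intro z
      induction z using Finsupp.induction_linear with
      | zero => exact ⟨0, zero_mem _, by simp⟩
      | add z w hz hw =>
        obtain ⟨h, hh, hz⟩ := hz
        obtain ⟨k, hk, hw⟩ := hw
        exact ⟨h + k, add_mem hh hk, by rw [map_add, LinearMap.add_apply, hz, hw, map_add]⟩
      | single s c =>
        obtain ⟨h, hh, hs⟩ := exists_rpn_unit_weight hn hξ hv hρ hS s t
        refine ⟨(c * (RepSpace.toSpace (ρ lam) x.1 t)⁻¹) • h, Subalgebra.smul_mem _ hh _, ?_⟩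
        rw [map_smul, LinearMap.smul_apply, hs l _ x.2, smul_smul, mul_assoc, inv_mul_cancel₀ ht,
          mul_one, ← map_smul, Finsupp.smul_single, smul_eq_mul, mul_one]
    obtain ⟨h, hh, hy⟩ := key (RepSpace.toSpace (ρ lam) y.1)
    refine ⟨⟨h, hh⟩, Subtype.ext ?_⟩
    rw [weightProj_of_isWeight hξ y.2] at hy
    exact hy

/-- The modules `V(λ̄, l)`, `1 ≤ l ≤ e`, are pairwise non-isomorphic. -/
theorem eq_of_arikiModule_equiv (hn : 0 < n) (hξ : IsPrimitiveRoot ξ p) (hv : ∀ j, v j ≠ 0)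
    (hρ : ∀ lam, IsSeminormal lam (ρ lam)) (hS : Separated p n ξ v q)
    {lam : MultiDiagram p d n} {l m : ℕ} (hl : l ∈ Finset.Icc 1 (eNum lam))
    (hm : m ∈ Finset.Icc 1 (eNum lam))
    (φ : arikiModule hξ (hρ lam) l ≃ₗ[heckeRpn p n ξ v q] arikiModule hξ (hρ lam) m) :
    l = m := by
  have := Fintype.ofFinite (stab lam)
  refine eq_of_chi_pow_eq hξ hl hm fun g => ?_
  have := isSimpleModule_arikiModule hn hξ hv hρ hS lam l
  have := IsSimpleModule.nontrivial (heckeRpn p n ξ v q) (arikiModule hξ (hρ lam) l)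
  obtain ⟨x, hx⟩ := exists_ne (0 : arikiModule hξ (hρ lam) l)
  obtain ⟨t, ht⟩ := (arikiModule_ne_zero_iff hξ hρ _).1 (φ.map_ne_zero_iff.2 hx)
  obtain ⟨h, hh, h1⟩ := exists_rpn_unit_weight hn hξ hv hρ hS t t
  obtain ⟨k, hk, k1⟩ := exists_rpn_unit_weight hn hξ hv hρ hS (shiftTab g t) t
  -- The ratio of the two elements on a weight space is the character value. Hence k - χ(g)^l h
  -- kills weight l, and by the isomorphism also weight m, where it acts as (χ(g)^m - χ(g)^l) h.
  have k2 : ∀ l, ∀ x : V lam, IsWeight ξ l x →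
      ρ lam k x = chi ξ (g : CycGroup p) ^ l • ρ lam h x := by
    intro l x hx
    rw [k1 l x hx, h1 l x hx, ← shiftOp_single, weightProj_shiftOp hξ, smul_comm]
  let a : heckeRpn p n ξ v q :=
    ⟨k - chi ξ (g : CycGroup p) ^ l • h, sub_mem hk (Subalgebra.smul_mem _ hh _)⟩
  have ha : a • x = 0 := by
    apply Subtype.ext
    change ρ lam (k - chi ξ (g : CycGroup p) ^ l • h) (RepSpace.toSpace (ρ lam) x.1) = 0
    rw [map_sub, map_smul, LinearMap.sub_apply, LinearMap.smul_apply, k2 l _ x.2, sub_self]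
  have hb : a • φ x = 0 := by rw [← map_smul, ha, map_zero]
  have hc : ρ lam (k - chi ξ (g : CycGroup p) ^ l • h) (RepSpace.toSpace (ρ lam) (φ x).1) = 0 :=
    congrArg Subtype.val hb
  rw [map_sub, map_smul, LinearMap.sub_apply, LinearMap.smul_apply, k2 m _ (φ x).2, ← sub_smul,
    h1 m _ (φ x).2] at hc
  have hd := DFunLike.congr_fun hc t
  rw [Finsupp.smul_apply, Finsupp.smul_apply, weightProj_single_self hn, smul_eq_mul, smul_eq_mul,
    Finsupp.zero_apply] at hd
  have he := (mul_eq_zero.1 hd).resolve_right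
    (mul_ne_zero ht (inv_ne_zero (eNum_cast_ne_zero lam)))
  exact (sub_eq_zero.1 he).symm

lemma shiftOp_shiftV (g : CycGroup p) (lam : MultiDiagram p d n) (h : CycGroup p)
    (h1 : h ∈ stab lam) (h2 : h ∈ stab (g • lam)) (x : V lam) :
    shiftOp ⟨h, h2⟩ (shiftV g lam x) = shiftV g lam (shiftOp ⟨h, h1⟩ x) := by
  induction x using Finsupp.induction_linear with
  | zero => simp
  | add x y hx hy => simp only [map_add, hx, hy]
  | single t c =>
    rw [shiftV_single, shiftOp_single, shiftOp_single, shiftV_single]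
    congr 1
    apply Subtype.ext
    funext a
    change shiftCell h (shiftCell g (t.1 a)) = shiftCell g (shiftCell h (t.1 a))
    rw [← shiftCell_mul, ← shiftCell_mul, mul_comm]

lemma mem_stab_smul_iff (g : CycGroup p) (lam : MultiDiagram p d n) (h : CycGroup p) :
    h ∈ stab (g • lam) ↔ h ∈ stab lam := by
  rw [MulAction.mem_stabilizer_iff, MulAction.mem_stabilizer_iff, smul_smul, mul_comm, ← smul_smul,
    smul_left_cancel_iff]

/-- The shift as an isomorphism of `H_{r,p,n}`-modules. -/
noncomputable def shiftEquiv (hξ : IsPrimitiveRoot ξ p) (hρ : ∀ lam, IsSeminormal lam (ρ lam))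
    (g : CycGroup p) (lam : MultiDiagram p d n) :
    RepSpace (ρ lam) ≃ₗ[heckeRpn p n ξ v q] RepSpace (ρ (g • lam)) where
  __ := (shiftV g lam).toAddEquiv
  map_smul' h x := by
    change shiftV g lam (ρ lam h (RepSpace.toSpace (ρ lam) x)) =
      ρ (g • lam) h (shiftV g lam (RepSpace.toSpace (ρ lam) x))
    rw [shiftV_act hξ hρ, heckeAut_fixes hξ v q g _ h.2]

/-- `V(λ̄, l)` depends only on the orbit of `lam`. -/
theorem nonempty_arikiModule_equiv (hξ : IsPrimitiveRoot ξ p)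
    (hρ : ∀ lam, IsSeminormal lam (ρ lam)) (lam : MultiDiagram p d n) (g : CycGroup p) (l : ℕ) :
    Nonempty (arikiModule hξ (hρ lam) l ≃ₗ[heckeRpn p n ξ v q]
      arikiModule hξ (hρ (g • lam)) l) := by
  refine ⟨(shiftEquiv hξ hρ g lam).ofSubmodules _ _ ?_⟩
  ext y
  obtain ⟨x, rfl⟩ := (shiftEquiv hξ hρ g lam).surjective y
  rw [Submodule.mem_map_equiv, LinearEquiv.symm_apply_apply]
  constructor
  · intro hx h
    have h1 := (mem_stab_smul_iff g lam h).1 h.2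
    exact (shiftOp_shiftV g lam h h1 h.2 (RepSpace.toSpace (ρ lam) x)).trans
      ((congrArg (shiftV g lam) (hx ⟨h, h1⟩)).trans (map_smul _ _ _))
  · intro hx h
    have h2 := (mem_stab_smul_iff g lam h).2 h.2
    apply (shiftV g lam).injective
    exact (shiftOp_shiftV g lam h h.2 h2 (RepSpace.toSpace (ρ lam) x)).symm.trans
      ((hx ⟨h, h2⟩).trans (map_smul (shiftV g lam) _ _).symm)

end Eigenspaces

/-! ### One-dimensional modules of twisted group algebras -/

section LineModules

variable {G : Type} [Group G]

/-- A trivialization of the cocycle `β`, equivalently a one-dimensional module of the twisted group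
algebra. -/
structure Trivialization (β : TwoCocycle G) where
  toFun : G → ℂ
  ne_zero : ∀ g, toFun g ≠ 0
  mul : ∀ g h, toFun g * toFun h = β g h * toFun (g * h)

variable {β : TwoCocycle G}

/-- The one-dimensional module attached to a trivialization. -/
noncomputable def Trivialization.rep (s : Trivialization β) :
    CovariantRep (1 : G →* (ℂ ≃ₐ[ℂ] ℂ)) β ℂ where
  act := Algebra.ofId ℂ _
  op g := LinearEquiv.smulOfNeZero ℂ ℂ (s.toFun g) (s.ne_zero g)
  op_mul g h w := by
    simp only [LinearEquiv.smulOfNeZero_apply, smul_eq_mul]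
    rw [← mul_assoc, s.mul, mul_assoc]
  op_act g r w := by
    simp only [Algebra.ofId_apply, Module.algebraMap_end_apply, map_smul, MonoidHom.one_apply,
      AlgEquiv.one_apply]

/-- The underlying module of the twisted group algebra. -/
abbrev Trivialization.Line (s : Trivialization β) : Type := s.rep.Space

namespace Trivialization

lemma single_smul (s : Trivialization β) (g : G) (r : ℂ) (x : s.Line) :
    (CrossedProduct.single _ β g r : TwistedGroupAlgebra β) • x = (r * s.toFun g) • x := by
  apply (RepSpace.toSpace _).injective
  rw [RepSpace.toSpace_smul]
  change s.rep.toLin _ _ = _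
  rw [CovariantRep.toLin_single, mul_smul, map_smul, map_smul]
  rfl

lemma isSimpleModule_line (s : Trivialization β) :
    IsSimpleModule (TwistedGroupAlgebra β) s.Line := by
  rw [isSimpleModule_iff_toSpanSingleton_surjective]
  refine ⟨inferInstanceAs (Nontrivial ℂ), fun x hx y => ?_⟩
  refine ⟨algebraMap ℂ _ (RepSpace.toSpace _ y / RepSpace.toSpace _ x), ?_⟩
  rw [LinearMap.toSpanSingleton_apply, algebraMap_smul]
  apply (RepSpace.toSpace _).injective
  rw [map_smul, smul_eq_mul, div_mul_cancel₀ _ ((RepSpace.toSpace _).map_ne_zero_iff.2 hx)]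

lemma toFun_eq_of_equiv {s t : Trivialization β}
    (φ : s.Line ≃ₗ[TwistedGroupAlgebra β] t.Line) (g : G) : s.toFun g = t.toFun g := by
  have := s.isSimpleModule_line
  have := IsSimpleModule.nontrivial (TwistedGroupAlgebra β) s.Line
  obtain ⟨x, hx⟩ := exists_ne (0 : s.Line)
  have h1 := map_smul φ (CrossedProduct.single _ β g 1 : TwistedGroupAlgebra β) x
  rw [single_smul, single_smul, one_mul, one_mul, ← algebraMap_smul (TwistedGroupAlgebra β),
    map_smul, algebraMap_smul] at h1
  exact smul_left_injective ℂ (φ.map_ne_zero_iff.2 hx) h1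

lemma apply_one (s : Trivialization β) : s.toFun 1 = β 1 1 := by
  have := s.mul 1 1
  rw [mul_one] at this
  exact mul_right_cancel₀ (s.ne_zero 1) this

variable [Fintype G]

/-- The idempotent of the twisted group algebra attached to a trivialization, up to a scalar. -/
noncomputable def idem (s : Trivialization β) : TwistedGroupAlgebra β :=
  ∑ g, CrossedProduct.single _ β g (s.toFun g)⁻¹

lemma single_mul_idem (s : Trivialization β) (h : G) (r : ℂ) :
    CrossedProduct.single _ β h r * s.idem = (r * s.toFun h) • s.idem := by
  rw [idem, Finset.mul_sum, Finset.smul_sum]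
  simp only [CrossedProduct.smul_single]
  rw [← Equiv.sum_comp (Equiv.mulLeft h) (fun g => CrossedProduct.single _ β g
    ((r * s.toFun h) • (s.toFun g)⁻¹))]
  refine Finset.sum_congr rfl fun g _ => ?_
  rw [CrossedProduct.single_mul_single, Equiv.coe_mulLeft]
  congr 1
  have h1 := s.mul h g
  have h2 := s.ne_zero g
  have h3 := s.ne_zero (h * g)
  rw [MonoidHom.one_apply, AlgEquiv.one_apply, smul_eq_mul, smul_eq_mul]
  field_simp
  linear_combination (-r) * h1

/-- By orthogonality the elements `idem` add up to a nonzero multiple of 1, so one of them does not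
kill M. Its image contains a copy of the line, and a nonzero map between simple modules is an
isomorphism. -/
lemma exists_equiv_line {ι : Type*} (I : Finset ι) (s : ι → Trivialization β)
    (hI : I.Nonempty) (hs : ∀ g, g ≠ 1 → ∑ l ∈ I, ((s l).toFun g)⁻¹ = 0)
    (M : Type*) [AddCommGroup M] [Module (TwistedGroupAlgebra β) M]
    [IsSimpleModule (TwistedGroupAlgebra β) M] :
    ∃ l ∈ I, Nonempty (M ≃ₗ[TwistedGroupAlgebra β] (s l).Line) := by
  have h1 : ∑ l ∈ I, (s l).idem = (I.card : ℂ) • (1 : TwistedGroupAlgebra β) := by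
    simp only [idem]
    rw [Finset.sum_comm, CrossedProduct.one_def, CrossedProduct.smul_single]
    have h2 : ∀ g, ∑ l ∈ I, (CrossedProduct.single _ β g ((s l).toFun g)⁻¹ :
        TwistedGroupAlgebra β) = CrossedProduct.single _ β g (∑ l ∈ I, ((s l).toFun g)⁻¹) :=
      fun g => (map_sum (Finsupp.singleAddHom g) _ _).symm
    rw [Finset.sum_congr rfl fun g _ => h2 g, Finset.sum_eq_single 1]
    · congr 1
      simp [apply_one]
    · intro g _ hg
      rw [hs g hg]
      exact Finsupp.single_zero g
    · exact fun h => absurd (Finset.mem_univ _) h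
  have := IsSimpleModule.nontrivial (TwistedGroupAlgebra β) M
  obtain ⟨m, hm⟩ := exists_ne (0 : M)
  have h3 : ∃ l ∈ I, (s l).idem • m ≠ 0 := by
    by_contra! h
    apply hm
    have h4 : (∑ l ∈ I, (s l).idem) • m = 0 := by
      rw [Finset.sum_smul]
      exact Finset.sum_eq_zero h
    have h5 : (algebraMap ℂ (TwistedGroupAlgebra β) (I.card : ℂ)⁻¹) • (∑ l ∈ I, (s l).idem) • m
        = m := by
      rw [h1, ← mul_smul, ← Algebra.smul_def, smul_smul,
        inv_mul_cancel₀ (Nat.cast_ne_zero.2 hI.card_pos.ne'), one_smul, one_smul]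
    rw [← h5, h4, smul_zero]
  obtain ⟨l, hl, h4⟩ := h3
  refine ⟨l, hl, ?_⟩
  let f : (s l).Line →ₗ[TwistedGroupAlgebra β] M :=
    { toFun x := (algebraMap ℂ (TwistedGroupAlgebra β) (RepSpace.toSpace _ x)) • (s l).idem • m
      map_add' x y := by rw [map_add, map_add, add_smul]
      map_smul' a x := by
        induction a using CrossedProduct.induction with
        | h0 => simp
        | hadd a b ha hb =>
          simp only [add_smul, map_add, RingHom.id_apply] at ha hb ⊢
          rw [ha, hb]
        | hs g r =>
          rw [single_smul, map_smul, RingHom.id_apply, ← mul_smul, ← mul_smul, ← mul_smul,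
            ← Algebra.commutes, mul_assoc, single_mul_idem, ← Algebra.smul_def,
            ← Algebra.smul_def, smul_smul, smul_eq_mul, mul_comm] }
  have hf : f ≠ 0 := by
    intro h
    apply h4
    have h5 := LinearMap.congr_fun h ((RepSpace.toSpace (s l).rep.toHom).symm 1)
    change (algebraMap ℂ (TwistedGroupAlgebra β) 1) • (s l).idem • m = 0 at h5
    rwa [map_one, one_smul] at h5
  have := (s l).isSimpleModule_line
  exact ⟨(LinearEquiv.ofBijective f (LinearMap.bijective_of_ne_zero hf)).symm⟩

end Trivialization

/-- The functionals on a line, as multiples of the coordinate functional. -/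
lemma Trivialization.dual_eq_smul (s : Trivialization β) (f : Module.Dual ℂ s.Line) :
    f = f ((RepSpace.toSpace s.rep.toHom).symm 1) •
      (RepSpace.toSpace s.rep.toHom : s.Line →ₗ[ℂ] ℂ) := by
  refine LinearMap.ext fun x => ?_
  obtain ⟨z, rfl⟩ := (RepSpace.toSpace s.rep.toHom).symm.surjective x
  have h1 : (RepSpace.toSpace s.rep.toHom).symm z =
      z • (RepSpace.toSpace s.rep.toHom).symm 1 := by
    rw [← map_smul, smul_eq_mul, mul_one]
  rw [h1, map_smul]
  simp [mul_comm]

lemma Trivialization.inv_basisUnit_smul (s : Trivialization β) (g : G) (x : s.Line) :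
    (((TwistedGroupAlgebra.basisUnit β g)⁻¹ : (TwistedGroupAlgebra β)ˣ) :
      TwistedGroupAlgebra β) • x = (s.toFun g)⁻¹ • x := by
  have h1 : (TwistedGroupAlgebra.basisUnit β g : TwistedGroupAlgebra β) • (s.toFun g)⁻¹ • x = x := by
    refine (s.single_smul g 1 _).trans ?_
    rw [one_mul, smul_inv_smul₀ (s.ne_zero g)]
  nth_rewrite 1 [← h1]
  rw [← mul_smul, Units.inv_mul, one_smul]

end LineModules

/-! ### Decomposition of a module with scalar group action on its pieces -/

section Decomposition

variable {G : Type} [Group G] {α : TwoCocycle G} {B : Type} [Ring B] [Algebra ℂ B]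
  {W : Type} [AddCommGroup W] [Module ℂ W]

/-- The projections need only be additive: they show that the A-linear map out of the direct sum is
bijective. -/
lemma nonempty_equiv_directSum_of_maps {A E ι : Type*} [Ring A] [AddCommGroup E] [Module A E]
    [Fintype ι] [DecidableEq ι] {D : ι → Type*} [∀ l, AddCommGroup (D l)] [∀ l, Module A (D l)]
    (f : ∀ l, D l →ₗ[A] E) (g : ∀ l, E →+ D l) (hsum : ∀ w, ∑ l, f l (g l w) = w)
    (hself : ∀ l x, g l (f l x) = x) (hne : ∀ l m x, l ≠ m → g l (f m x) = 0) :
    Nonempty (E ≃ₗ[A] ⨁ l, D l) := by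
  have h1 : ∀ w, DirectSum.toModule A ι E f (∑ l, DirectSum.lof A ι D l (g l w)) = w := by
    intro w
    rw [map_sum]
    simp only [DirectSum.toModule_lof, hsum]
  refine ⟨(LinearEquiv.ofBijective (DirectSum.toModule A ι E f)
    ⟨(injective_iff_map_eq_zero _).2 fun y hy => ?_, fun w => ⟨_, h1 w⟩⟩).symm⟩
  have h2 : ∀ y l, g l (DirectSum.toModule A ι E f y) = y l := by
    intro y l
    induction y using DirectSum.induction_on with
    | zero => simp
    | of m x =>
      rw [← DirectSum.lof_eq_of A, DirectSum.toModule_lof, DirectSum.lof_eq_of]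
      by_cases h : m = l
      · subst h
        rw [hself, DirectSum.of_eq_same]
      · rw [hne l m x (Ne.symm h), DirectSum.of_eq_of_ne _ _ _ (Ne.symm h)]
    | add x y hx hy => rw [map_add, map_add, hx, hy, DirectSum.add_apply]
  ext l
  rw [← h2, hy, map_zero, DirectSum.zero_apply]

/-- The homomorphism `M ⊗ L^* → W` induced by a map `M → W` on whose image the group acts by
scalars. -/
lemma exists_outerTensor_hom (E : CovariantRep (1 : G →* (B ≃ₐ[ℂ] B)) α W) {M : Type}
    [AddCommGroup M] [Module ℂ M] [Module B M] [IsScalarTower ℂ B M]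
    (s : Trivialization α⁻¹) (j : M →ₗ[ℂ] W) (hact : ∀ b x, E.act b (j x) = j (b • x))
    (hop : ∀ g x, E.op g (j x) = (s.toFun g)⁻¹ • j x) :
    ∃ f : (CovariantRep.outerTensor (Algebra.lsmul ℂ ℂ M : B →ₐ[ℂ] Module.End ℂ M)
        (CovariantRep.twistedDual α s.Line)).Space
          →ₗ[CrossedProduct (1 : G →* (B ≃ₐ[ℂ] B)) α] E.Space,
      ∀ x : M ⊗[ℂ] Module.Dual ℂ s.Line, f x = TensorProduct.lift ((LinearMap.lsmul ℂ W).flip.compl₂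
        (Module.Dual.eval ℂ s.Line ((RepSpace.toSpace s.rep.toHom).symm 1)) ∘ₗ j) x := by
  set D := CovariantRep.outerTensor (Algebra.lsmul ℂ ℂ M : B →ₐ[ℂ] Module.End ℂ M)
        (CovariantRep.twistedDual α s.Line) with hDdef
  set f₀ := TensorProduct.lift ((LinearMap.lsmul ℂ W).flip.compl₂
    (Module.Dual.eval ℂ s.Line ((RepSpace.toSpace s.rep.toHom).symm 1)) ∘ₗ j) with hf
  have hf₀ : ∀ x φ, f₀ (x ⊗ₜ φ) = φ ((RepSpace.toSpace s.rep.toHom).symm 1) • j x :=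
    fun x φ => rfl
  have hD : ∀ g b x φ, D.act b (D.op g (x ⊗ₜ φ)) = (b • x) ⊗ₜ ((s.toFun g)⁻¹ • φ) := by
    intro g b x φ
    have h1 : (CovariantRep.twistedDual α s.Line).op g φ = (s.toFun g)⁻¹ • φ := by
      refine LinearMap.ext fun y => ?_
      change φ ((((TwistedGroupAlgebra.basisUnit α⁻¹ g)⁻¹ : (TwistedGroupAlgebra α⁻¹)ˣ) :
        TwistedGroupAlgebra α⁻¹) • y) = _
      rw [s.inv_basisUnit_smul, map_smul, LinearMap.smul_apply]
    rw [← h1]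
    rfl
  have hlin : ∀ (a : CrossedProduct (1 : G →* (B ≃ₐ[ℂ] B)) α) (w : M ⊗[ℂ] Module.Dual ℂ s.Line),
      f₀ (D.toHom a w) = E.toHom a (f₀ w) := by
    intro a w
    induction a using CrossedProduct.induction with
    | h0 => simp only [map_zero, LinearMap.zero_apply]
    | hadd a b ha hb => simp only [map_add, LinearMap.add_apply, ha, hb]
    | hs g b =>
      change f₀ (D.toLin _ w) = E.toLin _ (f₀ w)
      rw [CovariantRep.toLin_single, CovariantRep.toLin_single]
      induction w using TensorProduct.induction_on with
      | zero => simp only [map_zero]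
      | add x y hx hy => simp only [map_add, hx, hy]
      | tmul x φ =>
        rw [hD, hf₀, hf₀, map_smul (E.op g), hop, map_smul (E.act b), map_smul (E.act b), hact,
          LinearMap.smul_apply, smul_eq_mul, mul_smul, smul_comm]
  exact ⟨{ toFun := f₀, map_add' := map_add f₀, map_smul' := hlin }, fun x => rfl⟩

/-- If `W` is the direct sum of submodules on which the group acts by scalars, then it is the sum of
their tensor products with the duals of the corresponding lines. -/
theorem nonempty_equiv_directSum {ι : Type} [Fintype ι] [DecidableEq ι]
    (E : CovariantRep (1 : G →* (B ≃ₐ[ℂ] B)) α W) (M : ι → Type) [∀ l, AddCommGroup (M l)]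
    [∀ l, Module ℂ (M l)] [∀ l, Module B (M l)] [∀ l, IsScalarTower ℂ B (M l)]
    (s : ι → Trivialization α⁻¹) (j : ∀ l, M l →ₗ[ℂ] W) (P : ∀ l, W →ₗ[ℂ] M l)
    (hact : ∀ l b x, E.act b (j l x) = j l (b • x))
    (hop : ∀ l g x, E.op g (j l x) = ((s l).toFun g)⁻¹ • j l x)
    (hsum : ∀ w, ∑ l, j l (P l w) = w) (hself : ∀ l x, P l (j l x) = x)
    (hne : ∀ l m x, l ≠ m → P l (j m x) = 0) :
    Nonempty (E.Space ≃ₗ[CrossedProduct (1 : G →* (B ≃ₐ[ℂ] B)) α]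
      ⨁ l, (CovariantRep.outerTensor (Algebra.lsmul ℂ ℂ (M l) : B →ₐ[ℂ] Module.End ℂ (M l))
        (CovariantRep.twistedDual α (s l).Line)).Space) := by
  choose f hf using fun l => exists_outerTensor_hom E (s l) (j l) (hact l) (hop l)
  -- The inverse on the l-th summand tensors the projection with the coordinate functional of the
  -- line.
  let g₀ : ∀ l, W →ₗ[ℂ] M l ⊗[ℂ] Module.Dual ℂ (s l).Line := fun l =>
    (TensorProduct.mk ℂ (M l) (Module.Dual ℂ (s l).Line)).flip
      (RepSpace.toSpace (s l).rep.toHom : (s l).Line →ₗ[ℂ] ℂ) ∘ₗ P l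
  have hg : ∀ l m x φ, g₀ l (TensorProduct.lift ((LinearMap.lsmul ℂ W).flip.compl₂
      (Module.Dual.eval ℂ (s m).Line ((RepSpace.toSpace (s m).rep.toHom).symm 1)) ∘ₗ j m)
        (x ⊗ₜ φ)) = P l (j m x) ⊗ₜ (φ ((RepSpace.toSpace (s m).rep.toHom).symm 1) •
          (RepSpace.toSpace (s l).rep.toHom : (s l).Line →ₗ[ℂ] ℂ)) := by
    intro l m x φ
    change P l (φ ((RepSpace.toSpace (s m).rep.toHom).symm 1) • j m x) ⊗ₜ[ℂ] _ = _
    rw [map_smul, TensorProduct.smul_tmul]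
  refine nonempty_equiv_directSum_of_maps f (fun l => (g₀ l).toAddMonoidHom) ?_ ?_ ?_
  · intro w
    refine Eq.trans (Finset.sum_congr rfl fun l _ => ?_) (hsum w)
    refine (hf l (g₀ l w)).trans ?_
    exact one_smul ℂ (j l (P l w))
  · intro l x
    refine (congrArg (g₀ l) (hf l x)).trans ?_
    refine TensorProduct.induction_on (motive := fun x => g₀ l (TensorProduct.lift _ x) = x) x ?_ ?_ ?_
    · simp only [map_zero]
    · intro x φ
      rw [hg, hself, ← (s l).dual_eq_smul]
    · intro x y hx hy
      rw [map_add, map_add, hx, hy]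
  · intro l m x hlm
    refine (congrArg (g₀ l) (hf m x)).trans ?_
    refine TensorProduct.induction_on (motive := fun x => g₀ l (TensorProduct.lift _ x) = 0) x ?_ ?_ ?_
    · simp only [map_zero]
    · intro x φ
      rw [hg, hne l m x hlm, TensorProduct.zero_tmul]
    · intro x y hx hy
      rw [map_add, map_add, hx, hy, add_zero]

end Decomposition

/-! ### Module structures over twisted skew group algebras -/

section Twisted

variable {p d n : ℕ} [NeZero p] {ξ : ℂ} {v : Fin d → ℂ} {q : ℂ}
  {ρ : ∀ lam : MultiDiagram p d n, HeckeR1n p n ξ v q →ₐ[ℂ] Module.End ℂ (V lam)}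

/-- Endomorphisms of the seminormal modules are scalar. -/
lemma exists_eq_smul_of_commute (hρ : ∀ lam, IsSeminormal lam (ρ lam)) (hS : Separated p n ξ v q)
    {lam : MultiDiagram p d n} (A : V lam →ₗ[ℂ] V lam)
    (hA : ∀ h x, A (ρ lam h x) = ρ lam h (A x)) : ∃ c : ℂ, ∀ x, A x = c • x := by
  obtain ⟨t⟩ := (inferInstance : Nonempty (StdTableau lam))
  -- Matrix units from t to s carry this one coefficient to every basis vector v(s).
  refine ⟨A (Finsupp.single t 1) t, fun x => ?_⟩
  induction x using Finsupp.induction_linear with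
  | zero => simp
  | add x y hx hy => rw [map_add, hx, hy, smul_add]
  | single s c =>
    obtain ⟨h, hh⟩ := exists_isMatrixUnit hρ hS s t
    have h1 := hA h (Finsupp.single t 1)
    rw [hh.apply, hh.apply, Finsupp.single_eq_same, one_smul] at h1
    have h2 : (Finsupp.single s c : V lam) = c • Finsupp.single s 1 := by simp
    rw [h2, map_smul, h1, smul_comm]

/-- Both operators intertwine the action with the same automorphism, so their quotient commutes with
the algebra and is scalar. -/
lemma exists_op_eq_smul_shiftOp (hξ : IsPrimitiveRoot ξ p)
    (hρ : ∀ lam, IsSeminormal lam (ρ lam)) (hS : Separated p n ξ v q)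
    {lam : MultiDiagram p d n} {α : TwoCocycle (stab lam)}
    (F : CovariantRep (stabAut hξ v q lam) α (V lam)) (hF : F.act = ρ lam) (g : stab lam) :
    ∃ c : ℂ, ∀ x, F.op g x = c • shiftOp g x := by
  obtain ⟨c, hc⟩ := exists_eq_smul_of_commute hρ hS
    ((F.op g : V lam →ₗ[ℂ] V lam) ∘ₗ ((shiftOp g).symm : V lam →ₗ[ℂ] V lam)) (fun h x => by
      obtain ⟨k, rfl⟩ := (stabAut hξ v q lam g).surjective h
      obtain ⟨y, rfl⟩ := (shiftOp g).surjective x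
      rw [← shiftOp_act hξ (hρ lam)]
      simp only [LinearMap.comp_apply, LinearEquiv.coe_coe, LinearEquiv.symm_apply_apply]
      rw [← hF, F.op_act])
  refine ⟨c, fun x => ?_⟩
  have := hc (shiftOp g x)
  simpa only [LinearMap.comp_apply, LinearEquiv.coe_coe, LinearEquiv.symm_apply_apply] using this

/-- An extension of the seminormal module to a twisted skew group algebra trivializes the
cocycle. -/
lemma exists_trivialization (hξ : IsPrimitiveRoot ξ p)
    (hρ : ∀ lam, IsSeminormal lam (ρ lam)) (hS : Separated p n ξ v q)
    {lam : MultiDiagram p d n} {α : TwoCocycle (stab lam)}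
    (F : CovariantRep (stabAut hξ v q lam) α (V lam)) (hF : F.act = ρ lam) :
    ∃ c : Trivialization α, ∀ g x, F.op g x = c.toFun g • shiftOp g x := by
  choose c hc using exists_op_eq_smul_shiftOp hξ hρ hS F hF
  obtain ⟨x, hx⟩ := exists_ne (0 : V lam)
  refine ⟨⟨c, fun g h0 => ?_, fun g h => ?_⟩, hc⟩
  · have := hc g x
    rw [h0, zero_smul] at this
    exact hx ((F.op g).map_eq_zero_iff.1 this)
  · have h1 := F.op_mul g h x
    rw [hc h, map_smul, hc g, hc (g * h), shiftOp_mul, smul_smul, smul_smul, mul_comm (c h)] at h1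
    exact smul_left_injective ℂ ((shiftOp (g * h)).map_ne_zero_iff.2 hx) h1

/-- The trivialization `(c chi ^ l)⁻¹` of `α⁻¹`. -/
noncomputable def Trivialization.invTwist (hξ : IsPrimitiveRoot ξ p) {lam : MultiDiagram p d n}
    {α : TwoCocycle (stab lam)} (c : Trivialization α) (l : ℕ) : Trivialization α⁻¹ where
  toFun g := (c.toFun g * chi ξ (g : CycGroup p) ^ l)⁻¹
  ne_zero g := inv_ne_zero (mul_ne_zero (c.ne_zero g)
    (pow_ne_zero _ (chi_ne_zero hξ.pow_eq_one _)))
  mul g h := by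
    rw [TwoCocycle.inv_apply, Units.val_inv_eq_inv_val, ← mul_inv, ← mul_inv, Subgroup.coe_mul,
      chi_mul hξ.pow_eq_one, mul_pow, ← mul_assoc (α g h : ℂ), ← c.mul]
    congr 1
    ring

/-- The decomposition of the seminormal module over a twisted skew group algebra. -/
theorem exists_decomposition (hξ : IsPrimitiveRoot ξ p)
    (hρ : ∀ lam, IsSeminormal lam (ρ lam)) (hS : Separated p n ξ v q)
    {lam : MultiDiagram p d n} {α : TwoCocycle (stab lam)}
    (F : CovariantRep (stabAut hξ v q lam) α (V lam)) (hF : F.act = ρ lam) :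
    ∃ (π : Finset.Icc 1 (eNum lam) → Type) (_ : ∀ l, AddCommGroup (π l))
      (_ : ∀ l, Module ℂ (π l)) (_ : ∀ l, Module (TwistedGroupAlgebra α⁻¹) (π l))
      (_ : ∀ l, IsScalarTower ℂ (TwistedGroupAlgebra α⁻¹) (π l)),
      (∀ l, IsSimpleModule (TwistedGroupAlgebra α⁻¹) (π l)) ∧
      (∀ l m, Nonempty (π l ≃ₗ[TwistedGroupAlgebra α⁻¹] π m) → l = m) ∧
      (∀ (M : Type) [AddCommGroup M] [Module (TwistedGroupAlgebra α⁻¹) M],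
        IsSimpleModule (TwistedGroupAlgebra α⁻¹) M →
        ∃ l, Nonempty (M ≃ₗ[TwistedGroupAlgebra α⁻¹] π l)) ∧
      Nonempty
        ((F.restrictFixed (heckeRpn p n ξ v q)
            (fun g s hs => heckeAut_fixes hξ v q (g : CycGroup p) s hs)).Space
          ≃ₗ[CrossedProduct
              (1 : stab lam →* (heckeRpn p n ξ v q ≃ₐ[ℂ] heckeRpn p n ξ v q)) α]
          ⨁ l : Finset.Icc 1 (eNum lam),
            (CovariantRep.outerTensor
              (Algebra.lsmul ℂ ℂ (arikiModule hξ (hρ lam) (l : ℕ)) :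
                heckeRpn p n ξ v q →ₐ[ℂ]
                  Module.End ℂ (arikiModule hξ (hρ lam) (l : ℕ)))
              (CovariantRep.twistedDual α (π l))).Space) := by
  have := Fintype.ofFinite (stab lam)
  obtain ⟨c, hc⟩ := exists_trivialization hξ hρ hS F hF
  -- On weight l the element g acts by c χ^l. The line must carry the inverse, so that dualizing
  -- returns this scalar.
  refine ⟨fun l => (c.invTwist hξ (l : ℕ)).Line, inferInstance, inferInstance, inferInstance,
    inferInstance, fun l => (c.invTwist hξ (l : ℕ)).isSimpleModule_line, ?_, ?_, ?_⟩
  · rintro l m ⟨φ⟩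
    refine Subtype.ext (eq_of_chi_pow_eq hξ l.2 m.2 fun g => ?_)
    have h1 := inv_injective (Trivialization.toFun_eq_of_equiv φ g)
    exact mul_left_cancel₀ (c.ne_zero g) h1
  · intro M _ _ hM
    obtain ⟨l, hl, h⟩ := Trivialization.exists_equiv_line (Finset.Icc 1 (eNum lam))
      (fun l => c.invTwist hξ l) (Finset.nonempty_Icc.2 (eNum_pos lam)) (fun g hg => by
        -- The idempotents here involve χ^l instead of its inverse, so orthogonality is applied at
        -- g⁻¹.
        have h1 := sum_chi_pow_inv hξ g⁻¹ (inv_ne_one.2 hg)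
        have h2 : ∀ l : ℕ, (chi ξ ((g⁻¹ : stab lam) : CycGroup p) ^ l)⁻¹ =
            chi ξ (g : CycGroup p) ^ l := by
          intro l
          apply inv_eq_of_mul_eq_one_left
          rw [← mul_pow, ← chi_mul hξ.pow_eq_one, ← Subgroup.coe_mul, mul_inv_cancel,
            Subgroup.coe_one, chi_one, one_pow]
        simp only [h2] at h1
        simp only [Trivialization.invTwist, inv_inv, ← Finset.mul_sum, h1, mul_zero]) M
    exact ⟨⟨l, hl⟩, h⟩
  · refine nonempty_equiv_directSum (ι := Finset.Icc 1 (eNum lam)) _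
      (fun l => arikiModule hξ (hρ lam) (l : ℕ)) (fun l => c.invTwist hξ (l : ℕ))
      (fun l => { toFun x := RepSpace.toSpace (ρ lam) x.1
                  map_add' _ _ := rfl
                  map_smul' _ _ := rfl })
      (fun l => { toFun x := ⟨(RepSpace.toSpace (ρ lam)).symm (weightProj ξ lam l x),
                    isWeight_weightProj hξ l _⟩
                  map_add' x y := Subtype.ext (map_add (weightProj ξ lam l) x y)
                  map_smul' a x := Subtype.ext (map_smul (weightProj ξ lam l) a x) })
      ?_ ?_ ?_ ?_ ?_
    · intro l b x
      change F.act b _ = _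
      rw [hF]
      rfl
    · intro l g x
      change F.op g (RepSpace.toSpace (ρ lam) x.1) =
        ((c.toFun g * chi ξ (g : CycGroup p) ^ (l : ℕ))⁻¹)⁻¹ • RepSpace.toSpace (ρ lam) x.1
      rw [hc, x.2 g, smul_smul, inv_inv]
    · intro w
      refine Eq.trans ?_ (sum_weightProj hξ w)
      exact Finset.sum_coe_sort (Finset.Icc 1 (eNum lam)) (fun l => weightProj ξ lam l w)
    · exact fun l x => Subtype.ext (weightProj_of_isWeight hξ x.2)
    · exact fun l m x hlm => Subtype.ext (weightProj_of_isWeight_ne hξ l.2 m.2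
        (fun h => hlm (Subtype.ext h)) x.2)

end Twisted

end CyclotomicHecke

theorem mainTheorem8 (p d n : ℕ) [NeZero p] (hn : 0 < n)
    (q : ℂ) (hq : q ≠ 0) (ξ : ℂ) (hξ : IsPrimitiveRoot ξ p)
    (v : Fin d → ℂ) (hv : ∀ j, v j ≠ 0) (hvp : ∀ i j, i ≠ j → v i ^ p ≠ v j ^ p)
    (hss : IsSemisimpleRing (HeckeR1n p n ξ v q)) :
    ∃ (ρ : ∀ lam : MultiDiagram p d n, HeckeR1n p n ξ v q →ₐ[ℂ] Module.End ℂ (V lam))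
      (hρ : ∀ lam, IsSeminormal lam (ρ lam)),
      ∀ lam : MultiDiagram p d n,
        -- `V(lam)` is a simple module of `H_{r,1,n}`
        IsSimpleModule (HeckeR1n p n ξ v q) (RepSpace (ρ lam)) ∧
        -- the `V(λ̄, l)`, `1 ≤ l ≤ e`, are irreducible and pairwise non-isomorphic
        (∀ l ∈ Finset.Icc 1 (eNum lam),
          IsSimpleModule (heckeRpn p n ξ v q) (arikiModule hξ (hρ lam) l)) ∧
        (∀ l ∈ Finset.Icc 1 (eNum lam), ∀ m ∈ Finset.Icc 1 (eNum lam),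
          Nonempty (arikiModule hξ (hρ lam) l ≃ₗ[heckeRpn p n ξ v q]
            arikiModule hξ (hρ lam) m) → l = m) ∧
        -- they depend only on the cyclic equivalence class of `lam`
        (∀ (g : CycGroup p) (l : ℕ),
          Nonempty (arikiModule hξ (hρ lam) l ≃ₗ[heckeRpn p n ξ v q]
            arikiModule hξ (hρ (g • lam)) l)) ∧
        -- `V(lam)` is an `H_{r,1,n} ⋊ G_lam`-module through the shift operators
        (∃ F : CovariantRep (stabAut hξ v q lam) 1 (V lam), F.act = ρ lam ∧ F.op = shiftOp) ∧
        -- the decomposition, for every `H_{r,1,n} ⋊_α G_lam`-module structure extending `V(lam)`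
        ∀ (α : TwoCocycle (stab lam)) (F : CovariantRep (stabAut hξ v q lam) α (V lam)),
          F.act = ρ lam →
          ∃ (π : Finset.Icc 1 (eNum lam) → Type) (_ : ∀ l, AddCommGroup (π l))
            (_ : ∀ l, Module ℂ (π l)) (_ : ∀ l, Module (TwistedGroupAlgebra α⁻¹) (π l))
            (_ : ∀ l, IsScalarTower ℂ (TwistedGroupAlgebra α⁻¹) (π l)),
            -- the `π_l` form a complete list of the simple modules of `(ℂ G_lam)_{α⁻¹}`
            (∀ l, IsSimpleModule (TwistedGroupAlgebra α⁻¹) (π l)) ∧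
            (∀ l m, Nonempty (π l ≃ₗ[TwistedGroupAlgebra α⁻¹] π m) → l = m) ∧
            (∀ (M : Type) [AddCommGroup M] [Module (TwistedGroupAlgebra α⁻¹) M],
              IsSimpleModule (TwistedGroupAlgebra α⁻¹) M →
              ∃ l, Nonempty (M ≃ₗ[TwistedGroupAlgebra α⁻¹] π l)) ∧
            -- `V(lam) ≅ ⨁ V(λ̄, l) ⊗ π_l^*` as `H_{r,p,n} ⋊_α G_lam`-modules
            Nonempty
              ((F.restrictFixed (heckeRpn p n ξ v q)
                  (fun g s hs => heckeAut_fixes hξ v q (g : CycGroup p) s hs)).Space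
                ≃ₗ[CrossedProduct
                    (1 : stab lam →* (heckeRpn p n ξ v q ≃ₐ[ℂ] heckeRpn p n ξ v q)) α]
                ⨁ l : Finset.Icc 1 (eNum lam),
                  (CovariantRep.outerTensor
                    (Algebra.lsmul ℂ ℂ (arikiModule hξ (hρ lam) (l : ℕ)) :
                      heckeRpn p n ξ v q →ₐ[ℂ]
                        Module.End ℂ (arikiModule hξ (hρ lam) (l : ℕ)))
                    (CovariantRep.twistedDual α (π l))).Space) := by
  -- A multi-diagram of positive size forces d > 0, which supplies the parameter used in the
  -- argument about q-integers; without multi-diagrams there is nothing to construct.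
  by_cases hne : Nonempty (MultiDiagram p d n)
  · have hd : 0 < d := by
      obtain ⟨lam⟩ := hne
      apply Nat.pos_of_ne_zero
      rintro rfl
      have := lam.size
      simp only [Finset.univ_eq_empty, Finset.sum_empty, Finset.sum_const_zero] at this
      omega
    have hS := separated_of_semisimple hd hq hξ hv hss
    choose ρ hρ using fun lam : MultiDiagram p d n => exists_seminormal hξ hS lam
    exact ⟨ρ, hρ, fun lam => ⟨isSimpleModule_seminormal hρ hS lam,
      fun l _ => isSimpleModule_arikiModule hn hξ hv hρ hS lam l,
      fun l hl m hm ⟨φ⟩ => eq_of_arikiModule_equiv hn hξ hv hρ hS hl hm φ,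
      fun g l => nonempty_arikiModule_equiv hξ hρ lam g l,
      ⟨shiftRep hξ (hρ lam), rfl, rfl⟩,
      fun α F hF => exists_decomposition hξ hρ hS F hF⟩⟩
  · rw [not_nonempty_iff] at hne
    exact ⟨fun lam => hne.elim lam, fun lam => hne.elim lam, fun lam => hne.elim lam⟩
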